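/- Let $\mathfrak g$ be a finite-dimensional simple complex Lie algebra with Cartan subalgebra $\mathfrak h$ and positive part $\mathfrak n_+$ (the sum of the positive root spaces for a chosen base). Let $\hat{\mathfrak g}=\mathfrak g\otimes\mathbb C[t^{\pm1}]\oplus\mathbb CK$ with $K$ central and $[x\otimes t^m,y\otimes t^n]=[x,y]\otimes t^{m+n}+m\,\delta_{m+n,0}(x|y)K$, where $(\cdot|\cdot)$ is the Killing form, and let $\tilde{\mathfrak g}=\hat{\mathfrak g}\oplus\mathbb Cd$ with $[d,x\otimes t^m]=m\,x\otimes t^m$, $[d,K]=0$. Put $\hat{\mathfrak h}=\mathfrak h\oplus\mathbb CK$ and $\tilde{\mathfrak n}_+=\mathfrak n_+\oplus(\mathfrak g\otimes t\mathbb C[t])$. For a $\hat{\mathfrak g}$-module $M$ let $M[d]=\operatorname{Ind}_{\hat{\mathfrak g}}^{\tilde{\mathfrak g}}M=U(\tilde{\mathfrak g})\otimes_{U(\hat{\mathfrak g})}M$. For $\lambda=(\lambda_1,\dots,\lambda_m)\in(\mathfrak h^*)^m$ and pairwise distinct nonzero $a_1,\dots,a_m\in\mathbb C$, let $E(\lambda,a)=V(\lambda_1)\otimes\cdots\otimes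 V(\lambda_m)$, where $V(\lambda_i)$ is the irreducible highest weight $\mathfrak g$-module of highest weight $\lambda_i$, $x\otimes t^k$ acts as $\sum_i a_i^k\,(1\otimes\cdots\otimes x\otimes\cdots\otimes1)$ ($x$ in the $i$-th factor) and $K$ acts as $0$. A highest weight vector of weight $\gamma\in\hat{\mathfrak h}^*$ in a $\hat{\mathfrak g}$-module is a nonzero vector $v$ with $hv=\gamma(h)v$ for $h\in\hat{\mathfrak h}$ and $\tilde{\mathfrak n}_+v=0$; a highest weight $\hat{\mathfrak g}$-module of highest weight $\gamma$ is one generated by such a vector. Let $V(\gamma)$ denote the irreducible highest weight $\hat{\mathfrak g}$-module of highest weight $\gamma$ whose action extends to $\tilde{\mathfrak g}$ with $d$ annihilating a highest weight vector of weight $\gamma$ (that is, the restriction to $\hat{\mathfrak g}$ of an irreducible highest weight $\tilde{\mathfrak g}$-module). For a nonzero Lie algebra homomorphism $\eta:\tilde{\mathfrak n}_+\to\mathbb C$ let $W(\eta)$ denote any irreducible $\hat{\mathfrak g}$-module generated by a nonzero vector $w$ with $xw=\eta(x)w$ for all $x\in\tilde{\mathfrak n}_+$. Let $\lambda\in(\mathfrak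 h^*)^m\setminus\{0\}$, $\lambda'\in(\mathfrak h^*)^{m'}$, let $a\in(\mathbb C^*)^m$ and $a'\in(\mathbb C^*)^{m'}$ each have pairwise distinct entries, let $\gamma,\gamma'\in\hat{\mathfrak h}^*$, and let $\eta,\eta':\tilde{\mathfrak n}_+\to\mathbb C$ be nonzero Lie algebra homomorphisms. Then: 1. $(E(\lambda,a)\otimes V)[d]$ and $(E(\lambda',a')\otimes W(\eta))[d]$ are not isomorphic as $\tilde{\mathfrak g}$-modules, for any irreducible highest weight $\hat{\mathfrak g}$-module $V$, in particular for $V=V(\gamma)$. 2. $(E(\lambda,a)\otimes V(\gamma))[d]\cong(E(\lambda',a')\otimes V(\gamma'))[d]$ as $\tilde{\mathfrak g}$-modules if and only if $E(\lambda,a)\cong E(\lambda',a')$ as $\hat{\mathfrak g}$-modules and $\gamma=\gamma'$. More generally, for arbitrary irreducible highest weight $\hat{\mathfrak g}$-modules $V,V'$, one has $(E(\lambda,a)\otimes V)[d]\cong(E(\lambda',a')\otimes V')[d]$ if and only if $E(\lambda,a)\cong E(\lambda',a')$ and $V\cong V'$ as $\hat{\mathfrak g}$-modules. 3. $(E(\lambda,a)\otimes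 W(\eta))[d]\cong(E(\lambda',a')\otimes W(\eta'))[d]$ as $\tilde{\mathfrak g}$-modules if and only if $E(\lambda,a)\cong E(\lambda',a')$ and $W(\eta)\cong W(\eta')$ as $\hat{\mathfrak g}$-modules. -/

import Mathlib

open scoped TensorProduct

universe uG uE uE' uV uV'

noncomputable section

namespace Affine

/- Associative algebras (endomorphism rings, enveloping algebras, `ℂ`) carry the commutator
bracket. -/
attribute [local instance 100] LieRing.ofAssociativeRing

/-! ### Generic notions for modules over a complex Lie algebra -/

section Generic

variable {G : Type*} [LieRing G] [LieAlgebra ℂ G]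

/-- `v` is a highest weight vector of weight `γ`, relative to the subalgebras `HH` (Cartan part)
and `NN` (positive part) of `G`. -/
structure IsHighestWeightVector (HH NN : LieSubalgebra ℂ G) (γ : Module.Dual ℂ HH)
    {M : Type*} [AddCommGroup M] [Module ℂ M] [LieRingModule G M] (v : M) : Prop where
  ne_zero : v ≠ 0
  weight : ∀ x : HH, ⁅(x : G), v⁆ = γ x • v
  annihilated : ∀ x ∈ NN, ⁅x, v⁆ = 0

/-- `M` is an irreducible highest weight module of highest weight `γ`: it is irreducible and it is
generated by a highest weight vector of weight `γ`. -/
structure IsIrredHighestWeight (HH NN : LieSubalgebra ℂ G) (γ : Module.Dual ℂ HH)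
    (M : Type*) [AddCommGroup M] [Module ℂ M] [LieRingModule G M] : Prop where
  irreducible : LieModule.IsIrreducible ℂ G M
  generated : ∃ v : M, IsHighestWeightVector HH NN γ v ∧ LieSubmodule.lieSpan ℂ G {v} = ⊤

/-- `M` is an irreducible Whittaker module of type `η : NN → ℂ`: it is irreducible and it is
generated by a nonzero vector on which each `x ∈ NN` acts as the scalar `η x`. -/
structure IsIrredWhittaker (NN : LieSubalgebra ℂ G) (η : LieAlgebra.LieCharacter ℂ NN)
    (M : Type*) [AddCommGroup M] [Module ℂ M] [LieRingModule G M] : Prop where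
  irreducible : LieModule.IsIrreducible ℂ G M
  generated : ∃ v : M, v ≠ 0 ∧ (∀ x : NN, ⁅(x : G), v⁆ = η x • v) ∧
    LieSubmodule.lieSpan ℂ G {v} = ⊤

end Generic

/-! ### Induced modules -/

section Induced

variable {G G' : Type*} [LieRing G] [LieAlgebra ℂ G] [LieRing G'] [LieAlgebra ℂ G']
  (f : G →ₗ⁅ℂ⁆ G') (M : Type*) [AddCommGroup M] [Module ℂ M] [LieRingModule G M]

/-- The `U(G')`-submodule of `U(G') ⊗ M` (tensor product over `ℂ`) generated by all
`f x ⊗ m - 1 ⊗ x m`; thus it is spanned by all `u (f x) ⊗ m - u ⊗ x m`. -/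
def inducedRelations :
    Submodule (UniversalEnvelopingAlgebra ℂ G') (UniversalEnvelopingAlgebra ℂ G' ⊗[ℂ] M) :=
  Submodule.span _ {z | ∃ (x : G) (m : M),
    z = (UniversalEnvelopingAlgebra.ι ℂ (f x)) ⊗ₜ[ℂ] m - 1 ⊗ₜ[ℂ] ⁅x, m⁆}

/-- The `G'`-module `U(G') ⊗_{U(G)} M` induced from the `G`-module `M` along `f : G → G'`. -/
def Induced : Type _ :=
  (UniversalEnvelopingAlgebra ℂ G' ⊗[ℂ] M) ⧸ inducedRelations f M

instance : AddCommGroup (Induced f M) :=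
  inferInstanceAs (AddCommGroup (_ ⧸ inducedRelations f M))

instance : Module (UniversalEnvelopingAlgebra ℂ G') (Induced f M) :=
  inferInstanceAs (Module (UniversalEnvelopingAlgebra ℂ G') (_ ⧸ inducedRelations f M))

instance : Module ℂ (Induced f M) :=
  inferInstanceAs (Module ℂ (_ ⧸ inducedRelations f M))

instance : IsScalarTower ℂ (UniversalEnvelopingAlgebra ℂ G') (Induced f M) :=
  inferInstanceAs (IsScalarTower ℂ (UniversalEnvelopingAlgebra ℂ G') (_ ⧸ inducedRelations f M))

/-- `y ∈ G'` acts as left multiplication by its image in `U(G')`. -/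
instance : LieRingModule G' (Induced f M) where
  bracket y w := UniversalEnvelopingAlgebra.ι ℂ y • w
  add_lie x y w := by
    change UniversalEnvelopingAlgebra.ι ℂ (x + y) • w = _
    rw [map_add, add_smul]
  lie_add x w w' := smul_add _ w w'
  leibniz_lie x y w := by
    change UniversalEnvelopingAlgebra.ι ℂ x • UniversalEnvelopingAlgebra.ι ℂ y • w =
      UniversalEnvelopingAlgebra.ι ℂ ⁅x, y⁆ • w +
        UniversalEnvelopingAlgebra.ι ℂ y • UniversalEnvelopingAlgebra.ι ℂ x • w
    rw [LieHom.map_lie, LieRing.of_associative_ring_bracket, sub_smul, mul_smul, mul_smul]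
    abel

instance : LieModule ℂ G' (Induced f M) where
  smul_lie c x w := by
    change UniversalEnvelopingAlgebra.ι ℂ (c • x) • w = c • UniversalEnvelopingAlgebra.ι ℂ x • w
    rw [map_smul, smul_assoc]
  lie_smul c x w := by
    change UniversalEnvelopingAlgebra.ι ℂ x • c • w = c • UniversalEnvelopingAlgebra.ι ℂ x • w
    exact smul_algebra_smul_comm c _ w

end Induced

/-! ### The Lie algebras `ĝ = g ⊗ ℂ[t, t⁻¹] ⊕ ℂ K` and `g̃ = ĝ ⊕ ℂ d` -/

section Algebras

variable (g : Type*) [LieRing g] [LieAlgebra ℂ g]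

/-- The 2-cocycle of the central extension. Mathlib's `twoCocycleOfBilinear` sends
`(x ⊗ t^m, y ⊗ t^n)` to `n Φ(x, y) δ_{m+n,0} = - m Φ(x, y) δ_{m+n,0}`, so `Φ` is minus the Killing
form; see `lie_loopElem`. -/
def cocycle := LieAlgebra.LoopAlgebra.twoCocycleOfBilinear ℂ ℤ g (-killingForm ℂ g)
  (fun x y z => by
    have h := LieModule.traceForm_lieInvariant ℂ g g x y z
    simp only [LinearMap.neg_apply]
    exact congrArg Neg.neg h)
  ⟨fun x y => by
    simp only [LinearMap.neg_apply]
    exact congrArg Neg.neg (LieModule.traceForm_comm ℂ g g x y)⟩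

/-- `ĝ = g ⊗ ℂ[t, t⁻¹] ⊕ ℂ K`. -/
abbrev Hat : Type _ := LieAlgebra.ofTwoCocycle (cocycle g)

/-- Components of an element of `ĝ`: its loop part and the coefficient of `K`. -/
def hatEquiv : Hat g ≃ₗ[ℂ] (LieAlgebra.loopAlgebra ℂ ℤ g × ℂ) where
  toFun z := (((LieAlgebra.ofProd (cocycle g)).symm z).1,
    TrivialLieModule.equiv ℂ (LieAlgebra.loopAlgebra ℂ ℤ g) ℂ
      ((LieAlgebra.ofProd (cocycle g)).symm z).2)
  invFun p := LieAlgebra.ofProd (cocycle g)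
    (p.1, (TrivialLieModule.equiv ℂ (LieAlgebra.loopAlgebra ℂ ℤ g) ℂ).symm p.2)
  map_add' _ _ := by simp
  map_smul' _ _ := by simp
  left_inv _ := rfl
  right_inv _ := rfl

variable {g} in
/-- The element `x ⊗ t^k` of `ĝ`. -/
def loopElem (x : g) (k : ℤ) : Hat g :=
  (hatEquiv g).symm (AddMonoidAlgebra.single k 1 ⊗ₜ[ℂ] x, 0)

/-- The central element `K` of `ĝ`. -/
def central : Hat g := (hatEquiv g).symm (0, 1)

variable {g}

lemma hatEquiv_lie (z w : Hat g) :
    hatEquiv g ⁅z, w⁆ = (⁅(hatEquiv g z).1, (hatEquiv g w).1⁆,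
      LieAlgebra.LoopAlgebra.residuePairing ℂ ℤ g (-killingForm ℂ g)
        (hatEquiv g z).1 (hatEquiv g w).1) := by
  refine Prod.ext rfl ?_
  change TrivialLieModule.equiv ℂ (LieAlgebra.loopAlgebra ℂ ℤ g) ℂ
    ((TrivialLieModule.equiv ℂ (LieAlgebra.loopAlgebra ℂ ℤ g) ℂ).symm
      (LieAlgebra.LoopAlgebra.residuePairing ℂ ℤ g (-killingForm ℂ g)
        (hatEquiv g z).1 (hatEquiv g w).1) +
      ⁅((LieAlgebra.ofProd (cocycle g)).symm z).1, ((LieAlgebra.ofProd (cocycle g)).symm w).2⁆ -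
      ⁅((LieAlgebra.ofProd (cocycle g)).symm w).1, ((LieAlgebra.ofProd (cocycle g)).symm z).2⁆) = _
  rw [LieModule.IsTrivial.trivial, LieModule.IsTrivial.trivial, add_zero, sub_zero,
    LinearEquiv.apply_symm_apply]

/-- `[x ⊗ t^m, y ⊗ t^n] = [x, y] ⊗ t^(m+n) + m (x | y) δ_{m+n,0} K`. -/
lemma lie_loopElem (x y : g) (m n : ℤ) :
    ⁅loopElem x m, loopElem y n⁆ =
      loopElem ⁅x, y⁆ (m + n) +
        (if m + n = 0 then (m : ℂ) * killingForm ℂ g x y else 0) • central g := by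
  apply (hatEquiv g).injective
  rw [hatEquiv_lie]
  simp only [loopElem, central, map_add, map_smul, LinearEquiv.apply_symm_apply]
  refine Prod.ext ?_ ?_
  · rw [LieAlgebra.ExtendScalars.bracket_tmul, AddMonoidAlgebra.single_mul_single, one_mul]
    simp only [Prod.fst_add, Prod.smul_fst, smul_zero, add_zero]
  · simp only [LieAlgebra.LoopAlgebra.residuePairing_apply_apply,
      LieAlgebra.LoopAlgebra.toFinsupp_single_tmul]
    rw [Finsupp.sum_single_index (by simp)]
    by_cases h : m + n = 0
    · obtain rfl : n = -m := by omega
      simp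
    · have : m ≠ -n := fun h' => h (by omega)
      simp [h, this]

/-- `K` is central. -/
lemma lie_central (z : Hat g) : ⁅z, central g⁆ = 0 := by
  apply (hatEquiv g).injective
  rw [hatEquiv_lie, central, LinearEquiv.apply_symm_apply, map_zero, map_zero]
  refine Prod.ext ?_ rfl
  exact lie_zero (hatEquiv g z).1

lemma central_lie (z : Hat g) : ⁅central g, z⁆ = 0 := by
  rw [← lie_skew, lie_central, neg_zero]

/-- An element of `ĝ` is a combination of elements `x ⊗ t^k` and of `K`. -/
lemma hat_induction {p : Hat g → Prop} (h0 : p 0) (hl : ∀ x k, p (loopElem x k))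
    (hK : ∀ c : ℂ, p (c • central g)) (ha : ∀ z w, p z → p w → p (z + w)) (z : Hat g) : p z := by
  have hL : ∀ u : LieAlgebra.loopAlgebra ℂ ℤ g, p ((hatEquiv g).symm (u, 0)) := by
    intro u
    induction u using TensorProduct.induction_on with
    | zero => exact h0
    | tmul q x =>
      induction q using AddMonoidAlgebra.induction_linear with
      | zero => rw [TensorProduct.zero_tmul]; exact h0
      | add q q' hq hq' =>
        have := ha _ _ hq hq'
        rwa [← map_add, Prod.mk_add_mk, ← TensorProduct.add_tmul, add_zero] at this
      | single k c =>
        have : AddMonoidAlgebra.single k c ⊗ₜ[ℂ] x = AddMonoidAlgebra.single k (1 : ℂ) ⊗ₜ[ℂ] (c • x) := by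
          rw [← TensorProduct.smul_tmul, AddMonoidAlgebra.smul_single, smul_eq_mul, mul_one]
        rw [this]; exact hl _ _
    | add u u' hu hu' =>
      have := ha _ _ hu hu'
      rwa [← map_add, Prod.mk_add_mk, add_zero] at this
  have h := ha _ _ (hL (hatEquiv g z).1) (hK (hatEquiv g z).2)
  rw [central, ← map_smul, ← map_add] at h
  simpa using h

/-- Linear maps out of `ĝ` are determined by their values on `x ⊗ t^k` and `K`. -/
lemma hat_ext {N : Type*} [AddCommGroup N] [Module ℂ N] {f f' : Hat g →ₗ[ℂ] N}
    (hl : ∀ x k, f (loopElem x k) = f' (loopElem x k)) (hK : f (central g) = f' (central g)) :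
    f = f' := by
  ext z
  induction z using hat_induction with
  | h0 => simp
  | hl x k => exact hl x k
  | hK c => simp [hK]
  | ha z w hz hw => simp [hz, hw]

variable (g)

/-- `t d/dt` on Laurent polynomials. -/
def eulerLaurent : AddMonoidAlgebra ℂ ℤ →ₗ[ℂ] AddMonoidAlgebra ℂ ℤ :=
  (AddMonoidAlgebra.basis ℤ ℂ).constr ℂ (fun k => AddMonoidAlgebra.single k (k : ℂ))

/-- `t d/dt` on `ĝ`, killing `K`, as a linear map. -/
def degLin : Hat g →ₗ[ℂ] Hat g :=
  (hatEquiv g).symm.toLinearMap ∘ₗ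
    LinearMap.prodMap (LinearMap.rTensor g eulerLaurent) (0 : ℂ →ₗ[ℂ] ℂ) ∘ₗ
      (hatEquiv g).toLinearMap

variable {g} in
lemma degLin_loopElem (x : g) (k : ℤ) : degLin g (loopElem x k) = (k : ℂ) • loopElem x k := by
  have h : eulerLaurent (AddMonoidAlgebra.single k (1 : ℂ)) =
      (k : ℂ) • AddMonoidAlgebra.single k (1 : ℂ) := by
    have := (AddMonoidAlgebra.basis ℤ ℂ).constr_basis ℂ
      (fun k => AddMonoidAlgebra.single k (k : ℂ)) k
    rw [AddMonoidAlgebra.smul_single, smul_eq_mul, mul_one]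
    rwa [AddMonoidAlgebra.basis_apply] at this
  apply (hatEquiv g).injective
  simp only [degLin, loopElem, LinearMap.comp_apply, LinearEquiv.coe_coe, LinearMap.prodMap_apply,
    LinearEquiv.apply_symm_apply, LinearMap.rTensor_tmul, h, map_smul, TensorProduct.smul_tmul',
    Prod.smul_mk, LinearMap.zero_apply, smul_zero]

lemma degLin_central : degLin g (central g) = 0 := by
  apply (hatEquiv g).injective
  simp [degLin, central]

/-- The derivation `t d/dt` of `ĝ`: `x ⊗ t^k ↦ k x ⊗ t^k`, `K ↦ 0`. -/
def deg : LieDerivation ℂ (Hat g) (Hat g) where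
  toLinearMap := degLin g
  leibniz' z w := by
    induction z using hat_induction with
    | h0 => simp
    | ha z z' h h' =>
      simp only [add_lie, lie_add, map_add, h, h']; abel
    | hK c =>
      have h := central_lie (g := g)
      simp [h, degLin_central]
    | hl x m =>
      induction w using hat_induction with
      | h0 => simp
      | ha z z' h h' =>
        simp only [add_lie, lie_add, map_add, h, h']; abel
      | hK c => simp [lie_central, central_lie, degLin_central]
      | hl y n =>
        rw [lie_loopElem, map_add, map_smul, degLin_central, degLin_loopElem, degLin_loopElem,
          degLin_loopElem, lie_smul, lie_smul, ← lie_skew (loopElem y n) (loopElem x m),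
          lie_loopElem, smul_zero, add_zero, smul_neg, sub_neg_eq_add, ← add_smul, smul_add, smul_smul]
        have h : ((n : ℂ) + m) * (if m + n = 0 then (m : ℂ) * killingForm ℂ g x y else 0) = 0 := by
          split_ifs with h
          · have : (n : ℂ) + m = 0 := by rw [add_comm]; exact_mod_cast h
            rw [this, zero_mul]
          · rw [mul_zero]
        rw [h, zero_smul, add_zero]
        push_cast
        rw [add_comm (m : ℂ)]

/-- The action of `ℂ d` on `ĝ`. -/
def degAction : ℂ →ₗ⁅ℂ⁆ LieDerivation ℂ (Hat g) (Hat g) where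
  toLinearMap := LinearMap.toSpanSingleton ℂ _ (deg g)
  map_lie' {a b} := by
    have h : ⁅a, b⁆ = 0 := by rw [LieRing.of_associative_ring_bracket, mul_comm, sub_self]
    change ⁅a, b⁆ • deg g = ⁅a • deg g, b • deg g⁆
    rw [h, smul_lie, lie_smul, lie_self, smul_zero, smul_zero, zero_smul]

/-- The untwisted affine Lie algebra `g̃ = ĝ ⊕ ℂ d`, with `d` acting on `ĝ` as `t d/dt`. -/
abbrev Tilde : Type _ := LieAlgebra.SemiDirectSum (Hat g) ℂ (degAction g)

/-- The element `d` of `g̃`. -/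
def dElem : Tilde g := LieAlgebra.SemiDirectSum.inr (degAction g) 1

/-- The inclusion `ĝ → g̃`. -/
def hatIncl : Hat g →ₗ⁅ℂ⁆ Tilde g := LieAlgebra.SemiDirectSum.inl (degAction g)

/-- `[d, z] = t (dz/dt)` for `z` in `ĝ`. -/
lemma lie_dElem (z : Hat g) : ⁅dElem g, hatIncl g z⁆ = hatIncl g (deg g z) := by
  refine LieAlgebra.SemiDirectSum.ext ?_ ?_
  · change ⁅(0 : Hat g), z⁆ + ((1 : ℂ) • deg g) z - ((0 : ℂ) • deg g) 0 = deg g z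
    rw [zero_lie, one_smul, map_zero, zero_add, sub_zero]
  · change ⁅(1 : ℂ), (0 : ℂ)⁆ = 0
    rw [lie_zero]

/-- The `g̃`-module `M[d]` induced from the `ĝ`-module `M`. -/
abbrev WithD (M : Type*) [AddCommGroup M] [Module ℂ M] [LieRingModule (Hat g) M] : Type _ :=
  Induced (hatIncl g) M

end Algebras

/-! ### Evaluation modules -/

section Evaluation

variable (g : Type*) [LieRing g] [LieAlgebra ℂ g]

/-- Evaluation of Laurent polynomials at a nonzero complex number. -/
def evalLaurent (a : ℂˣ) : AddMonoidAlgebra ℂ ℤ →ₐ[ℂ] ℂ :=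
  AddMonoidAlgebra.lift ℂ ℂ ℤ ((Units.coeHom ℂ).comp (zpowersHom ℂˣ a))

/-- The evaluation `ĝ → g`, `x ⊗ t^k ↦ a^k x`, `K ↦ 0`, as a linear map. -/
def evLin (a : ℂˣ) : Hat g →ₗ[ℂ] g :=
  TensorProduct.lift ((LinearMap.lsmul ℂ g).comp (evalLaurent a).toLinearMap) ∘ₗ
    LinearMap.fst ℂ _ _ ∘ₗ (hatEquiv g).toLinearMap

variable {g} in
lemma evLin_loopElem (a : ℂˣ) (x : g) (k : ℤ) :
    evLin g a (loopElem x k) = ((a : ℂ) ^ k) • x := by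
  have h : evalLaurent a (AddMonoidAlgebra.single k 1) = (a : ℂ) ^ k := by
    rw [evalLaurent, AddMonoidAlgebra.lift_single, one_smul]
    simp
  simp only [evLin, loopElem, LinearMap.comp_apply, LinearEquiv.coe_coe,
    LinearEquiv.apply_symm_apply, LinearMap.fst_apply, TensorProduct.lift.tmul,
    AlgHom.toLinearMap_apply, h, LinearMap.lsmul_apply]

lemma evLin_central (a : ℂˣ) : evLin g a (central g) = 0 := by
  simp [evLin, central]

/-- The evaluation `ĝ → g`, `x ⊗ t^k ↦ a^k x`, `K ↦ 0`. -/
def ev (a : ℂˣ) : Hat g →ₗ⁅ℂ⁆ g where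
  toLinearMap := evLin g a
  map_lie' {z w} := by
    change evLin g a ⁅z, w⁆ = ⁅evLin g a z, evLin g a w⁆
    induction z using hat_induction with
    | h0 => simp
    | ha z z' h h' => simp only [add_lie, map_add, h, h']
    | hK c =>
      have h := central_lie (g := g)
      simp [h, evLin_central]
    | hl x m =>
      induction w using hat_induction with
      | h0 => simp
      | ha z z' h h' => simp only [lie_add, map_add, h, h']
      | hK c => simp [lie_central, evLin_central]
      | hl y n =>
        rw [lie_loopElem, map_add, map_smul, evLin_central, evLin_loopElem, evLin_loopElem,
          evLin_loopElem, smul_zero, add_zero, smul_lie, lie_smul, smul_smul,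
          zpow_add₀ a.ne_zero]

variable {m : ℕ} (V : Fin m → Type*) [∀ i, AddCommGroup (V i)] [∀ i, Module ℂ (V i)]

/-- The operator `v₁ ⊗ ⋯ ⊗ v_m ↦ v₁ ⊗ ⋯ ⊗ A vᵢ ⊗ ⋯ ⊗ v_m`, linear in `A`. -/
def atSlot (i : Fin m) : Module.End ℂ (V i) →ₗ[ℂ] Module.End ℂ (⨂[ℂ] j, V j) :=
  (PiTensorProduct.mapMultilinear ℂ V V).toLinearMap (fun _ => LinearMap.id) i

variable {V}

lemma atSlot_tprod (i : Fin m) (A : Module.End ℂ (V i)) (v : ∀ j, V j) :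
    atSlot V i A (PiTensorProduct.tprod ℂ v) =
      PiTensorProduct.tprod ℂ (Function.update v i (A (v i))) := by
  simp only [atSlot, MultilinearMap.toLinearMap_apply, PiTensorProduct.mapMultilinear_apply,
    PiTensorProduct.map_tprod]
  congr 1
  ext j
  by_cases h : j = i
  · subst h; simp
  · simp [h]

lemma atSlot_lie (i : Fin m) (A B : Module.End ℂ (V i)) :
    atSlot V i ⁅A, B⁆ = ⁅atSlot V i A, atSlot V i B⁆ := by
  have hmul : ∀ A B : Module.End ℂ (V i), atSlot V i (A * B) = atSlot V i A * atSlot V i B := by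
    intro A B
    apply PiTensorProduct.ext
    ext v
    simp [atSlot_tprod]
  rw [LieRing.of_associative_ring_bracket, LieRing.of_associative_ring_bracket, map_sub, hmul, hmul]

lemma atSlot_lie_of_ne {i j : Fin m} (h : i ≠ j) (A : Module.End ℂ (V i))
    (B : Module.End ℂ (V j)) : ⁅atSlot V i A, atSlot V j B⁆ = 0 := by
  rw [LieRing.of_associative_ring_bracket, sub_eq_zero]
  apply PiTensorProduct.ext
  ext v
  simp [atSlot_tprod, h, h.symm, Function.update_comm h]

variable (V) [∀ i, LieRingModule g (V i)] [∀ i, LieModule ℂ g (V i)]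

/-- The representation of `ĝ` on `V₁ ⊗ ⋯ ⊗ V_m` for which `x ⊗ t^k` acts as
`∑ᵢ aᵢ^k (1 ⊗ ⋯ ⊗ x ⊗ ⋯ ⊗ 1)` (with `x` in the `i`-th slot) and `K` as `0`. -/
def evalRep (a : Fin m → ℂˣ) : Hat g →ₗ⁅ℂ⁆ Module.End ℂ (⨂[ℂ] j, V j) where
  toLinearMap := ∑ i, atSlot V i ∘ₗ (LieModule.toEnd ℂ g (V i)).toLinearMap ∘ₗ
    (ev g (a i)).toLinearMap
  map_lie' {z w} := by
    have key : ∀ A B : ∀ i, Module.End ℂ (V i),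
        ∑ i, atSlot V i ⁅A i, B i⁆ = ⁅∑ i, atSlot V i (A i), ∑ i, atSlot V i (B i)⁆ := by
      intro A B
      simp only [sum_lie, lie_sum]
      refine Finset.sum_congr rfl fun i _ => ?_
      rw [Finset.sum_eq_single i (fun j _ hj => atSlot_lie_of_ne hj _ _) (by simp), atSlot_lie]
    have h := key (fun i => LieModule.toEnd ℂ g (V i) (ev g (a i) z))
      (fun i => LieModule.toEnd ℂ g (V i) (ev g (a i) w))
    simpa using h

/-- The evaluation module: the space `V₁ ⊗ ⋯ ⊗ V_m` with `ĝ` acting through `evalRep`. When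
`Vᵢ = V(λᵢ)` is the irreducible highest weight `g`-module of highest weight `λᵢ`, this is
`E(λ, a)`. -/
@[nolint unusedArguments]
def EvalModule (_a : Fin m → ℂˣ) : Type _ := ⨂[ℂ] j, V j

variable (a : Fin m → ℂˣ)

instance : AddCommGroup (EvalModule V a) := inferInstanceAs (AddCommGroup (⨂[ℂ] j, V j))

instance : Module ℂ (EvalModule V a) := inferInstanceAs (Module ℂ (⨂[ℂ] j, V j))

instance : LieRingModule (Hat g) (EvalModule V a) :=
  LieRingModule.compLieHom (⨂[ℂ] j, V j) (evalRep g V a)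

instance : LieModule ℂ (Hat g) (EvalModule V a) :=
  LieModule.compLieHom (⨂[ℂ] j, V j) (evalRep g V a)

end Evaluation

/-! ### Triangular decompositions -/

/-- A linear span that is closed under brackets of spanning vectors, as a Lie subalgebra. -/
def spanSubalgebra {G : Type*} [LieRing G] [LieAlgebra ℂ G] (S : Set G)
    (h : ∀ x ∈ S, ∀ y ∈ S, ⁅x, y⁆ ∈ Submodule.span ℂ S) : LieSubalgebra ℂ G where
  __ := Submodule.span ℂ S
  lie_mem' {x y} hx hy := by
    change ⁅x, y⁆ ∈ Submodule.span ℂ S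
    induction hx, hy using Submodule.span_induction₂ with
    | mem_mem x y hx hy => exact h x hx y hy
    | zero_left y hy => simp
    | zero_right x hx => simp
    | add_left x y z hx hy hz h1 h2 => rw [add_lie]; exact add_mem h1 h2
    | add_right x y z hx hy hz h1 h2 => rw [lie_add]; exact add_mem h1 h2
    | smul_left r x y hx hy h1 => rw [smul_lie]; exact Submodule.smul_mem _ _ h1
    | smul_right r x y hx hy h1 => rw [lie_smul]; exact Submodule.smul_mem _ _ h1

section Triangular

variable {g : Type*} [LieRing g] [LieAlgebra ℂ g]

/-- The Cartan part `ĥ = h ⊗ 1 ⊕ ℂ K` of `ĝ`. -/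
def hatCartan (H : LieSubalgebra ℂ g) : LieSubalgebra ℂ (Hat g) :=
  spanSubalgebra ({z | ∃ x ∈ H, z = loopElem x 0} ∪ {central g}) (by
    rintro _ (⟨x, hx, rfl⟩ | rfl) _ (⟨y, hy, rfl⟩ | rfl)
    · rw [lie_loopElem]
      refine Submodule.subset_span (Or.inl ⟨⁅x, y⁆, H.lie_mem hx hy, ?_⟩)
      simp
    · rw [lie_central]; exact zero_mem _
    · rw [central_lie]; exact zero_mem _
    · rw [central_lie]; exact zero_mem _)

/-- The positive part `n ⊗ 1 ⊕ g ⊗ t ℂ[t]` of `ĝ` (and of `g̃`) attached to a subalgebra `n`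
of `g`. -/
def hatPos (n : LieSubalgebra ℂ g) : LieSubalgebra ℂ (Hat g) :=
  spanSubalgebra ({z | ∃ x ∈ n, z = loopElem x 0} ∪
    {z | ∃ (x : g) (k : ℤ), 0 < k ∧ z = loopElem x k}) (by
    rintro _ (⟨x, hx, rfl⟩ | ⟨x, k, hk, rfl⟩) _ (⟨y, hy, rfl⟩ | ⟨y, l, hl, rfl⟩)
    · rw [lie_loopElem]
      refine Submodule.subset_span (Or.inl ⟨⁅x, y⁆, n.lie_mem hx hy, ?_⟩)
      simp
    · rw [lie_loopElem, if_neg (by omega), zero_smul, add_zero]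
      exact Submodule.subset_span (Or.inr ⟨_, _, by omega, rfl⟩)
    · rw [lie_loopElem, if_neg (by omega), zero_smul, add_zero]
      exact Submodule.subset_span (Or.inr ⟨_, _, by omega, rfl⟩)
    · rw [lie_loopElem, if_neg (by omega), zero_smul, add_zero]
      exact Submodule.subset_span (Or.inr ⟨_, _, by omega, rfl⟩))

/-- `V` is the irreducible highest weight `ĝ`-module `V(γ)`: it is an irreducible highest weight
`ĝ`-module of highest weight `γ` obtained by restriction from a highest weight `g̃`-module, that is,
it carries an operator `D` (the action of `d`, normalized to kill a highest weight vector) such that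
`[D, z] = t (dz/dt)` for all `z` in `ĝ`. -/
structure IsGradedHighestWeight (H n : LieSubalgebra ℂ g) (γ : Module.Dual ℂ (hatCartan H))
    (V : Type*) [AddCommGroup V] [Module ℂ V] [LieRingModule (Hat g) V] : Prop where
  isIrredHighestWeight : IsIrredHighestWeight (hatCartan H) (hatPos n) γ V
  graded : ∃ (D : V →ₗ[ℂ] V) (v : V), IsHighestWeightVector (hatCartan H) (hatPos n) γ v ∧
    D v = 0 ∧ ∀ (z : Hat g) (w : V), D ⁅z, w⁆ = ⁅z, D w⁆ + ⁅deg g z, w⁆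

open LieAlgebra in
/-- The positive part `n₊` of `g` for the Cartan subalgebra `H` and a base `b` of its root system:
the sum of the root spaces of the positive roots. -/
def nPlus [FiniteDimensional ℂ g] [IsKilling ℂ g] (H : LieSubalgebra ℂ g) [H.IsCartanSubalgebra]
    (b : (IsKilling.rootSystem H).Base) : LieSubalgebra ℂ g :=
  spanSubalgebra {x | ∃ α : H.root, b.IsPos α ∧ x ∈ rootSpace H α.1} (by
    rintro x ⟨α, hα, hx⟩ y ⟨β, hβ, hy⟩
    have hxy : ⁅x, y⁆ ∈ rootSpace H (⇑α.1 + ⇑β.1) :=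
      lie_mem_genWeightSpace_of_mem_genWeightSpace hx hy
    by_cases h0 : ⁅x, y⁆ = 0
    · rw [h0]; exact zero_mem _
    have hne : rootSpace H (⇑α.1 + ⇑β.1) ≠ ⊥ := fun h => h0 (by rw [h] at hxy; simpa using hxy)
    let γ : LieModule.Weight ℂ H g := ⟨⇑α.1 + ⇑β.1, hne⟩
    have hsum : γ.toLinear = α.1.toLinear + β.1.toLinear := by ext h; rfl
    have hγ : γ.IsNonZero := by
      intro hz
      have hz' : α.1.toLinear = -β.1.toLinear := by
        rw [eq_neg_iff_add_eq_zero, ← hsum]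
        ext h
        exact congrFun hz h
      have hroot : (IsKilling.rootSystem H).root α =
          (IsKilling.rootSystem H).root ((IsKilling.rootSystem H).reflectionPerm β β) := by
        rw [RootPairing.root_reflectionPerm, RootPairing.reflection_apply_self]
        exact hz'
      have hab := (IsKilling.rootSystem H).root.injective hroot
      have hh := b.height_reflectionPerm_self β
      change 0 < b.height α at hα
      change 0 < b.height β at hβ
      change b.height ((IsKilling.rootSystem H).reflectionPerm β β) = _ at hh
      rw [← hab] at hh
      omega
    refine Submodule.subset_span ⟨⟨γ, by simpa using hγ⟩, hα.add hβ ?_, hxy⟩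
    exact hsum)

end Triangular

end Affine

end

open Affine

/-!
Let `V` and `V'` be irreducible `ĝ`-modules, each a highest weight module or a Whittaker module. All
parts of the theorem follow from one equivalence, `nonempty_withD_equiv_iff`: the induced modules
`(E(λ, a) ⊗ V)[d]` and `(E(λ', a') ⊗ V')[d]` are isomorphic if and only if `E(λ, a) ≅ E(λ', a')` and
`V ≅ V'`. Only the forward direction needs an argument.

Removing `d`. As a space `N[d]` consists of the polynomials in `d` with coefficients in `N`, and an
element of degree `n` of `ĝ` acts by `f(d) ⊗ m ↦ f(d - n) ⊗ z m`; in particular `ĝ` preserves the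
filtration by degree in `d` and acts on leading coefficients as on `N`. So an isomorphism
`M[d] ≅ N[d]` with `M` irreducible yields a nonzero homomorphism `M → N`
(`exists_hom_of_withD_equiv`).

Separating the factors. By Jacobson density and interpolation, the operators generated by the
`x ⊗ t^k` with `k ≥ N` are dense in all linear operators on `E(λ, a)`, for every `N`
(`isLoopDense_evalModule`). On the other hand each vector of `V` is killed by the `x ⊗ t^k` with `k`
large (`IsIrredHighestWeight.isSmooth`, `IsIrredWhittaker.isSmooth`). Hence arbitrary finite-rank
operators on the first factor of `E(λ, a) ⊗ V` can be realized inside the enveloping algebra without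
touching the second factor. This makes `E(λ, a) ⊗ V` irreducible (`IsLoopDense.irreducible_tensor`)
and splits a nonzero homomorphism `E(λ, a) ⊗ V → E(λ', a') ⊗ V'` into isomorphisms of the factors
(`equiv_of_tensor_hom`).

Comparing the second factors. Highest weight modules are generated by a vector of top degree for the
principal gradation of `ĝ`. Elements of positive degree act locally nilpotently on them, so that they
contain no Whittaker vector of nonzero type (`isEmpty_equiv_whittaker`). If `d` acts as well, the
degree operator diagonalizes the module, and the highest weight determines the irreducible module and
is determined by it (`IsGradedHighestWeight.nonempty_equiv_iff`). The same argument for `g` shows that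
the irreducible highest weight modules `V(λᵢ)` have only scalar endomorphisms
(`IsIrredHighestWeight.end_eq_smul`), as density requires.
-/

noncomputable section

namespace Affine

attribute [local instance 100] LieRing.ofAssociativeRing

/-! ### Enveloping algebras and induced modules -/

section Enveloping

variable {G : Type*} [LieRing G] [LieAlgebra ℂ G]

lemma adjoin_range_ι :
    Algebra.adjoin ℂ (Set.range (UniversalEnvelopingAlgebra.ι ℂ : G → _)) = ⊤ := by
  set S := Algebra.adjoin ℂ (Set.range (UniversalEnvelopingAlgebra.ι ℂ : G → _)) with hS
  have hmem : ∀ x : G, UniversalEnvelopingAlgebra.ι ℂ x ∈ S :=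
    fun x => Algebra.subset_adjoin ⟨x, rfl⟩
  let f : G →ₗ⁅ℂ⁆ S :=
    { toFun := fun x => ⟨UniversalEnvelopingAlgebra.ι ℂ x, hmem x⟩
      map_add' := fun x y => Subtype.ext (map_add _ x y)
      map_smul' := fun c x => Subtype.ext (map_smul _ c x)
      map_lie' := fun {x y} => Subtype.ext (LieHom.map_lie _ x y) }
  have h : S.val.comp (UniversalEnvelopingAlgebra.lift ℂ f) = AlgHom.id ℂ _ := by
    apply UniversalEnvelopingAlgebra.hom_ext
    ext x
    simp [f]
  rw [eq_top_iff]
  intro u _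
  have := congrArg (fun k => k u) h
  simp only [AlgHom.comp_apply, AlgHom.id_apply] at this
  rw [← this]
  exact Subtype.property _

/-- The action of the enveloping algebra on a Lie module. -/
def envAction (M : Type*) [AddCommGroup M] [Module ℂ M] [LieRingModule G M] [LieModule ℂ G M] :
    UniversalEnvelopingAlgebra ℂ G →ₐ[ℂ] Module.End ℂ M :=
  UniversalEnvelopingAlgebra.lift ℂ (LieModule.toEnd ℂ G M)

variable {M : Type*} [AddCommGroup M] [Module ℂ M] [LieRingModule G M] [LieModule ℂ G M]

@[simp]
lemma envAction_ι (x : G) (m : M) :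
    envAction M (UniversalEnvelopingAlgebra.ι ℂ x) m = ⁅x, m⁆ := by
  simp [envAction]

end Enveloping

section Induction

variable {G G' : Type*} [LieRing G] [LieAlgebra ℂ G] [LieRing G'] [LieAlgebra ℂ G']
  (f : G →ₗ⁅ℂ⁆ G') {M : Type*} [AddCommGroup M] [Module ℂ M] [LieRingModule G M]
  {N : Type*} [AddCommGroup N] [Module ℂ N] [LieRingModule G' N]

/-- The canonical map `m ↦ 1 ⊗ m` from a module to the module induced from it. -/
def inducedMk : M →ₗ[ℂ] Induced f M :=
  ((inducedRelations f M).mkQ.restrictScalars ℂ) ∘ₗ TensorProduct.mk ℂ _ M 1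

lemma inducedMk_lie (x : G) (m : M) : inducedMk f ⁅x, m⁆ = ⁅f x, inducedMk f m⁆ := by
  change (inducedRelations f M).mkQ _ =
    UniversalEnvelopingAlgebra.ι ℂ (f x) • (inducedRelations f M).mkQ _
  rw [← map_smul, eq_comm, ← sub_eq_zero, ← map_sub]
  refine (Submodule.Quotient.mk_eq_zero _).2 (Submodule.subset_span ⟨x, m, ?_⟩)
  simp [TensorProduct.smul_tmul']

variable {f} in
/-- Induced modules are generated over the enveloping algebra by the elements `1 ⊗ m`. -/
lemma induced_induction {p : Induced f M → Prop} (hmk : ∀ m, p (inducedMk f m))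
    (hadd : ∀ w w', p w → p w' → p (w + w')) (hsmul : ∀ (c : ℂ) w, p w → p (c • w))
    (hlie : ∀ (y : G') w, p w → p ⁅y, w⁆) (w : Induced f M) : p w := by
  have hU : ∀ (u : UniversalEnvelopingAlgebra ℂ G') (w : Induced f M), p w → p (u • w) := by
    intro u
    have hu : u ∈ Algebra.adjoin ℂ (Set.range (UniversalEnvelopingAlgebra.ι ℂ : G' → _)) := by
      rw [adjoin_range_ι]; trivial
    induction hu using Algebra.adjoin_induction with
    | mem x hx => obtain ⟨y, rfl⟩ := hx; exact hlie y
    | algebraMap r => intro w hw; rw [algebraMap_smul]; exact hsmul r w hw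
    | add x y _ _ hx hy => intro w hw; rw [add_smul]; exact hadd _ _ (hx w hw) (hy w hw)
    | mul x y _ _ hx hy => intro w hw; rw [mul_smul]; exact hx _ (hy w hw)
  obtain ⟨t, rfl⟩ := (inducedRelations f M).mkQ_surjective w
  induction t using TensorProduct.induction_on with
  | zero => have := hsmul 0 _ (hmk 0); rw [zero_smul] at this; rwa [map_zero]
  | add a b ha hb => rw [map_add]; exact hadd _ _ ha hb
  | tmul u m =>
    have : (u ⊗ₜ[ℂ] m : _ ⊗[ℂ] M) = u • ((1 : UniversalEnvelopingAlgebra ℂ G') ⊗ₜ[ℂ] m) := by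
      simp [TensorProduct.smul_tmul']
    rw [this, map_smul]
    exact hU u _ (hmk m)

lemma induced_hom_ext {F F' : Induced f M →ₗ⁅ℂ, G'⁆ N}
    (h : ∀ m, F (inducedMk f m) = F' (inducedMk f m)) : F = F' := by
  ext w
  induction w using induced_induction with
  | hmk m => exact h m
  | hadd w w' hw hw' => rw [map_add, map_add, hw, hw']
  | hsmul c w hw => rw [map_smul, map_smul, hw]
  | hlie y w hw => rw [LieModuleHom.map_lie, LieModuleHom.map_lie, hw]

variable [LieModule ℂ G' N]

/-- The universal property of the induced module (Frobenius reciprocity). -/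
lemma exists_induced_lift (φ : M →ₗ[ℂ] N) (hφ : ∀ (x : G) (m : M), φ ⁅x, m⁆ = ⁅f x, φ m⁆) :
    ∃ F : Induced f M →ₗ⁅ℂ, G'⁆ N, ∀ m, F (inducedMk f m) = φ m := by
  let L : UniversalEnvelopingAlgebra ℂ G' ⊗[ℂ] M →ₗ[ℂ] N :=
    TensorProduct.lift ((LinearMap.lcomp ℂ N φ) ∘ₗ (envAction N).toLinearMap)
  have hLt : ∀ u m, L (u ⊗ₜ m) = envAction N u (φ m) := fun u m => by simp [L]
  have hL : ∀ (u : UniversalEnvelopingAlgebra ℂ G') t, L (u • t) = envAction N u (L t) := by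
    intro u t
    induction t using TensorProduct.induction_on with
    | zero => simp
    | add a b ha hb => rw [smul_add, map_add, ha, hb, map_add, map_add]
    | tmul v m => rw [TensorProduct.smul_tmul', hLt, hLt, smul_eq_mul, map_mul]; rfl
  have hker : (inducedRelations f M).restrictScalars ℂ ≤ LinearMap.ker L := by
    intro t ht
    change t ∈ inducedRelations f M at ht
    rw [LinearMap.mem_ker]
    induction ht using Submodule.span_induction with
    | mem t ht =>
      obtain ⟨x, m, rfl⟩ := ht
      rw [map_sub, hLt, hLt, envAction_ι, hφ, map_one]
      exact sub_self _
    | zero => exact map_zero _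
    | add a b _ _ ha hb => rw [map_add, ha, hb, add_zero]
    | smul u t _ ht => rw [hL, ht, map_zero]
  let F₀ : Induced f M →ₗ[ℂ] N :=
    (Submodule.liftQ _ L hker) ∘ₗ
      (Submodule.Quotient.restrictScalarsEquiv ℂ (inducedRelations f M)).symm.toLinearMap
  have hF₀ : ∀ t, F₀ ((inducedRelations f M).mkQ t) = L t := fun t => rfl
  refine ⟨{ F₀ with map_lie' := ?_ }, fun m => ?_⟩
  · intro y w
    obtain ⟨t, rfl⟩ := (inducedRelations f M).mkQ_surjective w
    change F₀ (UniversalEnvelopingAlgebra.ι ℂ y • (inducedRelations f M).mkQ t) =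
      ⁅y, F₀ ((inducedRelations f M).mkQ t)⁆
    rw [← map_smul, hF₀, hF₀, hL, envAction_ι]
  · change L (1 ⊗ₜ m) = _
    rw [hLt, map_one]
    rfl

/-- Isomorphic modules induce isomorphic modules. -/
lemma induced_equiv {M' : Type*} [AddCommGroup M'] [Module ℂ M'] [LieRingModule G M']
    (e : M ≃ₗ⁅ℂ, G⁆ M') : Nonempty (Induced f M ≃ₗ⁅ℂ, G'⁆ Induced f M') := by
  obtain ⟨F, hF⟩ := exists_induced_lift f (inducedMk f ∘ₗ (e : M →ₗ⁅ℂ, G⁆ M').toLinearMap)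
    (fun x m => by
      change inducedMk f ((e : M →ₗ⁅ℂ, G⁆ M') ⁅x, m⁆) = _
      rw [LieModuleHom.map_lie, inducedMk_lie]; rfl)
  obtain ⟨F', hF'⟩ := exists_induced_lift f
    (inducedMk f ∘ₗ (e.symm : M' →ₗ⁅ℂ, G⁆ M).toLinearMap)
    (fun x m => by
      change inducedMk f ((e.symm : M' →ₗ⁅ℂ, G⁆ M) ⁅x, m⁆) = _
      rw [LieModuleHom.map_lie, inducedMk_lie]; rfl)
  have h1 : F'.comp F = LieModuleHom.id := induced_hom_ext f fun m => by
    rw [LieModuleHom.comp_apply, hF]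
    change F' (inducedMk f (e m)) = _
    rw [hF']
    change inducedMk f (e.symm (e m)) = _
    simp
  have h2 : F.comp F' = LieModuleHom.id := induced_hom_ext f fun m => by
    rw [LieModuleHom.comp_apply, hF']
    change F (inducedMk f (e.symm m)) = _
    rw [hF]
    change inducedMk f (e (e.symm m)) = _
    simp
  exact ⟨{ F with
    invFun := F'
    left_inv := fun w => LieModuleHom.congr_fun h1 w
    right_inv := fun w => LieModuleHom.congr_fun h2 w }⟩

end Induction

/-! ### The polynomial model of `M[d]` -/

section PolynomialModel

open Polynomial

variable {g : Type*} [LieRing g] [LieAlgebra ℂ g]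

/-- `x ↦ x ⊗ t^k` as a linear map. -/
def loopLin (k : ℤ) : g →ₗ[ℂ] Hat g :=
  (hatEquiv g).symm.toLinearMap ∘ₗ LinearMap.inl ℂ _ _ ∘ₗ
    TensorProduct.mk ℂ _ g (AddMonoidAlgebra.single k 1)

@[simp]
lemma loopLin_apply (k : ℤ) (x : g) : loopLin k x = loopElem x k := rfl

/-- The space `M[X]` of polynomials in `X = d` with coefficients in `M`. -/
def PolyModule (M : Type*) [AddCommGroup M] [Module ℂ M] : Type _ := ℂ[X] ⊗[ℂ] M

section

variable (M : Type*) [AddCommGroup M] [Module ℂ M]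

instance : AddCommGroup (PolyModule M) := inferInstanceAs (AddCommGroup (ℂ[X] ⊗[ℂ] M))

instance : Module ℂ (PolyModule M) := inferInstanceAs (Module ℂ (ℂ[X] ⊗[ℂ] M))

variable {M} in
/-- The polynomial `f(X) m`. -/
def polyTmul (f : ℂ[X]) : M →ₗ[ℂ] PolyModule M := TensorProduct.mk ℂ ℂ[X] M f

variable {M} in
lemma polyTmul_sub (f f' : ℂ[X]) (m : M) :
    polyTmul (f - f') m = polyTmul f m - polyTmul f' m := TensorProduct.sub_tmul f f' m

variable {M} in
lemma polyTmul_smul (c : ℂ) (f : ℂ[X]) (m : M) : polyTmul (c • f) m = c • polyTmul f m := rfl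

variable {M} in
lemma poly_induction {p : PolyModule M → Prop} (h0 : p 0) (ht : ∀ f m, p (polyTmul f m))
    (ha : ∀ F F', p F → p F' → p (F + F')) (F : PolyModule M) : p F :=
  TensorProduct.induction_on F h0 ht ha

variable {M} in
lemma poly_ext {N : Type*} [AddCommGroup N] [Module ℂ N] {A B : PolyModule M →ₗ[ℂ] N}
    (h : ∀ f m, A (polyTmul f m) = B (polyTmul f m)) : A = B :=
  TensorProduct.ext' h

/-- The operator `f ⊗ m ↦ f (X + c) ⊗ A m`, linear in `A`. -/
def taylorTensor (c : ℂ) : Module.End ℂ M →ₗ[ℂ] Module.End ℂ (PolyModule M) :=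
  TensorProduct.mapBilinear (RingHom.id ℂ) ℂ[X] M ℂ[X] M (taylor c)

variable {M} in
@[simp]
lemma taylorTensor_tmul (c : ℂ) (A : Module.End ℂ M) (f : ℂ[X]) (m : M) :
    taylorTensor M c A (polyTmul f m) = polyTmul (taylor c f) (A m) := rfl

/-- Multiplication by `X` on polynomials with coefficients in `M`. -/
def polyD : Module.End ℂ (PolyModule M) := LinearMap.rTensor M (LinearMap.mulLeft ℂ X)

variable {M} in
@[simp]
lemma polyD_tmul (f : ℂ[X]) (m : M) : polyD M (polyTmul f m) = polyTmul (X * f) m := rfl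

end

variable (M : Type*) [AddCommGroup M] [Module ℂ M] [LieRingModule (Hat g) M]
  [LieModule ℂ (Hat g) M]

/-- The action of `ĝ` on polynomials in `d` with coefficients in `M`: an element `z` of degree `n`
satisfies `z d = (d - n) z`, so it acts as `f(d) ⊗ m ↦ f(d - n) ⊗ z m`. -/
def polyLin : Hat g →ₗ[ℂ] Module.End ℂ (PolyModule M) :=
  (LinearMap.coprod
    (TensorProduct.lift ((AddMonoidAlgebra.basis ℤ ℂ).constr ℂ fun k : ℤ =>
      taylorTensor M (-(k : ℂ)) ∘ₗ (LieModule.toEnd ℂ (Hat g) M).toLinearMap ∘ₗ loopLin k))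
    (LinearMap.toSpanSingleton ℂ _
      (taylorTensor M 0 (LieModule.toEnd ℂ (Hat g) M (central g))))) ∘ₗ
    (hatEquiv g).toLinearMap

lemma polyLin_loopElem (x : g) (k : ℤ) :
    polyLin M (loopElem x k) =
      taylorTensor M (-(k : ℂ)) (LieModule.toEnd ℂ (Hat g) M (loopElem x k)) := by
  have h := (AddMonoidAlgebra.basis ℤ ℂ).constr_basis ℂ (fun k : ℤ =>
      taylorTensor M (-(k : ℂ)) ∘ₗ (LieModule.toEnd ℂ (Hat g) M).toLinearMap ∘ₗ loopLin k) k
  rw [AddMonoidAlgebra.basis_apply] at h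
  simp only [polyLin, loopElem, LinearMap.comp_apply, LinearEquiv.coe_coe,
    LinearEquiv.apply_symm_apply, LinearMap.coprod_apply, map_zero, add_zero,
    TensorProduct.lift.tmul, h]
  rfl

lemma polyLin_central :
    polyLin M (central g) = taylorTensor M 0 (LieModule.toEnd ℂ (Hat g) M (central g)) := by
  simp [polyLin, central]

/-- A linear map from `ĝ` to an associative algebra is a homomorphism of Lie algebras as soon as it
respects the brackets of the generators. -/
lemma map_lie_of_generators {A : Type*} [Ring A] [Algebra ℂ A] (P : Hat g →ₗ[ℂ] A)
    (hK : ∀ x k, P (loopElem x k) * P (central g) = P (central g) * P (loopElem x k))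
    (hl : ∀ x y k l, P ⁅loopElem x k, loopElem y l⁆ =
      P (loopElem x k) * P (loopElem y l) - P (loopElem y l) * P (loopElem x k))
    (z w : Hat g) : P ⁅z, w⁆ = P z * P w - P w * P z := by
  induction z using hat_induction with
  | h0 => simp
  | ha z z' h h' => rw [add_lie, map_add, map_add, h, h', add_mul, mul_add]; abel
  | hK c =>
    have h := central_lie (g := g)
    induction w using hat_induction with
    | h0 => simp
    | ha z z' h h' => rw [lie_add, map_add, map_add, h, h', add_mul, mul_add]; abel
    | hK c => simp [smul_comm c]
    | hl y n => simp [h, hK]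
  | hl x m =>
    induction w using hat_induction with
    | h0 => simp
    | ha z z' h h' => rw [lie_add, map_add, map_add, h, h', add_mul, mul_add]; abel
    | hK c => simp [lie_central, hK]
    | hl y n => exact hl x y m n

lemma polyLin_lie (z w : Hat g) :
    polyLin M ⁅z, w⁆ = polyLin M z * polyLin M w - polyLin M w * polyLin M z := by
  have hmul : ∀ (c c' : ℂ) (A B : Module.End ℂ M),
      taylorTensor M c A * taylorTensor M c' B = taylorTensor M (c + c') (A * B) := by
    intro c c' A B
    apply poly_ext
    intro f m
    simp [taylor_taylor]
  have hlie : ∀ (c c' : ℂ) (z w : Hat g),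
      taylorTensor M c (LieModule.toEnd ℂ (Hat g) M z) *
          taylorTensor M c' (LieModule.toEnd ℂ (Hat g) M w) -
        taylorTensor M c' (LieModule.toEnd ℂ (Hat g) M w) *
          taylorTensor M c (LieModule.toEnd ℂ (Hat g) M z) =
      taylorTensor M (c + c') (LieModule.toEnd ℂ (Hat g) M ⁅z, w⁆) := by
    intro c c' z w
    rw [hmul, hmul, add_comm c' c, ← map_sub, LieHom.map_lie,
      LieRing.of_associative_ring_bracket]
  refine map_lie_of_generators _ (fun x k => ?_) (fun x y m n => ?_) z w
  · have h := hlie (-(k : ℂ)) 0 (loopElem x k) (central g)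
    rw [lie_central, map_zero, map_zero, sub_eq_zero] at h
    rwa [polyLin_loopElem, polyLin_central]
  · have h1 : -(m : ℂ) + -(n : ℂ) = -((m + n : ℤ) : ℂ) := by push_cast; ring
    rw [polyLin_loopElem, polyLin_loopElem, hlie, h1, lie_loopElem]
    by_cases h : m + n = 0
    · simp only [h, map_add, map_smul, polyLin_loopElem, polyLin_central, Int.cast_zero,
        neg_zero]
    · simp only [if_neg h, zero_smul, add_zero, polyLin_loopElem]

lemma polyD_comm (z : Hat g) :
    polyD M * polyLin M z - polyLin M z * polyD M = polyLin M (deg g z) := by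
  induction z using hat_induction with
  | h0 => simp
  | ha z z' h h' => rw [map_add, map_add, map_add, ← h, ← h', add_mul, mul_add]; abel
  | hK c =>
    change _ = polyLin M (degLin g (c • central g))
    rw [map_smul, map_smul, degLin_central, polyLin_central, smul_mul_assoc, mul_smul_comm,
      ← smul_sub]
    apply poly_ext
    intro f m
    simp
  | hl x k =>
    change _ = polyLin M (degLin g (loopElem x k))
    rw [degLin_loopElem, map_smul, polyLin_loopElem]
    apply poly_ext
    intro f m
    simp only [LinearMap.sub_apply, Module.End.mul_apply, taylorTensor_tmul, polyD_tmul,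
      LinearMap.smul_apply, taylor_mul, taylor_X, ← polyTmul_sub, ← polyTmul_smul]
    congr 2
    rw [map_neg, ← sub_mul, smul_eq_C_mul]
    ring

/-- The action of `g̃` on polynomials in `d` with coefficients in `M`. -/
def polyRep : Tilde g →ₗ⁅ℂ⁆ Module.End ℂ (PolyModule M) where
  toFun y := polyLin M y.left + y.right • polyD M
  map_add' y y' := by simp only [LieAlgebra.SemiDirectSum.add_eq_mk, map_add, add_smul]; abel
  map_smul' c y := by
    simp only [LieAlgebra.SemiDirectSum.smul_eq_mk, map_smul, smul_eq_mul, mul_smul, smul_add,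
      RingHom.id_apply]
  map_lie' {y y'} := by
    obtain ⟨z, c⟩ := y
    obtain ⟨z', c'⟩ := y'
    have hd : ∀ (c : ℂ) z, (degAction g c : LieDerivation ℂ (Hat g) (Hat g)) z = c • deg g z :=
      fun _ _ => rfl
    have hcc : ⁅c, c'⁆ = 0 := by rw [LieRing.of_associative_ring_bracket, mul_comm, sub_self]
    rw [LieRing.of_associative_ring_bracket]
    simp only [LieAlgebra.SemiDirectSum.lie_eq_mk, hd, hcc, zero_smul, add_zero, map_sub, map_add,
      map_smul, polyLin_lie, ← polyD_comm, add_mul, mul_add, smul_mul_assoc, mul_smul_comm,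
      smul_sub, smul_add, smul_smul, mul_comm c' c]
    abel

instance : LieRingModule (Tilde g) (PolyModule M) :=
  LieRingModule.compLieHom (PolyModule M) (polyRep M)

instance : LieModule ℂ (Tilde g) (PolyModule M) :=
  LieModule.compLieHom (PolyModule M) (polyRep M)

lemma hatIncl_lie_poly (z : Hat g) (F : PolyModule M) :
    ⁅hatIncl g z, F⁆ = polyLin M z F := by
  change (polyLin M z + (0 : ℂ) • polyD M) _ = _
  rw [zero_smul, add_zero]

/-- The coefficient of `X ^ k` of a polynomial with coefficients in `M`. -/
def polyCoeff (k : ℕ) : PolyModule M →ₗ[ℂ] M :=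
  TensorProduct.lift ((LinearMap.lsmul ℂ M) ∘ₗ lcoeff ℂ k)

variable {M} in
@[simp]
lemma polyCoeff_tmul (k : ℕ) (f : ℂ[X]) (m : M) : polyCoeff M k (polyTmul f m) = f.coeff k • m := by
  rfl

/-- The polynomials of degree less than `k` with coefficients in `M`. -/
def polyDegreeLT (k : ℕ) : Submodule ℂ (PolyModule M) :=
  Submodule.span ℂ {F | ∃ (f : ℂ[X]) (m : M), f.degree < k ∧ F = polyTmul f m}

lemma exists_mem_polyDegreeLT (F : PolyModule M) : ∃ k, F ∈ polyDegreeLT M k := by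
  induction F using poly_induction with
  | h0 => exact ⟨0, zero_mem _⟩
  | ht f m =>
    exact ⟨f.natDegree + 1, Submodule.subset_span ⟨f, m,
      (degree_le_natDegree).trans_lt (by exact_mod_cast Nat.lt_succ_self _), rfl⟩⟩
  | ha F F' h h' =>
    obtain ⟨k, h⟩ := h
    obtain ⟨k', h'⟩ := h'
    have mono : ∀ {i j : ℕ}, i ≤ j → polyDegreeLT M i ≤ polyDegreeLT M j := by
      intro i j hij
      apply Submodule.span_mono
      rintro _ ⟨f, m, hf, rfl⟩
      exact ⟨f, m, hf.trans_le (by exact_mod_cast hij), rfl⟩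
    exact ⟨max k k', add_mem (mono (le_max_left _ _) h) (mono (le_max_right _ _) h')⟩

lemma polyDegreeLT_zero : polyDegreeLT M 0 = ⊥ := by
  rw [polyDegreeLT, Submodule.span_eq_bot]
  rintro _ ⟨f, m, hf, rfl⟩
  have : f = 0 := by
    rw [← degree_eq_bot]
    by_contra h
    rw [degree_eq_natDegree (fun h0 => h (by simp [h0]))] at hf
    exact absurd hf (by simp)
  rw [this]
  exact TensorProduct.zero_tmul _ m

variable {M}

lemma mem_polyDegreeLT_of_coeff_eq_zero {k : ℕ} {F : PolyModule M}
    (hF : F ∈ polyDegreeLT M (k + 1)) (h : polyCoeff M k F = 0) : F ∈ polyDegreeLT M k := by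
  suffices H : F - polyTmul (X ^ k) (polyCoeff M k F) ∈ polyDegreeLT M k by simpa [h] using H
  clear h
  induction hF using Submodule.span_induction with
  | mem F hF =>
    obtain ⟨f, m, hf, rfl⟩ := hF
    rw [polyCoeff_tmul, map_smul, ← polyTmul_smul, ← polyTmul_sub]
    refine Submodule.subset_span ⟨_, m, ?_, rfl⟩
    rw [degree_lt_iff_coeff_zero]
    intro j hj
    rw [degree_lt_iff_coeff_zero] at hf
    rcases hj.eq_or_lt with rfl | hj
    · simp
    · rw [coeff_sub, hf j hj, coeff_smul, coeff_X_pow, if_neg hj.ne', smul_zero, sub_zero]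
  | zero => simp
  | add F F' _ _ h h' =>
    have := add_mem h h'
    rwa [map_add, map_add, add_sub_add_comm]
  | smul c F _ h =>
    have := Submodule.smul_mem _ c h
    rwa [map_smul, map_smul, ← smul_sub]

/-- `ĝ` preserves the degree and acts coefficientwise on leading coefficients. -/
lemma polyLin_mem_degreeLT {k : ℕ} {F : PolyModule M} (hF : F ∈ polyDegreeLT M (k + 1))
    (z : Hat g) :
    polyLin M z F ∈ polyDegreeLT M (k + 1) ∧ polyCoeff M k (polyLin M z F) = ⁅z, polyCoeff M k F⁆ := by
  have key : ∀ (c : ℂ) (z : Hat g),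
      taylorTensor M c (LieModule.toEnd ℂ (Hat g) M z) F ∈ polyDegreeLT M (k + 1) ∧
      polyCoeff M k (taylorTensor M c (LieModule.toEnd ℂ (Hat g) M z) F) =
        ⁅z, polyCoeff M k F⁆ := by
    intro c z
    induction hF using Submodule.span_induction with
    | mem F hF =>
      obtain ⟨f, m, hf, rfl⟩ := hF
      refine ⟨Submodule.subset_span ⟨taylor c f, ⁅z, m⁆, ?_, rfl⟩, ?_⟩
      · rwa [degree_taylor]
      · have hk : (taylor c f).coeff k = f.coeff k := by
          have hle : f.natDegree ≤ k := by
            by_contra! hlt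
            rw [degree_lt_iff_coeff_zero] at hf
            have h0 := hf f.natDegree hlt
            rw [coeff_natDegree, leadingCoeff_eq_zero] at h0
            simp [h0] at hlt
          rcases hle.eq_or_lt with h | h
          · rw [← h, coeff_natDegree, ← leadingCoeff_taylor c f, leadingCoeff, natDegree_taylor]
          · rw [coeff_eq_zero_of_natDegree_lt h,
              coeff_eq_zero_of_natDegree_lt (by rwa [natDegree_taylor])]
        simp [hk]
    | zero => simp
    | add F F' _ _ h h' =>
      simp only [map_add, lie_add, h.2, h'.2, and_true]
      exact add_mem h.1 h'.1
    | smul c F _ h =>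
      simp only [map_smul, lie_smul, h.2, and_true]
      exact Submodule.smul_mem _ _ h.1
  induction z using hat_induction with
  | h0 => simp
  | hl x n => rw [polyLin_loopElem]; exact key _ _
  | hK c =>
    rw [map_smul, polyLin_central, LinearMap.smul_apply, map_smul, (key _ _).2, smul_lie]
    exact ⟨Submodule.smul_mem _ _ (key _ _).1, rfl⟩
  | ha z w hz hw =>
    simp only [map_add, LinearMap.add_apply, add_lie, hz.2, hw.2, and_true]
    exact add_mem hz.1 hw.1

/-- An isomorphism `M[d] ≅ N[d]` with `M` irreducible and `N ≠ 0` yields a nonzero homomorphism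
`M → N`: embed `M` into `N[d]`, map to polynomials in `d`, and take the leading coefficient. -/
lemma exists_hom_of_withD_equiv {M : Type*} [AddCommGroup M] [Module ℂ M]
    [LieRingModule (Hat g) M] {N : Type*} [AddCommGroup N] [Module ℂ N]
    [LieRingModule (Hat g) N] [LieModule ℂ (Hat g) N] [Nontrivial N]
    [LieModule.IsIrreducible ℂ (Hat g) M] (e : WithD g M ≃ₗ⁅ℂ, Tilde g⁆ WithD g N) :
    ∃ φ : M →ₗ⁅ℂ, Hat g⁆ N, φ ≠ 0 := by
  let const : N →ₗ[ℂ] PolyModule N := polyTmul 1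
  have hconst : ∀ n, polyCoeff N 0 (const n) = n := fun n => by
    change polyCoeff N 0 (polyTmul 1 n) = n
    simp
  obtain ⟨Φ, hΦ⟩ := exists_induced_lift (hatIncl g) const (fun z n => by
    rw [hatIncl_lie_poly]
    change polyTmul 1 ⁅z, n⁆ = polyLin N z (polyTmul 1 n)
    induction z using hat_induction with
    | h0 => simp
    | hl x k => rw [polyLin_loopElem]; simp
    | hK c => rw [map_smul, LinearMap.smul_apply, polyLin_central]; simp
    | ha z w hz hw => rw [add_lie, map_add, hz, hw, map_add, LinearMap.add_apply])
  let Θ : WithD g M →ₗ⁅ℂ, Tilde g⁆ PolyModule N := Φ.comp (e : WithD g M →ₗ⁅ℂ, Tilde g⁆ WithD g N)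
  let f : M →ₗ[ℂ] PolyModule N := Θ.toLinearMap ∘ₗ inducedMk (hatIncl g)
  have hf : ∀ (z : Hat g) m, f ⁅z, m⁆ = polyLin N z (f m) := by
    intro z m
    change Θ (inducedMk (hatIncl g) ⁅z, m⁆) = _
    rw [inducedMk_lie, LieModuleHom.map_lie, hatIncl_lie_poly]
    rfl
  have hf0 : ∃ m, f m ≠ 0 := by
    by_contra! h
    have hΘ : Θ = 0 := induced_hom_ext (hatIncl g) fun m => h m
    obtain ⟨n, hn⟩ := exists_ne (0 : N)
    apply hn
    have h1 : Θ (e.symm (inducedMk (hatIncl g) n)) = const n := by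
      change Φ (e (e.symm _)) = _
      rw [LieModuleEquiv.apply_symm_apply, hΦ]
    rw [← hconst n, ← h1, hΘ]
    exact map_zero (polyCoeff N 0)
  -- the least `k` for which some nonzero vector of `M` is mapped to degree less than `k`
  have hex : ∃ k, ∃ m, m ≠ 0 ∧ f m ∈ polyDegreeLT N k := by
    obtain ⟨m, hm⟩ := hf0
    obtain ⟨k, hk⟩ := exists_mem_polyDegreeLT N (f m)
    exact ⟨k, m, fun h => hm (by rw [h, map_zero]), hk⟩
  classical
  have hstab : ∀ k, (∃ m, m ≠ 0 ∧ f m ∈ polyDegreeLT N (k + 1)) →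
      ∀ m, f m ∈ polyDegreeLT N (k + 1) := by
    rintro k ⟨m, hm, hfm⟩
    let S : LieSubmodule ℂ (Hat g) M :=
      { (polyDegreeLT N (k + 1)).comap f with
        lie_mem := fun {z m} hm => by
          change f ⁅z, m⁆ ∈ polyDegreeLT N (k + 1)
          rw [hf]
          exact (polyLin_mem_degreeLT hm z).1 }
    have : Nontrivial S := ⟨⟨⟨m, hfm⟩, 0, fun h => hm (congrArg Subtype.val h)⟩⟩
    have hS := LieSubmodule.eq_top_of_isIrreducible ℂ (Hat g) M S
    intro m
    have : m ∈ S := by rw [hS]; trivial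
    exact this
  obtain ⟨m₀, hm₀, hfm₀⟩ := Nat.find_spec hex
  obtain ⟨k, hk⟩ : ∃ k, Nat.find hex = k + 1 ∨ Nat.find hex = 0 := by
    cases h : Nat.find hex with
    | zero => exact ⟨0, Or.inr rfl⟩
    | succ k => exact ⟨k, Or.inl rfl⟩
  have h0 : polyDegreeLT N 0 ≤ polyDegreeLT N 1 := by rw [polyDegreeLT_zero]; exact bot_le
  rcases hk with hk | hk
  · have hall := hstab k (hk ▸ Nat.find_spec hex)
    refine ⟨{ polyCoeff N k ∘ₗ f with
      map_lie' := fun {z m} => ?_ }, fun h => ?_⟩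
    · change polyCoeff N k (f ⁅z, m⁆) = ⁅z, polyCoeff N k (f m)⁆
      rw [hf]
      exact (polyLin_mem_degreeLT (hall m) z).2
    · refine Nat.find_min hex (m := k) (by omega) ⟨m₀, hm₀, ?_⟩
      exact mem_polyDegreeLT_of_coeff_eq_zero (hall m₀) (LieModuleHom.congr_fun h m₀)
  -- the bound cannot be `0`: then `f` would have a kernel, which would be all of `M`
  · exfalso
    obtain ⟨m, hm⟩ := hf0
    have hall := hstab 0 ⟨m₀, hm₀, h0 (hk ▸ hfm₀)⟩
    have hker : LinearMap.ker f ≠ ⊥ := fun h => hm₀ (by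
      rw [hk, polyDegreeLT_zero, Submodule.mem_bot] at hfm₀
      have : m₀ ∈ LinearMap.ker f := hfm₀
      rwa [h, Submodule.mem_bot] at this)
    let S : LieSubmodule ℂ (Hat g) M :=
      { LinearMap.ker f with
        lie_mem := fun {z m} (hm : f m = 0) => by
          change f ⁅z, m⁆ = 0
          rw [hf, hm, map_zero] }
    rw [hk, polyDegreeLT_zero, Submodule.mem_bot] at hfm₀
    have : Nontrivial S := ⟨⟨⟨m₀, hfm₀⟩, 0, fun h => hm₀ (congrArg Subtype.val h)⟩⟩
    have hS := LieSubmodule.eq_top_of_isIrreducible ℂ (Hat g) M S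
    have hmS : m ∈ S := by rw [hS]; trivial
    exact hm hmS

end PolynomialModel

/-! ### Tensor products with smooth modules -/

section Smooth

section EnvAction

variable {G : Type*} [LieRing G] [LieAlgebra ℂ G]
  {M : Type*} [AddCommGroup M] [Module ℂ M] [LieRingModule G M] [LieModule ℂ G M]
  {N : Type*} [AddCommGroup N] [Module ℂ N] [LieRingModule G N] [LieModule ℂ G N]

lemma env_induction {p : UniversalEnvelopingAlgebra ℂ G → Prop}
    (hι : ∀ x, p (UniversalEnvelopingAlgebra.ι ℂ x)) (hc : ∀ c : ℂ, p (algebraMap ℂ _ c))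
    (ha : ∀ u v, p u → p v → p (u + v)) (hm : ∀ u v, p u → p v → p (u * v))
    (u : UniversalEnvelopingAlgebra ℂ G) : p u := by
  have hu : u ∈ Algebra.adjoin ℂ (Set.range (UniversalEnvelopingAlgebra.ι ℂ : G → _)) := by
    rw [adjoin_range_ι]; trivial
  induction hu using Algebra.adjoin_induction with
  | mem x hx => obtain ⟨y, rfl⟩ := hx; exact hι y
  | algebraMap r => exact hc r
  | add x y _ _ hx hy => exact ha _ _ hx hy
  | mul x y _ _ hx hy => exact hm _ _ hx hy

lemma map_envAction (φ : M →ₗ⁅ℂ, G⁆ N) (u : UniversalEnvelopingAlgebra ℂ G) (m : M) :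
    φ (envAction M u m) = envAction N u (φ m) := by
  induction u using env_induction generalizing m with
  | hι x => rw [envAction_ι, envAction_ι, LieModuleHom.map_lie]
  | hc c => simp [Algebra.algebraMap_eq_smul_one]
  | ha u v hu hv => simp [hu, hv]
  | hm u v hu hv => simp [hu, hv]

lemma envAction_mem (S : LieSubmodule ℂ G M) (u : UniversalEnvelopingAlgebra ℂ G) {m : M}
    (hm : m ∈ S) : envAction M u m ∈ S := by
  induction u using env_induction generalizing m with
  | hι x => rw [envAction_ι]; exact S.lie_mem hm
  | hc c =>
    rw [Algebra.algebraMap_eq_smul_one, map_smul, map_one]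
    exact S.smul_mem c hm
  | ha u v hu hv => rw [map_add]; exact add_mem (hu hm) (hv hm)
  | hm u v hu hv => rw [map_mul]; exact hu (hv hm)

end EnvAction

section Schur

variable {G : Type*} [LieRing G] {M : Type*} [AddCommGroup M] [Module ℂ M] [LieRingModule G M]
  {N : Type*} [AddCommGroup N] [Module ℂ N] [LieRingModule G N]

lemma exists_ne_zero_mem {S : LieSubmodule ℂ G M} (hS : S ≠ ⊥) : ∃ x ∈ S, x ≠ 0 := by
  by_contra! h
  exact hS ((LieSubmodule.eq_bot_iff S).2 h)

lemma lieHom_bijective_of_irreducible [LieModule.IsIrreducible ℂ G M]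
    [LieModule.IsIrreducible ℂ G N] (φ : M →ₗ⁅ℂ, G⁆ N) (hφ : φ ≠ 0) : Function.Bijective φ := by
  have hker : φ.ker = ⊥ := by
    rcases eq_bot_or_eq_top φ.ker with h | h
    · exact h
    · refine absurd ?_ hφ
      ext m
      have : m ∈ φ.ker := by rw [h]; trivial
      exact this
  have hrange : φ.range = ⊤ := by
    rcases eq_bot_or_eq_top φ.range with h | h
    · refine absurd ?_ hφ
      ext m
      have : φ m ∈ φ.range := ⟨m, rfl⟩
      rw [h] at this
      exact this
    · exact h
  refine ⟨(LieModuleHom.ker_eq_bot φ).1 hker, fun n => ?_⟩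
  have : n ∈ φ.range := by rw [hrange]; trivial
  exact this

lemma lieEquiv_of_bijective (φ : M →ₗ⁅ℂ, G⁆ N) (h : Function.Bijective φ) :
    Nonempty (M ≃ₗ⁅ℂ, G⁆ N) :=
  ⟨{ φ with
    invFun := (Equiv.ofBijective φ h).symm
    left_inv := (Equiv.ofBijective φ h).left_inv
    right_inv := (Equiv.ofBijective φ h).right_inv }⟩

/-- Schur's lemma for two irreducible Lie modules. -/
lemma lieEquiv_of_irreducible [LieModule.IsIrreducible ℂ G M]
    [LieModule.IsIrreducible ℂ G N] (φ : M →ₗ⁅ℂ, G⁆ N) (hφ : φ ≠ 0) :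
    Nonempty (M ≃ₗ⁅ℂ, G⁆ N) :=
  lieEquiv_of_bijective φ (lieHom_bijective_of_irreducible φ hφ)

lemma nontrivial_of_isIrreducible [h : LieModule.IsIrreducible ℂ G M] : Nontrivial M := by
  obtain ⟨a, b, hab⟩ := h.toNontrivial
  by_contra hM
  rw [not_nontrivial_iff_subsingleton] at hM
  exact hab (by ext x; simp [Subsingleton.elim x 0])

lemma lieSpan_singleton_eq_top [LieModule.IsIrreducible ℂ G M] {v : M} (hv : v ≠ 0) :
    LieSubmodule.lieSpan ℂ G {v} = ⊤ := by
  rcases eq_bot_or_eq_top (LieSubmodule.lieSpan ℂ G {v}) with h | h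
  · refine absurd ?_ hv
    have : v ∈ LieSubmodule.lieSpan ℂ G {v} := LieSubmodule.subset_lieSpan rfl
    rw [h] at this
    exact this
  · exact h

end Schur

variable {g : Type*} [LieRing g] [LieAlgebra ℂ g]

/-- The part of the enveloping algebra of `ĝ` generated by the elements `x ⊗ t^k` with `k ≥ N`. -/
def upperEnv (g : Type*) [LieRing g] [LieAlgebra ℂ g] (N : ℤ) :
    Subalgebra ℂ (UniversalEnvelopingAlgebra ℂ (Hat g)) :=
  Algebra.adjoin ℂ {u | ∃ (x : g) (k : ℤ), N ≤ k ∧ u = UniversalEnvelopingAlgebra.ι ℂ (loopElem x k)}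

lemma ι_mem_upperEnv {g : Type*} [LieRing g] [LieAlgebra ℂ g] {N : ℤ} (x : g) {k : ℤ}
    (hk : N ≤ k) : UniversalEnvelopingAlgebra.ι ℂ (loopElem x k) ∈ upperEnv g N :=
  Algebra.subset_adjoin ⟨x, k, hk, rfl⟩

/-- The vectors killed by all `x ⊗ t^k` with `k ≥ N`. -/
def smoothLayer (V : Type*) [AddCommGroup V] [Module ℂ V] [LieRingModule (Hat g) V]
    [LieModule ℂ (Hat g) V] (N : ℤ) : Submodule ℂ V where
  carrier := {v | ∀ (x : g) (k : ℤ), N ≤ k → ⁅loopElem x k, v⁆ = 0}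
  add_mem' hv hw x k hk := by rw [lie_add, hv x k hk, hw x k hk, add_zero]
  zero_mem' x k hk := lie_zero _
  smul_mem' c v hv x k hk := by rw [lie_smul, hv x k hk, smul_zero]

/-- A `ĝ`-module is smooth if each of its vectors is killed by all `x ⊗ t^k` with `k` large. -/
def IsSmooth (g V : Type*) [LieRing g] [LieAlgebra ℂ g] [AddCommGroup V] [Module ℂ V]
    [LieRingModule (Hat g) V] [LieModule ℂ (Hat g) V] : Prop :=
  ∀ v : V, ∃ N : ℤ, v ∈ smoothLayer (g := g) V N

/-- A `ĝ`-module is loop dense if, for each `N`, the operators generated by the action of the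
`x ⊗ t^k` with `k ≥ N` approximate every linear operator on every finite set of vectors. -/
def IsLoopDense (g E : Type*) [LieRing g] [LieAlgebra ℂ g] [AddCommGroup E] [Module ℂ E]
    [LieRingModule (Hat g) E] [LieModule ℂ (Hat g) E] : Prop :=
  ∀ (N : ℤ) (T : Module.End ℂ E) (s : Finset E),
    ∃ u ∈ upperEnv g N, ∀ e ∈ s, envAction E u e = T e

variable {V : Type*} [AddCommGroup V] [Module ℂ V] [LieRingModule (Hat g) V]
  [LieModule ℂ (Hat g) V]
  {V' : Type*} [AddCommGroup V'] [Module ℂ V'] [LieRingModule (Hat g) V']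
  [LieModule ℂ (Hat g) V']
  {E : Type*} [AddCommGroup E] [Module ℂ E] [LieRingModule (Hat g) E] [LieModule ℂ (Hat g) E]
  {E' : Type*} [AddCommGroup E'] [Module ℂ E'] [LieRingModule (Hat g) E']
  [LieModule ℂ (Hat g) E']

lemma smoothLayer_mono {N N' : ℤ} (h : N ≤ N') :
    smoothLayer (g := g) V N ≤ smoothLayer (g := g) V N' :=
  fun _ hv x k hk => hv x k (h.trans hk)

lemma IsSmooth.exists_layer (hV : IsSmooth g V) (s : Finset V) :
    ∃ N : ℤ, ∀ v ∈ s, v ∈ smoothLayer (g := g) V N := by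
  classical
  induction s using Finset.induction_on with
  | empty => exact ⟨0, by simp⟩
  | insert v s _ ih =>
    obtain ⟨N, hN⟩ := ih
    obtain ⟨N', hN'⟩ := hV v
    refine ⟨max N N', fun w hw => ?_⟩
    rcases Finset.mem_insert.1 hw with rfl | hw
    · exact smoothLayer_mono (le_max_right _ _) hN'
    · exact smoothLayer_mono (le_max_left _ _) (hN w hw)

/-- The generators `x ⊗ t^k` with `k` large do not see a smooth tensor factor. -/
lemma envAction_tmul {N : ℤ} {u : UniversalEnvelopingAlgebra ℂ (Hat g)} (hu : u ∈ upperEnv g N)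
    {v : V} (hv : v ∈ smoothLayer (g := g) V N) (e : E) :
    envAction (E ⊗[ℂ] V) u (e ⊗ₜ v) = envAction E u e ⊗ₜ v := by
  induction hu using Algebra.adjoin_induction generalizing e with
  | mem u hu =>
    obtain ⟨x, k, hk, rfl⟩ := hu
    rw [envAction_ι, envAction_ι, TensorProduct.LieModule.lie_tmul_right, hv x k hk,
      TensorProduct.tmul_zero, add_zero]
  | algebraMap c =>
    simp [Algebra.algebraMap_eq_smul_one, TensorProduct.smul_tmul']
  | add u u' _ _ h h' => simp [h, h', TensorProduct.add_tmul]
  | mul u u' _ _ h h' => simp [h, h']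

/-- An element of `E ⊗ V` in coordinates with respect to a basis of `E`. -/
lemma exists_basis_tmul {κ : Type*} (B : Module.Basis κ ℂ E) (x : E ⊗[ℂ] V) :
    ∃ w : κ →₀ V, x = ∑ q ∈ w.support, B q ⊗ₜ w q := by
  obtain ⟨w, hw⟩ := TensorProduct.eq_repr_basis_left B x
  exact ⟨w, hw.symm⟩

/-- Contraction of the first tensor factor against a linear form. -/
def contractLeft (f : Module.Dual ℂ E) : E ⊗[ℂ] V →ₗ[ℂ] V :=
  (TensorProduct.lid ℂ V).toLinearMap ∘ₗ LinearMap.rTensor V f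

@[simp]
lemma contractLeft_tmul (f : Module.Dual ℂ E) (e : E) (v : V) :
    contractLeft f (e ⊗ₜ[ℂ] v) = f e • v := by simp [contractLeft]

/-- Contraction of the second tensor factor against a linear form. -/
def contractRight (f : Module.Dual ℂ V) : E ⊗[ℂ] V →ₗ[ℂ] E :=
  (TensorProduct.rid ℂ E).toLinearMap ∘ₗ LinearMap.lTensor E f

@[simp]
lemma contractRight_tmul (f : Module.Dual ℂ V) (e : E) (v : V) :
    contractRight f (e ⊗ₜ[ℂ] v) = f v • e := by simp [contractRight]

lemma contractLeft_basis {κ : Type*} (B : Module.Basis κ ℂ E) (w : κ →₀ V) (p : κ) :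
    contractLeft (B.coord p) (∑ q ∈ w.support, B q ⊗ₜ[ℂ] w q) = w p := by
  classical
  simp only [map_sum, contractLeft_tmul, Module.Basis.coord_apply, Module.Basis.repr_self,
    Finsupp.single_apply, ite_smul, one_smul, zero_smul]
  rw [Finset.sum_ite_eq']
  simp +contextual

lemma tmul_ne_zero_of_field {e : E} {v : V} (he : e ≠ 0) (hv : v ≠ 0) : e ⊗ₜ[ℂ] v ≠ 0 := by
  intro h
  obtain ⟨f, hf⟩ : ∃ f : Module.Dual ℂ E, f e ≠ 0 := by
    by_contra! hf
    exact he ((Module.forall_dual_apply_eq_zero_iff ℂ e).1 hf)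
  have := congrArg (contractLeft f) h
  rw [contractLeft_tmul, map_zero, smul_eq_zero] at this
  exact this.elim hf hv

/-- In a loop dense module tensored with a smooth one, some operators of the enveloping algebra act
on a given element as a matrix unit on the first factor. -/
lemma IsLoopDense.exists_matrixUnit {κ : Type*} (hE : IsLoopDense g E) (hV : IsSmooth g V)
    (B : Module.Basis κ ℂ E) (w : κ →₀ V) (p : κ) (e : E) (N : ℤ) :
    ∃ u ∈ upperEnv g N, envAction E u (B p) = e ∧
      envAction (E ⊗[ℂ] V) u (∑ q ∈ w.support, B q ⊗ₜ w q) = e ⊗ₜ w p := by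
  classical
  obtain ⟨N', hN'⟩ := hV.exists_layer (w.support.image w)
  obtain ⟨u, hu, hus⟩ := hE (max N N') ((B.coord p).smulRight e) (insert (B p) (w.support.image B))
  have hmono : upperEnv g (max N N') ≤ upperEnv g N :=
    Algebra.adjoin_mono fun _ ⟨x, k, hk, h⟩ => ⟨x, k, (le_max_left _ _).trans hk, h⟩
  refine ⟨u, hmono hu, ?_, ?_⟩
  · rw [hus _ (Finset.mem_insert_self _ _)]
    simp
  · have h : ∀ q ∈ w.support, envAction (E ⊗[ℂ] V) u (B q ⊗ₜ w q) =
        if q = p then e ⊗ₜ w q else 0 := by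
      intro q hq
      rw [envAction_tmul hu (smoothLayer_mono (le_max_right _ _)
        (hN' _ (Finset.mem_image_of_mem _ hq))),
        hus _ (Finset.mem_insert_of_mem (Finset.mem_image_of_mem _ hq))]
      by_cases hqp : q = p
      · subst hqp; simp
      · simp [hqp]
    rw [map_sum, Finset.sum_congr rfl h, Finset.sum_ite_eq']
    split_ifs with hp
    · rfl
    · rw [Finsupp.notMem_support_iff.1 hp, TensorProduct.tmul_zero]

/-- The tensor product of a loop dense module and an irreducible smooth module is irreducible. -/
lemma IsLoopDense.irreducible_tensor [Nontrivial E] (hE : IsLoopDense g E) (hV : IsSmooth g V)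
    [LieModule.IsIrreducible ℂ (Hat g) V] : LieModule.IsIrreducible ℂ (Hat g) (E ⊗[ℂ] V) := by
  have : Nontrivial V := nontrivial_of_isIrreducible (G := Hat g)
  obtain ⟨e₀, he₀⟩ := exists_ne (0 : E)
  obtain ⟨v₀, hv₀⟩ := exists_ne (0 : V)
  have : Nontrivial (E ⊗[ℂ] V) := ⟨⟨_, 0, tmul_ne_zero_of_field he₀ hv₀⟩⟩
  refine LieModule.IsIrreducible.mk fun S hS => ?_
  obtain ⟨x, hxS, hx⟩ := exists_ne_zero_mem hS
  let B := Module.Basis.ofVectorSpace ℂ E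
  obtain ⟨w, rfl⟩ := exists_basis_tmul B x
  obtain ⟨p, hp⟩ : ∃ p, w p ≠ 0 := by
    by_contra! h
    exact hx (Finset.sum_eq_zero fun q _ => by rw [h q, TensorProduct.tmul_zero])
  let L : LieSubmodule ℂ (Hat g) V :=
    { carrier := {v | ∀ e : E, e ⊗ₜ[ℂ] v ∈ S}
      add_mem' := fun hv hw e => by rw [TensorProduct.tmul_add]; exact add_mem (hv e) (hw e)
      zero_mem' := fun e => by rw [TensorProduct.tmul_zero]; exact zero_mem _
      smul_mem' := fun c v hv e => by rw [TensorProduct.tmul_smul]; exact S.smul_mem c (hv e)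
      lie_mem := fun {z v} hv e => by
        have h := sub_mem (S.lie_mem (x := z) (hv e)) (hv ⁅z, e⁆)
        rwa [TensorProduct.LieModule.lie_tmul_right, add_sub_cancel_left] at h }
  have hwp : w p ∈ L := fun e => by
    obtain ⟨u, _, _, hu⟩ := hE.exists_matrixUnit hV B w p e 0
    rw [← hu]
    exact envAction_mem S u hxS
  have : Nontrivial L := ⟨⟨⟨w p, hwp⟩, 0, fun h => hp (congrArg Subtype.val h)⟩⟩
  have hL := LieSubmodule.eq_top_of_isIrreducible ℂ (Hat g) V L
  rw [eq_top_iff]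
  rintro y -
  induction y using TensorProduct.induction_on with
  | zero => exact zero_mem _
  | add a b ha hb => exact add_mem ha hb
  | tmul e v =>
    have : v ∈ L := by rw [hL]; trivial
    exact this e

/-- A loop dense module is irreducible. -/
lemma IsLoopDense.irreducible [Nontrivial E] (hE : IsLoopDense g E) :
    LieModule.IsIrreducible ℂ (Hat g) E := by
  refine LieModule.IsIrreducible.mk fun S hS => ?_
  obtain ⟨e₀, he₀S, he₀⟩ := exists_ne_zero_mem hS
  obtain ⟨f, hf⟩ : ∃ f : Module.Dual ℂ E, f e₀ ≠ 0 := by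
    by_contra! hf
    exact he₀ ((Module.forall_dual_apply_eq_zero_iff ℂ e₀).1 hf)
  rw [eq_top_iff]
  rintro e -
  obtain ⟨u, -, hu⟩ := hE 0 (f.smulRight ((f e₀)⁻¹ • e)) {e₀}
  have h := hu e₀ (by simp)
  rw [LinearMap.smulRight_apply, smul_smul, mul_inv_cancel₀ hf, one_smul] at h
  rw [← h]
  exact envAction_mem S u he₀S

/-- A nonzero homomorphism `E ⊗ V → E' ⊗ V'` yields a nonzero linear map `E → E'` that commutes
with all `x ⊗ t^k` for `k` large. -/
lemma IsLoopDense.exists_left_map (hE : IsLoopDense g E) (hV : IsSmooth g V)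
    (hV' : IsSmooth g V') (φ : E ⊗[ℂ] V →ₗ⁅ℂ, Hat g⁆ E' ⊗[ℂ] V') (hφ : φ ≠ 0) :
    ∃ (N : ℤ) (θ : E →ₗ[ℂ] E'), θ ≠ 0 ∧
      ∀ (x : g) (k : ℤ), N ≤ k → ∀ e, θ ⁅loopElem x k, e⁆ = ⁅loopElem x k, θ e⁆ := by
  classical
  obtain ⟨e₀, v, hev⟩ : ∃ e v, φ (e ⊗ₜ[ℂ] v) ≠ 0 := by
    by_contra! h
    refine hφ (LieModuleHom.ext fun y => ?_)
    induction y using TensorProduct.induction_on with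
    | zero => simp
    | add a b ha hb => rw [map_add, ha, hb]; simp
    | tmul e v => exact h e v
  have he₀ : e₀ ≠ 0 := fun h => hev (by rw [h, TensorProduct.zero_tmul, map_zero])
  obtain ⟨f, hf⟩ : ∃ f : Module.Dual ℂ E, f e₀ ≠ 0 := by
    by_contra! hf
    exact he₀ ((Module.forall_dual_apply_eq_zero_iff ℂ e₀).1 hf)
  let B := Module.Basis.ofVectorSpace ℂ E'
  obtain ⟨w, hw⟩ := exists_basis_tmul B (φ (e₀ ⊗ₜ[ℂ] v))
  obtain ⟨p, hp⟩ : ∃ p, w p ≠ 0 := by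
    by_contra! h
    exact hev (hw.trans (Finset.sum_eq_zero fun q _ => by rw [h q, TensorProduct.tmul_zero]))
  obtain ⟨l, hl⟩ : ∃ l : Module.Dual ℂ V', l (w p) ≠ 0 := by
    by_contra! hl
    exact hp ((Module.forall_dual_apply_eq_zero_iff ℂ (w p)).1 hl)
  obtain ⟨N₁, hN₁⟩ := hV v
  obtain ⟨N₂, hN₂⟩ := hV'.exists_layer (w.support.image w)
  set N := max N₁ N₂ with hN
  have hv : v ∈ smoothLayer (g := g) V N := smoothLayer_mono (le_max_left _ _) hN₁
  let F : Submodule ℂ (E' ⊗[ℂ] V') :=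
    Submodule.span ℂ {y | ∃ (e : E') (v : V'), v ∈ smoothLayer (g := g) V' N ∧ y = e ⊗ₜ v}
  have hF : ∀ u ∈ upperEnv g N, ∀ y ∈ F, envAction (E' ⊗[ℂ] V') u y ∈ F ∧
      contractRight l (envAction (E' ⊗[ℂ] V') u y) = envAction E' u (contractRight l y) := by
    intro u hu y hy
    induction hy using Submodule.span_induction with
    | mem y hy =>
      obtain ⟨e, v, hv, rfl⟩ := hy
      rw [envAction_tmul hu hv]
      exact ⟨Submodule.subset_span ⟨_, v, hv, rfl⟩, by simp⟩
    | zero => simp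
    | add a b _ _ ha hb =>
      simp only [map_add, ha.2, hb.2, and_true]
      exact add_mem ha.1 hb.1
    | smul c a _ ha =>
      simp only [map_smul, ha.2, and_true]
      exact Submodule.smul_mem _ _ ha.1
  have hφF : ∀ e, φ (e ⊗ₜ[ℂ] v) ∈ F := by
    intro e
    obtain ⟨u, hu, hue⟩ := hE N (f.smulRight ((f e₀)⁻¹ • e)) {e₀}
    have h := hue e₀ (by simp)
    rw [LinearMap.smulRight_apply, smul_smul, mul_inv_cancel₀ hf, one_smul] at h
    rw [← h, ← envAction_tmul hu hv, map_envAction]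
    refine (hF u hu _ ?_).1
    rw [hw]
    exact sum_mem fun q hq => Submodule.subset_span ⟨_, _,
      smoothLayer_mono (le_max_right _ _) (hN₂ _ (Finset.mem_image_of_mem _ hq)), rfl⟩
  let θ : E →ₗ[ℂ] E' :=
    contractRight l ∘ₗ φ.toLinearMap ∘ₗ (TensorProduct.mk ℂ E V).flip v
  have hθ : ∀ e, θ e = contractRight l (φ (e ⊗ₜ[ℂ] v)) := fun e => rfl
  refine ⟨N, θ, fun h0 => ?_, fun x k hk e => ?_⟩
  · have h1 : B.coord p (θ e₀) = 0 := by rw [h0]; simp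
    rw [hθ, hw] at h1
    simp only [map_sum, contractRight_tmul, map_smul, Module.Basis.coord_apply,
      Module.Basis.repr_self, Finsupp.single_apply, smul_eq_mul, mul_ite, mul_one, mul_zero] at h1
    rw [Finset.sum_ite_eq', if_pos (Finsupp.mem_support_iff.2 hp)] at h1
    exact hl h1
  · have hu : UniversalEnvelopingAlgebra.ι ℂ (loopElem x k) ∈ upperEnv g N :=
      ι_mem_upperEnv x hk
    have h := (hF _ hu _ (hφF e)).2
    rw [← map_envAction, envAction_tmul hu hv, envAction_ι, envAction_ι] at h
    exact h

/-- A nonzero homomorphism `E ⊗ V → E ⊗ V'` yields a nonzero homomorphism `V → V'`. -/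
lemma IsLoopDense.exists_right_hom (hE : IsLoopDense g E) (hV : IsSmooth g V)
    (hV' : IsSmooth g V') (φ : E ⊗[ℂ] V →ₗ⁅ℂ, Hat g⁆ E ⊗[ℂ] V') (hφ : φ ≠ 0) :
    ∃ ψ : V →ₗ⁅ℂ, Hat g⁆ V', ψ ≠ 0 := by
  let B := Module.Basis.ofVectorSpace ℂ E
  obtain ⟨p⟩ : Nonempty (Module.Basis.ofVectorSpaceIndex ℂ E) := by
    by_contra h
    rw [not_nonempty_iff] at h
    have hsub : Subsingleton E := B.repr.toEquiv.subsingleton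
    refine hφ (LieModuleHom.ext fun y => ?_)
    obtain ⟨w, rfl⟩ := exists_basis_tmul B y
    simp
  let ψ : V →ₗ[ℂ] V' :=
    contractLeft (B.coord p) ∘ₗ φ.toLinearMap ∘ₗ TensorProduct.mk ℂ E V (B p)
  -- an operator approximating the matrix unit sending `B p` to `e` commutes with `φ`
  have key : ∀ e v, φ (e ⊗ₜ[ℂ] v) = e ⊗ₜ[ℂ] ψ v := by
    intro e v
    obtain ⟨w, hw⟩ := exists_basis_tmul B (φ (B p ⊗ₜ[ℂ] v))
    obtain ⟨N, hN⟩ := hV v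
    obtain ⟨u, hu, hue, hu'⟩ := hE.exists_matrixUnit hV' B w p e N
    have hψ : ψ v = w p := by
      change contractLeft (B.coord p) (φ (B p ⊗ₜ[ℂ] v)) = _
      rw [hw, contractLeft_basis]
    rw [hψ, ← hu', ← hw, ← map_envAction, envAction_tmul hu hN, hue]
  refine ⟨{ ψ with map_lie' := fun {z v} => ?_ }, fun h => hφ (LieModuleHom.ext fun y => ?_)⟩
  · change ψ ⁅z, v⁆ = ⁅z, ψ v⁆
    have h := LieModuleHom.map_lie φ z (B p ⊗ₜ[ℂ] v)
    rw [TensorProduct.LieModule.lie_tmul_right, map_add, key, key, key,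
      TensorProduct.LieModule.lie_tmul_right, add_right_inj] at h
    have h' := congrArg (contractLeft (B.coord p)) h
    simpa using h'
  · have h0 : ∀ v, ψ v = 0 := fun v => LieModuleHom.congr_fun h v
    induction y using TensorProduct.induction_on with
    | zero => simp
    | add a b ha hb => rw [map_add, ha, hb]; simp
    | tmul e v => rw [key, h0, TensorProduct.tmul_zero]; rfl

end Smooth

/-! ### Density of evaluation modules -/

section Density

/-- The closure of an algebra of operators in the topology of pointwise convergence, for the
discrete topology on the underlying space. -/
def pointClosure {E : Type*} [AddCommGroup E] [Module ℂ E] (A : Subalgebra ℂ (Module.End ℂ E)) :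
    Subalgebra ℂ (Module.End ℂ E) where
  carrier := {T | ∀ s : Finset E, ∃ a ∈ A, ∀ e ∈ s, a e = T e}
  mul_mem' := by
    classical
    intro T T' hT hT' s
    obtain ⟨a', ha', has'⟩ := hT' s
    obtain ⟨a, ha, has⟩ := hT (s.image T')
    refine ⟨a * a', mul_mem ha ha', fun e he => ?_⟩
    rw [Module.End.mul_apply, Module.End.mul_apply, has' e he, has _ (Finset.mem_image_of_mem _ he)]
  add_mem' := by
    classical
    intro T T' hT hT' s
    obtain ⟨a', ha', has'⟩ := hT' s
    obtain ⟨a, ha, has⟩ := hT s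
    refine ⟨a + a', add_mem ha ha', fun e he => ?_⟩
    rw [LinearMap.add_apply, LinearMap.add_apply, has' e he, has e he]
  algebraMap_mem' c s := ⟨_, A.algebraMap_mem c, fun _ _ => rfl⟩

/-- The Jacobson density theorem for an irreducible module all of whose endomorphisms are scalars. -/
lemma pointClosure_range_toEnd {g V : Type*} [LieRing g] [LieAlgebra ℂ g] [AddCommGroup V]
    [Module ℂ V] [LieRingModule g V] [LieModule ℂ g V] [LieModule.IsIrreducible ℂ g V]
    (hEnd : ∀ φ : V →ₗ⁅ℂ, g⁆ V, ∃ c : ℂ, ∀ v, φ v = c • v) :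
    pointClosure (Algebra.adjoin ℂ (Set.range (LieModule.toEnd ℂ g V))) = ⊤ := by
  set R := Algebra.adjoin ℂ (Set.range (LieModule.toEnd ℂ g V)) with hR
  have hmem : ∀ x, LieModule.toEnd ℂ g V x ∈ R := fun x => Algebra.subset_adjoin ⟨x, rfl⟩
  have : Nontrivial V := nontrivial_of_isIrreducible (G := g)
  have hsimple : IsSimpleModule R V := by
    refine (isSimpleModule_iff R V).2 ⟨fun S => ?_⟩
    let S' : LieSubmodule ℂ g V :=
      { carrier := S
        add_mem' := fun ha hb => S.add_mem ha hb
        zero_mem' := S.zero_mem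
        smul_mem' := fun c v hv => S.smul_mem (algebraMap ℂ R c) hv
        lie_mem := fun {x v} hv => S.smul_mem (⟨_, hmem x⟩ : R) hv }
    rcases eq_bot_or_eq_top S' with h | h
    · left
      rw [eq_bot_iff]
      intro v hv
      have : v ∈ S' := hv
      rw [h] at this
      exact this
    · right
      rw [eq_top_iff]
      intro v _
      have : v ∈ S' := by rw [h]; trivial
      exact this
  have hscalar : ∀ f : Module.End R V, ∃ c : ℂ, ∀ v, f v = c • v := by
    intro f
    exact hEnd
      { toFun := f
        map_add' := f.map_add
        map_smul' := fun c v => f.map_smul (algebraMap ℂ R c) v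
        map_lie' := fun {x v} => f.map_smul (⟨_, hmem x⟩ : R) v }
  rw [eq_top_iff]
  intro T _ s
  let T' : Module.End (Module.End R V) V :=
    { toFun := T
      map_add' := T.map_add
      map_smul' := fun f v => by
        obtain ⟨c, hc⟩ := hscalar f
        change T (f v) = f (T v)
        rw [hc, hc, map_smul] }
  obtain ⟨r, hr⟩ := jacobson_density T' s
  exact ⟨r, r.2, fun e he => (hr e he).symm⟩

/-- Polynomial interpolation at nonzero points by multiples of `t^N`. -/
lemma exists_interpolation (s : Finset ℂˣ) (r : ℂˣ → ℂ) (N : ℤ) :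
    ∃ p : Polynomial ℂ, ∀ c ∈ s, ∑ l ∈ p.support, p.coeff l * (c : ℂ) ^ (N + (l : ℤ)) = r c := by
  classical
  refine ⟨Lagrange.interpolate s (fun c : ℂˣ => (c : ℂ)) (fun c => r c * (c : ℂ) ^ (-N)),
    fun c hc => ?_⟩
  have h := Lagrange.eval_interpolate_at_node (s := s) (v := fun c : ℂˣ => (c : ℂ))
    (fun c => r c * (c : ℂ) ^ (-N)) (fun _ _ _ _ h => Units.ext h) hc
  set p := Lagrange.interpolate s (fun c : ℂˣ => (c : ℂ)) (fun c => r c * (c : ℂ) ^ (-N))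
  rw [Polynomial.eval_eq_sum, Polynomial.sum_def] at h
  have hN : (c : ℂ) ^ N ≠ 0 := zpow_ne_zero _ c.ne_zero
  calc ∑ l ∈ p.support, p.coeff l * (c : ℂ) ^ (N + (l : ℤ))
      = (c : ℂ) ^ N * ∑ l ∈ p.support, p.coeff l * (c : ℂ) ^ l := by
        rw [Finset.mul_sum]
        refine Finset.sum_congr rfl fun l _ => ?_
        rw [zpow_add₀ c.ne_zero, zpow_natCast]
        ring
    _ = r c := by
        rw [h, zpow_neg]
        field_simp

variable {g : Type*} [LieRing g] [LieAlgebra ℂ g] {m : ℕ} (V : Fin m → Type*)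
  [∀ i, AddCommGroup (V i)] [∀ i, Module ℂ (V i)]

/-- `atSlot` as a homomorphism of algebras. -/
def atSlotHom (i : Fin m) : Module.End ℂ (V i) →ₐ[ℂ] Module.End ℂ (⨂[ℂ] j, V j) :=
  AlgHom.ofLinearMap (atSlot V i)
    (by
      apply PiTensorProduct.ext
      ext v
      simp [atSlot_tprod])
    (fun A B => by
      apply PiTensorProduct.ext
      ext v
      simp [atSlot_tprod])

variable {V} in
/-- A tensor product of pointwise dense algebras of operators is pointwise dense. -/
lemma pointClosure_eq_top_of_slots (A : Subalgebra ℂ (Module.End ℂ (⨂[ℂ] j, V j)))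
    (R : ∀ i, Subalgebra ℂ (Module.End ℂ (V i))) (hR : ∀ i, pointClosure (R i) = ⊤)
    (hA : ∀ i, (R i).map (atSlotHom V i) ≤ A) : pointClosure A = ⊤ := by
  classical
  have hslot : ∀ i (T : Module.End ℂ (V i)), atSlot V i T ∈ pointClosure A := by
    intro i T s
    have hF : ∀ e : ⨂[ℂ] j, V j, ∃ F : Finset (V i), ∀ a : Module.End ℂ (V i),
        (∀ v ∈ F, a v = T v) → atSlot V i a e = atSlot V i T e := by
      intro e
      induction e using PiTensorProduct.induction_on with
      | smul_tprod r v =>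
        refine ⟨{v i}, fun a ha => ?_⟩
        rw [map_smul, map_smul, atSlot_tprod, atSlot_tprod, ha _ (Finset.mem_singleton_self _)]
      | add x y hx hy =>
        obtain ⟨F, hF⟩ := hx
        obtain ⟨F', hF'⟩ := hy
        refine ⟨F ∪ F', fun a ha => ?_⟩
        rw [map_add, map_add, hF a fun v hv => ha v (Finset.mem_union_left _ hv),
          hF' a fun v hv => ha v (Finset.mem_union_right _ hv)]
    choose F hF using hF
    have hT : T ∈ pointClosure (R i) := by rw [hR]; trivial
    obtain ⟨a, ha, has⟩ := hT (s.biUnion F)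
    exact ⟨atSlot V i a, hA i ⟨a, ha, rfl⟩, fun e he => hF e a fun v hv =>
      has v (Finset.mem_biUnion.2 ⟨e, he, hv⟩)⟩
  have hmap : ∀ (f : ∀ i, Module.End ℂ (V i)) (s : Finset (Fin m)),
      PiTensorProduct.map (fun i => if i ∈ s then f i else 1) ∈ pointClosure A := by
    intro f s
    induction s using Finset.induction_on with
    | empty =>
      have : PiTensorProduct.map (fun i => if i ∈ (∅ : Finset (Fin m)) then f i else 1) =
          (1 : Module.End ℂ (⨂[ℂ] j, V j)) := by
        apply PiTensorProduct.ext
        ext v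
        simp
      rw [this]
      exact one_mem _
    | insert i s hi ih =>
      have : PiTensorProduct.map (fun j => if j ∈ insert i s then f j else 1) =
          atSlot V i (f i) * PiTensorProduct.map (fun j => if j ∈ s then f j else 1) := by
        apply PiTensorProduct.ext
        ext v
        simp only [LinearMap.compMultilinearMap_apply, PiTensorProduct.map_tprod,
          Module.End.mul_apply, atSlot_tprod]
        congr 1
        ext j
        by_cases hj : j = i
        · subst hj; simp [hi]
        · simp [hj]
      rw [this]
      exact mul_mem (hslot i (f i)) ih
  let B := Basis.piTensorProduct fun i => Module.Basis.ofVectorSpace ℂ (V i)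
  have hunit : ∀ p q, (B.coord q).smulRight (B p) ∈ pointClosure A := by
    intro p q
    have h := hmap (fun i => ((Module.Basis.ofVectorSpace ℂ (V i)).coord (q i)).smulRight
      (Module.Basis.ofVectorSpace ℂ (V i) (p i))) Finset.univ
    convert h
    apply PiTensorProduct.ext
    ext v
    simp only [LinearMap.compMultilinearMap_apply, LinearMap.smulRight_apply, Finset.mem_univ,
      if_true, PiTensorProduct.map_tprod, Module.Basis.coord_apply, B,
      Basis.piTensorProduct_repr_tprod_apply, Basis.piTensorProduct_apply]
    rw [MultilinearMap.map_smul_univ]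
  have hrank : ∀ q e, (B.coord q).smulRight e ∈ pointClosure A := by
    intro q e
    have he : e ∈ Submodule.span ℂ (Set.range B) := by rw [B.span_eq]; trivial
    induction he using Submodule.span_induction with
    | mem e he => obtain ⟨p, rfl⟩ := he; exact hunit p q
    | zero =>
      have : (B.coord q).smulRight (0 : ⨂[ℂ] j, V j) = 0 := by ext; simp
      rw [this]
      exact zero_mem _
    | add e e' _ _ h h' =>
      have : (B.coord q).smulRight (e + e') =
          (B.coord q).smulRight e + (B.coord q).smulRight e' := by
        ext; simp
      rw [this]
      exact add_mem h h'
    | smul c e _ h =>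
      have : (B.coord q).smulRight (c • e) = c • (B.coord q).smulRight e := by
        ext; simp [smul_comm c]
      rw [this]
      exact Subalgebra.smul_mem _ h c
  rw [eq_top_iff]
  intro T _ s
  set Q := s.biUnion fun e => (B.repr e).support with hQ
  have hT : ∑ q ∈ Q, (B.coord q).smulRight (T (B q)) ∈ pointClosure A :=
    sum_mem fun q _ => hrank q _
  obtain ⟨a, ha, has⟩ := hT s
  refine ⟨a, ha, fun e he => ?_⟩
  rw [has e he]
  have hsub : (B.repr e).support ⊆ Q := Finset.subset_biUnion_of_mem (fun e => (B.repr e).support) he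
  conv_rhs => rw [← B.linearCombination_repr e, Finsupp.linearCombination_apply,
    Finsupp.sum_of_support_subset _ hsub _ (by simp)]
  simp

variable [∀ i, LieRingModule g (V i)] [∀ i, LieModule ℂ g (V i)] (a : Fin m → ℂˣ)

/-- `atSlot`, acting on the evaluation module. -/
def slotEnd (i : Fin m) : Module.End ℂ (V i) →ₐ[ℂ] Module.End ℂ (EvalModule V a) :=
  atSlotHom V i

variable {V}

lemma evalRep_apply (z : Hat g) :
    evalRep g V a z = ∑ i, atSlot V i (LieModule.toEnd ℂ g (V i) (evLin g (a i) z)) := by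
  change (∑ i, atSlot V i ∘ₗ (LieModule.toEnd ℂ g (V i)).toLinearMap ∘ₗ
    (ev g (a i)).toLinearMap) z = _
  rw [LinearMap.sum_apply]
  rfl

lemma loopElem_lie_eval (x : g) (k : ℤ) (e : EvalModule V a) :
    ⁅loopElem x k, e⁆ = ∑ i, (a i : ℂ) ^ k • slotEnd V a i (LieModule.toEnd ℂ g (V i) x) e := by
  have h : evalRep g V a (loopElem x k) =
      ∑ i, (a i : ℂ) ^ k • atSlot V i (LieModule.toEnd ℂ g (V i) x) := by
    rw [evalRep_apply]
    simp only [evLin_loopElem, map_smul]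
  have h' : LieModule.toEnd ℂ (Hat g) (EvalModule V a) (loopElem x k) =
      ∑ i, (a i : ℂ) ^ k • slotEnd V a i (LieModule.toEnd ℂ g (V i) x) := h
  rw [← LieModule.toEnd_apply_apply ℂ, h', LinearMap.sum_apply]
  rfl

lemma central_lie_eval (e : EvalModule V a) : ⁅central g, e⁆ = 0 := by
  have h : evalRep g V a (central g) = 0 := by
    rw [evalRep_apply]
    simp only [evLin_central, map_zero, Finset.sum_const_zero]
  have h' : LieModule.toEnd ℂ (Hat g) (EvalModule V a) (central g) = 0 := h
  rw [← LieModule.toEnd_apply_apply ℂ, h', LinearMap.zero_apply]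

lemma sum_loopElem_lie_eval (p : Polynomial ℂ) (N : ℤ) (x : g) (e : EvalModule V a) :
    ∑ l ∈ p.support, p.coeff l • ⁅loopElem x (N + l), e⁆ =
      ∑ i, (∑ l ∈ p.support, p.coeff l * (a i : ℂ) ^ (N + (l : ℤ))) •
        slotEnd V a i (LieModule.toEnd ℂ g (V i) x) e := by
  simp only [loopElem_lie_eval, Finset.smul_sum, Finset.sum_smul, smul_smul]
  rw [Finset.sum_comm]

/-- Evaluation modules at distinct points are loop dense, if all the factors are irreducible with
only scalar endomorphisms. Interpolation by multiples of `t^N` separates the factors. -/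
lemma isLoopDense_evalModule (ha : Function.Injective a)
    [∀ i, LieModule.IsIrreducible ℂ g (V i)]
    (hEnd : ∀ i, ∀ φ : V i →ₗ⁅ℂ, g⁆ V i, ∃ c : ℂ, ∀ v, φ v = c • v) :
    IsLoopDense g (EvalModule V a) := by
  classical
  intro N T s
  let A : Subalgebra ℂ (Module.End ℂ (EvalModule V a)) :=
    (upperEnv g N).map (envAction (EvalModule V a))
  have hA : ∀ i, (Algebra.adjoin ℂ (Set.range (LieModule.toEnd ℂ g (V i)))).map (slotEnd V a i) ≤
      A := by
    intro i
    rw [AlgHom.map_adjoin, Algebra.adjoin_le_iff]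
    rintro _ ⟨_, ⟨x, rfl⟩, rfl⟩
    obtain ⟨p, hp⟩ := exists_interpolation (Finset.univ.image a)
      (fun c => if c = a i then 1 else 0) N
    have hu : ∑ l ∈ p.support, p.coeff l • UniversalEnvelopingAlgebra.ι ℂ (loopElem x (N + l)) ∈
        upperEnv g N :=
      sum_mem fun l _ => (upperEnv g N).smul_mem (ι_mem_upperEnv x (by omega)) _
    refine ⟨_, hu, ?_⟩
    ext e
    change envAction (EvalModule V a) _ e = _
    rw [map_sum, LinearMap.sum_apply]
    simp only [map_smul, LinearMap.smul_apply, envAction_ι]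
    rw [sum_loopElem_lie_eval, Finset.sum_eq_single i]
    · rw [hp _ (Finset.mem_image_of_mem _ (Finset.mem_univ i)), if_pos rfl, one_smul]
    · intro j _ hj
      rw [hp _ (Finset.mem_image_of_mem _ (Finset.mem_univ j)), if_neg (fun h => hj (ha h)),
        zero_smul]
    · simp
  have htop : pointClosure A = ⊤ :=
    pointClosure_eq_top_of_slots A _ (fun i => pointClosure_range_toEnd (hEnd i)) hA
  have hT : T ∈ pointClosure A := by rw [htop]; trivial
  obtain ⟨_, ⟨u, hu, rfl⟩, h⟩ := hT s
  exact ⟨u, hu, h⟩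

variable {m' : ℕ} {V' : Fin m' → Type*} [∀ i, AddCommGroup (V' i)] [∀ i, Module ℂ (V' i)]
  [∀ i, LieRingModule g (V' i)] [∀ i, LieModule ℂ g (V' i)] (a' : Fin m' → ℂˣ)

/-- A linear map between evaluation modules that commutes with `x ⊗ t^k` for `k` large is a
homomorphism, since every power of `t` agrees at the evaluation points with a combination of
large powers. -/
lemma map_lie_of_large (θ : EvalModule V a →ₗ[ℂ] EvalModule V' a') (N : ℤ)
    (hθ : ∀ (x : g) (k : ℤ), N ≤ k → ∀ e, θ ⁅loopElem x k, e⁆ = ⁅loopElem x k, θ e⁆)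
    (z : Hat g) (e : EvalModule V a) : θ ⁅z, e⁆ = ⁅z, θ e⁆ := by
  classical
  induction z using hat_induction with
  | h0 => simp
  | ha z w hz hw => rw [add_lie, map_add, hz, hw, add_lie]
  | hK c => rw [smul_lie, central_lie_eval, smul_lie, central_lie_eval]; simp
  | hl x k =>
    obtain ⟨p, hp⟩ := exists_interpolation (Finset.univ.image a ∪ Finset.univ.image a')
      (fun c => (c : ℂ) ^ k) N
    have h1 : ⁅loopElem x k, e⁆ = ∑ l ∈ p.support, p.coeff l • ⁅loopElem x (N + l), e⁆ := by
      rw [sum_loopElem_lie_eval, loopElem_lie_eval]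
      refine Finset.sum_congr rfl fun i _ => ?_
      rw [hp (a i) (by simp)]
    have h2 : ⁅loopElem x k, θ e⁆ = ∑ l ∈ p.support, p.coeff l • ⁅loopElem x (N + l), θ e⁆ := by
      rw [sum_loopElem_lie_eval, loopElem_lie_eval]
      refine Finset.sum_congr rfl fun i _ => ?_
      rw [hp (a' i) (by simp)]
    rw [h1, h2, map_sum]
    refine Finset.sum_congr rfl fun l _ => ?_
    rw [map_smul, hθ x _ (by omega)]

lemma nontrivial_evalModule [∀ i, Nontrivial (V i)] : Nontrivial (EvalModule V a) := by
  let B := Basis.piTensorProduct fun i => Module.Basis.ofVectorSpace ℂ (V i)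
  have : ∀ i, Nonempty (Module.Basis.ofVectorSpaceIndex ℂ (V i)) :=
    fun i => (Module.Basis.ofVectorSpace ℂ (V i)).index_nonempty
  exact ⟨⟨B fun i => Classical.arbitrary _, 0, B.ne_zero _⟩⟩

/-- A nonzero homomorphism between tensor products of evaluation modules with smooth irreducible
modules yields isomorphisms of both factors: the linear map of `exists_left_map` is a homomorphism by
`map_lie_of_large`, and once the first factors are identified `exists_right_hom` applies. -/
theorem equiv_of_tensor_hom (ha : Function.Injective a) (ha' : Function.Injective a')
    [∀ i, LieModule.IsIrreducible ℂ g (V i)] [∀ i, LieModule.IsIrreducible ℂ g (V' i)]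
    (hEnd : ∀ i, ∀ φ : V i →ₗ⁅ℂ, g⁆ V i, ∃ c : ℂ, ∀ v, φ v = c • v)
    (hEnd' : ∀ i, ∀ φ : V' i →ₗ⁅ℂ, g⁆ V' i, ∃ c : ℂ, ∀ v, φ v = c • v)
    {W : Type*} [AddCommGroup W] [Module ℂ W] [LieRingModule (Hat g) W] [LieModule ℂ (Hat g) W]
    {W' : Type*} [AddCommGroup W'] [Module ℂ W'] [LieRingModule (Hat g) W']
    [LieModule ℂ (Hat g) W'] [LieModule.IsIrreducible ℂ (Hat g) W]
    [LieModule.IsIrreducible ℂ (Hat g) W'] (hW : IsSmooth g W) (hW' : IsSmooth g W')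
    (φ : EvalModule V a ⊗[ℂ] W →ₗ⁅ℂ, Hat g⁆ EvalModule V' a' ⊗[ℂ] W') (hφ : φ ≠ 0) :
    Nonempty (EvalModule V a ≃ₗ⁅ℂ, Hat g⁆ EvalModule V' a') ∧ Nonempty (W ≃ₗ⁅ℂ, Hat g⁆ W') := by
  have : ∀ i, Nontrivial (V i) := fun i => nontrivial_of_isIrreducible (G := g)
  have : ∀ i, Nontrivial (V' i) := fun i => nontrivial_of_isIrreducible (G := g)
  have := nontrivial_evalModule (V := V) a
  have := nontrivial_evalModule (V := V') a'
  have hE := isLoopDense_evalModule a ha hEnd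
  have hE' := isLoopDense_evalModule a' ha' hEnd'
  have := hE.irreducible
  have := hE'.irreducible
  obtain ⟨N, θ, hθ0, hθ⟩ := hE.exists_left_map hW hW' φ hφ
  let θ' : EvalModule V a →ₗ⁅ℂ, Hat g⁆ EvalModule V' a' :=
    { θ with map_lie' := fun {z e} => map_lie_of_large a a' θ N hθ z e }
  obtain ⟨ε⟩ := lieEquiv_of_irreducible θ' (fun h => hθ0 (LinearMap.ext fun e =>
    LieModuleHom.congr_fun h e))
  refine ⟨⟨ε⟩, ?_⟩
  let σ := TensorProduct.LieModule.map (ε.symm : EvalModule V' a' →ₗ⁅ℂ, Hat g⁆ EvalModule V a)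
    (LieModuleHom.id : W' →ₗ⁅ℂ, Hat g⁆ W')
  let σ' := TensorProduct.LieModule.map (ε : EvalModule V a →ₗ⁅ℂ, Hat g⁆ EvalModule V' a')
    (LieModuleHom.id : W' →ₗ⁅ℂ, Hat g⁆ W')
  have hσ : ∀ y, σ' (σ y) = y := by
    intro y
    induction y using TensorProduct.induction_on with
    | zero => simp
    | add a b ha hb => rw [map_add, map_add, ha, hb]
    | tmul e v =>
      change ε (ε.symm e) ⊗ₜ v = _
      rw [LieModuleEquiv.apply_symm_apply]
  obtain ⟨ψ, hψ⟩ := hE.exists_right_hom hW hW' (σ.comp φ) (fun h => hφ (by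
    ext y
    rw [← hσ (φ y)]
    have : σ (φ y) = 0 := LieModuleHom.congr_fun h y
    rw [this, map_zero]
    rfl))
  exact lieEquiv_of_irreducible ψ hψ

end Density

/-! ### Modules generated by a vector of top degree -/

section TopDegree

/-- Submodules `R i` of independent submodules `E i` contain every element of `E i` that lies in the
sum of all of them. -/
lemma mem_of_mem_iSup_of_iSupIndep {K M ι : Type*} [Ring K] [AddCommGroup M] [Module K M]
    {E R : ι → Submodule K M} (hE : iSupIndep E) (hR : ∀ i, R i ≤ E i) {x : M}
    (hx : x ∈ ⨆ i, R i) {i : ι} (hi : x ∈ E i) : x ∈ R i := by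
  have hle : ⨆ i, R i ≤ R i ⊔ ⨆ (j) (_ : j ≠ i), E j := by
    refine iSup_le fun j => ?_
    by_cases h : j = i
    · subst h; exact le_sup_left
    · exact (hR j).trans (le_sup_of_le_right (le_iSup₂_of_le j h le_rfl))
  obtain ⟨y, hy, z, hz, rfl⟩ := Submodule.mem_sup.1 (hle hx)
  have hzE : z ∈ E i := by simpa using sub_mem hi (hR i hy)
  have : z = 0 := by simpa using (Submodule.disjoint_def.1 (hE i)) z hzE hz
  rw [this, add_zero]
  exact hy

variable {G : Type*} [LieRing G] [LieAlgebra ℂ G]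

/-- A `ℤ`-grading of a Lie algebra (the sum of the pieces need not be assumed direct). -/
structure IsLieGrading (gr : ℤ → Submodule ℂ G) : Prop where
  lie_mem : ∀ {p q : ℤ} {x y : G}, x ∈ gr p → y ∈ gr q → ⁅x, y⁆ ∈ gr (p + q)
  iSup_eq_top : ⨆ p, gr p = ⊤

variable (gr : ℤ → Submodule ℂ G) {M : Type*} [AddCommGroup M] [LieRingModule G M]

/-- A vector killed by the elements of positive degree, on which those of degree zero act through
`χ`. -/
structure IsTopVector [Module ℂ M] (χ : G → ℂ) (s : M) : Prop where
  pos : ∀ {p : ℤ} {z : G}, 0 < p → z ∈ gr p → ⁅z, s⁆ = 0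
  zero : ∀ {z : G}, z ∈ gr 0 → ⁅z, s⁆ = χ z • s

/-- `NegWord gr s p w`: the vector `w` is obtained from `s` by applying homogeneous elements of
negative degrees that add up to `p`. -/
inductive NegWord (s : M) : ℤ → M → Prop
  | nil : NegWord s 0 s
  | cons {q p : ℤ} {z : G} {w : M} : q < 0 → z ∈ gr q → NegWord s p w → NegWord s (q + p) ⁅z, w⁆

variable {gr} in
lemma NegWord.le_zero {p : ℤ} {w : M} {s : M} (h : NegWord gr s p w) : p ≤ 0 ∧ (p = 0 → w = s) := by
  induction h with
  | nil => exact ⟨le_rfl, fun _ => rfl⟩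
  | cons hq _ _ ih => exact ⟨by omega, by omega⟩

variable [Module ℂ M]

/-- The span of the words of degree `p` in elements of negative degree, applied to `s`. -/
def negSpan (s : M) (p : ℤ) : Submodule ℂ M := Submodule.span ℂ {w | NegWord gr s p w}

variable {gr} {s : M} {χ : G → ℂ}

lemma negSpan_of_pos {p : ℤ} (hp : 0 < p) : negSpan gr s p = ⊥ := by
  rw [negSpan, Submodule.span_eq_bot]
  intro w hw
  have := NegWord.le_zero hw
  omega

lemma negSpan_zero_le : negSpan gr s 0 ≤ Submodule.span ℂ {s} := by
  refine Submodule.span_mono fun w hw => ?_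
  exact (NegWord.le_zero hw).2 rfl

lemma self_mem_negSpan : s ∈ negSpan gr s 0 := Submodule.subset_span NegWord.nil

variable [LieModule ℂ G M]

/-- The spans of words in elements of negative degree are stable under all homogeneous elements, by
moving these to the right. -/
lemma lie_mem_negSpan (hgr : IsLieGrading gr) (hs : IsTopVector gr χ s) {q p : ℤ} {z : G} {w : M}
    (hz : z ∈ gr q) (hw : w ∈ negSpan gr s p) : ⁅z, w⁆ ∈ negSpan gr s (q + p) := by
  have hneg : ∀ {q p : ℤ} {z : G} {w : M}, q < 0 → z ∈ gr q → w ∈ negSpan gr s p →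
      ⁅z, w⁆ ∈ negSpan gr s (q + p) := by
    intro q p z w hq hz hw
    induction hw using Submodule.span_induction with
    | mem w hw => exact Submodule.subset_span (NegWord.cons hq hz hw)
    | zero => rw [lie_zero]; exact zero_mem _
    | add a b _ _ ha hb => rw [lie_add]; exact add_mem ha hb
    | smul c a _ ha => rw [lie_smul]; exact Submodule.smul_mem _ _ ha
  have hword : ∀ {p : ℤ} {w : M}, NegWord gr s p w → ∀ {q : ℤ} {z : G}, z ∈ gr q →
      ⁅z, w⁆ ∈ negSpan gr s (q + p) := by
    intro p w hw
    induction hw with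
    | nil =>
      intro q z hz
      rcases lt_trichotomy q 0 with hq | rfl | hq
      · exact hneg hq hz self_mem_negSpan
      · rw [hs.zero hz]; exact Submodule.smul_mem _ _ self_mem_negSpan
      · rw [hs.pos hq hz]; exact zero_mem _
    | @cons q' p y w hq' hy hw ih =>
      intro q z hz
      rw [leibniz_lie]
      refine add_mem ?_ ?_
      · rw [← add_assoc]
        exact ih (hgr.lie_mem hz hy)
      · rw [add_left_comm]
        exact hneg hq' hy (ih hz)
  induction hw using Submodule.span_induction with
  | mem w hw => exact hword hw hz
  | zero => rw [lie_zero]; exact zero_mem _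
  | add a b _ _ ha hb => rw [lie_add]; exact add_mem ha hb
  | smul c a _ ha => rw [lie_smul]; exact Submodule.smul_mem _ _ ha

lemma lieSpan_le_iSup_negSpan (hgr : IsLieGrading gr) (hs : IsTopVector gr χ s) {w : M}
    (hw : w ∈ LieSubmodule.lieSpan ℂ G {s}) : w ∈ ⨆ p, negSpan gr s p := by
  let S : LieSubmodule ℂ G M :=
    { (⨆ p, negSpan gr s p : Submodule ℂ M) with
      lie_mem := fun {z w} hw => by
        change w ∈ ⨆ p, negSpan gr s p at hw
        change ⁅z, w⁆ ∈ ⨆ p, negSpan gr s p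
        have hz : z ∈ ⨆ p, gr p := by rw [hgr.iSup_eq_top]; trivial
        induction hw using Submodule.iSup_induction' with
        | mem p w hw =>
          induction hz using Submodule.iSup_induction' with
          | mem q z hz => exact Submodule.mem_iSup_of_mem _ (lie_mem_negSpan hgr hs hz hw)
          | zero => rw [zero_lie]; exact zero_mem _
          | add a b _ _ ha hb => rw [add_lie]; exact add_mem ha hb
        | zero => rw [lie_zero]; exact zero_mem _
        | add a b _ _ ha hb => rw [lie_add]; exact add_mem ha hb }
  have hle : LieSubmodule.lieSpan ℂ G {s} ≤ S := by
    rw [LieSubmodule.lieSpan_le, Set.singleton_subset_iff]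
    exact Submodule.mem_iSup_of_mem 0 self_mem_negSpan
  exact hle hw

/-- Elements of positive degree act without nonzero eigenvalues. -/
lemma eigenvalue_eq_zero_of_pos (hgr : IsLieGrading gr) (hs : IsTopVector gr χ s) {q : ℤ} {z : G}
    (hq : 0 < q) (hz : z ∈ gr q) {w : M} (hw : w ∈ LieSubmodule.lieSpan ℂ G {s}) (hw0 : w ≠ 0)
    {c : ℂ} (hc : ⁅z, w⁆ = c • w) : c = 0 := by
  have hnil : ∃ n : ℕ, ∀ k, n ≤ k → (LieModule.toEnd ℂ G M z ^ k) w = 0 := by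
    have hw' := lieSpan_le_iSup_negSpan hgr hs hw
    clear hw hw0 hc
    induction hw' using Submodule.iSup_induction' with
    | mem p w hw =>
      have hk : ∀ k : ℕ, (LieModule.toEnd ℂ G M z ^ k) w ∈ negSpan gr s (k * q + p) := by
        intro k
        induction k with
        | zero => simpa using hw
        | succ k ih =>
          rw [pow_succ', Module.End.mul_apply, LieModule.toEnd_apply_apply]
          have := lie_mem_negSpan hgr hs hz ih
          convert this using 2
          push_cast; ring
      refine ⟨p.natAbs + 1, fun k hk' => ?_⟩
      have h := hk k
      have hpos : 0 < (k : ℤ) * q + p := by nlinarith [neg_le_abs p, Int.natCast_natAbs p]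
      rwa [negSpan_of_pos hpos, Submodule.mem_bot] at h
    | zero => exact ⟨0, fun k _ => map_zero _⟩
    | add a b _ _ ha hb =>
      obtain ⟨n, hn⟩ := ha
      obtain ⟨n', hn'⟩ := hb
      exact ⟨max n n', fun k hk => by
        rw [map_add, hn k ((le_max_left _ _).trans hk), hn' k ((le_max_right _ _).trans hk),
          add_zero]⟩
  obtain ⟨n, hn⟩ := hnil
  have hpow : ∀ k : ℕ, (LieModule.toEnd ℂ G M z ^ k) w = c ^ k • w := by
    intro k
    induction k with
    | zero => simp
    | succ k ih =>
      rw [pow_succ', Module.End.mul_apply, ih, map_smul, LieModule.toEnd_apply_apply, hc,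
        smul_smul, pow_succ]
  have h := hn n le_rfl
  rw [hpow, smul_eq_zero] at h
  exact eq_zero_of_pow_eq_zero (h.resolve_right hw0)

/-- An operator `T` on a module is compatible with the grading if `[T, z] = p z` for `z` of
degree `p`. -/
def IsDegreeOperator (gr : ℤ → Submodule ℂ G) (T : Module.End ℂ M) : Prop :=
  ∀ {p : ℤ} {z : G}, z ∈ gr p → ∀ w : M, T ⁅z, w⁆ = ⁅z, T w⁆ + (p : ℂ) • ⁅z, w⁆

variable {T : Module.End ℂ M} {c : ℂ}

lemma negSpan_le_eigenspace (hT : IsDegreeOperator gr T) (hTs : T s = c • s) (p : ℤ) :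
    negSpan gr s p ≤ T.eigenspace (c + p) := by
  refine Submodule.span_le.2 fun w hw => ?_
  rw [SetLike.mem_coe, Module.End.mem_eigenspace_iff]
  induction hw with
  | nil => simpa using hTs
  | cons _ hz _ ih =>
    rw [hT hz, ih, lie_smul, ← add_smul]
    push_cast
    ring_nf

lemma iSupIndep_shifted_eigenspace (T : Module.End ℂ M) (c : ℂ) :
    iSupIndep fun p : ℤ => T.eigenspace (c + p) :=
  T.eigenspaces_iSupIndep.comp fun p q h => by simpa using h

/-- In a module generated by a top vector, eigenvectors of the degree operator are sums of words of
the right degree. -/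
lemma mem_negSpan_of_eigen (hgr : IsLieGrading gr) (hs : IsTopVector gr χ s)
    (hT : IsDegreeOperator gr T) (hTs : T s = c • s) {w : M}
    (hw : w ∈ LieSubmodule.lieSpan ℂ G {s}) {p : ℤ} (h : T w = (c + p) • w) :
    w ∈ negSpan gr s p :=
  mem_of_mem_iSup_of_iSupIndep (iSupIndep_shifted_eigenspace T c)
    (negSpan_le_eigenspace hT hTs) (lieSpan_le_iSup_negSpan hgr hs hw)
    (Module.End.mem_eigenspace_iff.2 h)

lemma mem_span_of_eigen (hgr : IsLieGrading gr) (hs : IsTopVector gr χ s)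
    (hT : IsDegreeOperator gr T) (hTs : T s = c • s) {w : M}
    (hw : w ∈ LieSubmodule.lieSpan ℂ G {s}) (h : T w = c • w) : w ∈ Submodule.span ℂ {s} :=
  negSpan_zero_le (mem_negSpan_of_eigen hgr hs hT hTs hw (p := 0) (by simpa using h))

lemma exists_eigenvalue_eq (hgr : IsLieGrading gr) (hs : IsTopVector gr χ s)
    (hT : IsDegreeOperator gr T) (hTs : T s = c • s) {w : M}
    (hw : w ∈ LieSubmodule.lieSpan ℂ G {s}) (hw0 : w ≠ 0) {μ : ℂ} (h : T w = μ • w) :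
    ∃ p : ℤ, p ≤ 0 ∧ μ = c + p := by
  obtain ⟨p, hp⟩ : ∃ p : ℤ, μ = c + p := by
    by_contra! hμ
    have hle : ⨆ p, negSpan gr s p ≤ ⨆ (ν) (_ : ν ≠ μ), T.eigenspace ν :=
      iSup_le fun p => (negSpan_le_eigenspace hT hTs p).trans
        (le_iSup₂_of_le (c + p) (hμ p).symm le_rfl)
    exact hw0 (Submodule.disjoint_def.1 (T.eigenspaces_iSupIndep μ) w
      (Module.End.mem_eigenspace_iff.2 h) (hle (lieSpan_le_iSup_negSpan hgr hs hw)))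
  refine ⟨p, ?_, hp⟩
  by_contra! hpos
  have := mem_negSpan_of_eigen hgr hs hT hTs hw (hp ▸ h)
  rw [negSpan_of_pos hpos, Submodule.mem_bot] at this
  exact hw0 this

/-- Endomorphisms of an irreducible module with a top vector are scalars, if they commute with the
degree operator. -/
lemma end_eq_smul [LieModule.IsIrreducible ℂ G M] (hgr : IsLieGrading gr)
    (hs : IsTopVector gr χ s) (hs0 : s ≠ 0)
    (hT : IsDegreeOperator gr T) (hTs : T s = c • s) (φ : M →ₗ⁅ℂ, G⁆ M)
    (hφ : ∀ w, φ (T w) = T (φ w)) : ∃ a : ℂ, ∀ w, φ w = a • w := by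
  have htop := lieSpan_singleton_eq_top (G := G) hs0
  obtain ⟨a, ha⟩ := Submodule.mem_span_singleton.1 (mem_span_of_eigen hgr hs hT hTs (w := φ s)
    (by rw [htop]; trivial) (by rw [← hφ, hTs, map_smul]))
  refine ⟨a, fun w => ?_⟩
  let S : LieSubmodule ℂ G M := (φ - a • LieModuleHom.id).ker
  have hsS : s ∈ S := by
    rw [LieModuleHom.mem_ker]
    change φ s - a • s = 0
    rw [ha, sub_self]
  have hle : LieSubmodule.lieSpan ℂ G {s} ≤ S := by
    rw [LieSubmodule.lieSpan_le, Set.singleton_subset_iff]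
    exact hsS
  have hw : w ∈ S := hle (by rw [htop]; trivial)
  rw [LieModuleHom.mem_ker] at hw
  exact sub_eq_zero.1 hw

/-- An operator for which a vector `x` of an invariant subspace is a sum of eigenvectors has an
eigenvector in that subspace. -/
lemma exists_eigenvector_mem {S : Submodule ℂ M} (hS : ∀ x ∈ S, T x ∈ S) {x : M} (hx : x ∈ S)
    (hx0 : x ≠ 0) (hsum : x ∈ ⨆ μ, T.eigenspace μ) : ∃ y ∈ S, y ≠ 0 ∧ ∃ μ : ℂ, T y = μ • y := by
  have hpoly : ∃ P : Polynomial ℂ, P ≠ 0 ∧ Polynomial.aeval T P x = 0 := by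
    clear hx hx0
    induction hsum using Submodule.iSup_induction' with
    | mem μ x hx =>
      refine ⟨Polynomial.X - Polynomial.C μ, Polynomial.X_sub_C_ne_zero μ, ?_⟩
      rw [Module.End.mem_eigenspace_iff] at hx
      simp [hx]
    | zero => exact ⟨1, one_ne_zero, map_zero _⟩
    | add a b _ _ ha hb =>
      obtain ⟨P, hP, hPa⟩ := ha
      obtain ⟨Q, hQ, hQb⟩ := hb
      refine ⟨P * Q, mul_ne_zero hP hQ, ?_⟩
      have ha : Polynomial.aeval T (P * Q) a = 0 := by
        rw [mul_comm, map_mul, Module.End.mul_apply, hPa, map_zero]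
      have hb : Polynomial.aeval T (P * Q) b = 0 := by
        rw [map_mul, Module.End.mul_apply, hQb, map_zero]
      rw [map_add, ha, hb, add_zero]
  have hinv : ∀ (Q : Polynomial ℂ), ∀ x ∈ S, Polynomial.aeval T Q x ∈ S := by
    intro Q
    induction Q using Polynomial.induction_on with
    | C a => intro x hx; rw [Polynomial.aeval_C]; exact S.smul_mem a hx
    | add P Q hP hQ => intro x hx; rw [map_add]; exact S.add_mem (hP x hx) (hQ x hx)
    | monomial n a h =>
      intro x hx
      rw [pow_succ, ← mul_assoc, map_mul, Module.End.mul_apply, Polynomial.aeval_X]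
      exact h _ (hS x hx)
  obtain ⟨P, hP, hPx⟩ := hpoly
  induction hn : P.natDegree generalizing P with
  | zero =>
    exfalso
    rw [Polynomial.natDegree_eq_zero] at hn
    obtain ⟨a, rfl⟩ := hn
    rw [Polynomial.aeval_C] at hPx
    change a • x = 0 at hPx
    exact (smul_eq_zero.1 hPx).elim (fun h => hP (by rw [h, Polynomial.C_0])) hx0
  | succ n ih =>
    obtain ⟨μ, hμ⟩ := IsAlgClosed.exists_root P (by
      intro h
      rw [Polynomial.natDegree_eq_of_degree_eq_some h] at hn
      exact Nat.succ_ne_zero n hn.symm)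
    obtain ⟨Q, rfl⟩ := Polynomial.dvd_iff_isRoot.2 hμ
    have hQ : Q ≠ 0 := right_ne_zero_of_mul hP
    by_cases hQx : Polynomial.aeval T Q x = 0
    · refine ih Q hQ hQx ?_
      rw [Polynomial.natDegree_mul (Polynomial.X_sub_C_ne_zero μ) hQ,
        Polynomial.natDegree_X_sub_C] at hn
      omega
    · refine ⟨_, hinv Q x hx, hQx, μ, ?_⟩
      rw [map_mul, Module.End.mul_apply] at hPx
      simpa [sub_eq_zero] using hPx

/-- In an irreducible module with a degree operator, the degree zero part acts in the same way on
all top vectors. -/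
lemma topVector_unique [LieModule.IsIrreducible ℂ G M] (hgr : IsLieGrading gr)
    (hs : IsTopVector gr χ s) (hs0 : s ≠ 0)
    (hT : IsDegreeOperator gr T) (hTs : T s = c • s) {s' : M} {χ' : G → ℂ}
    (hs' : IsTopVector gr χ' s') (hs0' : s' ≠ 0) {z : G} (hz : z ∈ gr 0) : χ z = χ' z := by
  have htop := lieSpan_singleton_eq_top (G := G) hs0
  let S : Submodule ℂ M :=
    { carrier := {w | IsTopVector gr χ' w}
      add_mem' := fun ha hb => ⟨fun hp hz => by rw [lie_add, ha.pos hp hz, hb.pos hp hz, add_zero],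
        fun hz => by rw [lie_add, ha.zero hz, hb.zero hz, smul_add]⟩
      zero_mem' := ⟨fun _ _ => lie_zero _, fun _ => by rw [lie_zero, smul_zero]⟩
      smul_mem' := fun c w hw => ⟨fun hp hz => by rw [lie_smul, hw.pos hp hz, smul_zero],
        fun hz => by rw [lie_smul, hw.zero hz, smul_comm]⟩ }
  have hS : ∀ w ∈ S, T w ∈ S := by
    refine fun w hw => ⟨fun hp hz => ?_, fun hz => ?_⟩
    · have h := hT hz w
      rw [hw.pos hp hz, map_zero, smul_zero, add_zero] at h
      exact h.symm
    · have h := hT hz w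
      rw [hw.zero hz, map_smul, Int.cast_zero, zero_smul, add_zero] at h
      exact h.symm
  have hsum : s' ∈ ⨆ μ, T.eigenspace μ := by
    have h : s' ∈ ⨆ p, negSpan gr s p := lieSpan_le_iSup_negSpan hgr hs (by rw [htop]; trivial)
    exact (iSup_le fun p => (negSpan_le_eigenspace hT hTs p).trans (le_iSup _ _)) h
  obtain ⟨w, hw, hw0, μ, hμ⟩ := exists_eigenvector_mem hS hs' hs0' hsum
  have htop' := lieSpan_singleton_eq_top (G := G) hw0
  obtain ⟨p, hp, hμp⟩ := exists_eigenvalue_eq hgr hs hT hTs (by rw [htop]; trivial) hw0 hμ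
  obtain ⟨q, hq, hcq⟩ := exists_eigenvalue_eq hgr hw hT hμ (w := s) (by rw [htop']; trivial) hs0 hTs
  -- each of the two vectors generates the other, so that their degrees agree
  have hpq : p = 0 := by
    have : ((p + q : ℤ) : ℂ) = 0 := by
      push_cast
      linear_combination -hμp - hcq
    have : p + q = 0 := by exact_mod_cast this
    omega
  rw [hpq, Int.cast_zero, add_zero] at hμp
  obtain ⟨a, rfl⟩ := Submodule.mem_span_singleton.1
    (mem_span_of_eigen hgr hs hT hTs (by rw [htop]; trivial) (hμp ▸ hμ))
  have h1 := hw.zero hz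
  rw [lie_smul, hs.zero hz, smul_comm, ← sub_eq_zero, ← sub_smul, smul_eq_zero] at h1
  exact sub_eq_zero.1 (h1.resolve_right hw0)

section Product

variable {M' : Type*} [AddCommGroup M'] [Module ℂ M'] [LieRingModule G M']

/-- The direct sum of two Lie modules. -/
abbrev prodLieRingModule (G M M' : Type*) [LieRing G] [AddCommGroup M] [LieRingModule G M]
    [AddCommGroup M'] [LieRingModule G M'] : LieRingModule G (M × M') where
  bracket z w := (⁅z, w.1⁆, ⁅z, w.2⁆)
  add_lie x y w := Prod.ext (add_lie x y w.1) (add_lie x y w.2)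
  lie_add x w w' := Prod.ext (lie_add x w.1 w'.1) (lie_add x w.2 w'.2)
  leibniz_lie x y w := Prod.ext (leibniz_lie x y w.1) (leibniz_lie x y w.2)

/-- Irreducible modules with a degree operator and isomorphic tops are isomorphic: the submodule of
the direct sum generated by the pair of top vectors is the graph of an isomorphism. -/
lemma lieEquiv_of_topVectors [LieModule ℂ G M'] [LieModule.IsIrreducible ℂ G M]
    [LieModule.IsIrreducible ℂ G M'] (hgr : IsLieGrading gr)
    (hs : IsTopVector gr χ s) (hs0 : s ≠ 0)
    (hT : IsDegreeOperator gr T) (hTs : T s = c • s) {s' : M'} (hs' : IsTopVector gr χ s')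
    (hs0' : s' ≠ 0) {T' : Module.End ℂ M'} (hT' : IsDegreeOperator gr T') (hTs' : T' s' = c • s') :
    Nonempty (M ≃ₗ⁅ℂ, G⁆ M') := by
  let : LieRingModule G (M × M') := prodLieRingModule G M M'
  let : LieModule ℂ G (M × M') :=
    { smul_lie := fun c x w => Prod.ext (smul_lie c x w.1) (smul_lie c x w.2)
      lie_smul := fun c x w => Prod.ext (lie_smul c x w.1) (lie_smul c x w.2) }
  have hlie : ∀ (z : G) (w : M × M'), ⁅z, w⁆ = (⁅z, w.1⁆, ⁅z, w.2⁆) := fun _ _ => rfl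
  have hss : IsTopVector gr χ (s, s') :=
    ⟨fun hp hz => by rw [hlie, hs.pos hp hz, hs'.pos hp hz]; rfl,
      fun hz => by rw [hlie, hs.zero hz, hs'.zero hz]; rfl⟩
  have hTT : IsDegreeOperator gr (LinearMap.prodMap T T') := fun hz w => by
    rw [hlie, LinearMap.prodMap_apply, hT hz, hT' hz]; rfl
  have hTss : LinearMap.prodMap T T' (s, s') = c • (s, s') := by
    rw [LinearMap.prodMap_apply, hTs, hTs']; rfl
  set S : LieSubmodule ℂ G (M × M') := LieSubmodule.lieSpan ℂ G {(s, s')} with hS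
  have hsS : (s, s') ∈ S := LieSubmodule.subset_lieSpan rfl
  have hleft : ∀ x, (x, (0 : M')) ∈ S → x = 0 := by
    let incl : M →ₗ⁅ℂ, G⁆ M × M' := { LinearMap.inl ℂ M M' with
      map_lie' := fun {z x} => by
        rw [hlie]
        exact Prod.ext rfl (lie_zero z).symm }
    let L : LieSubmodule ℂ G M := S.comap incl
    rcases eq_bot_or_eq_top L with h | h
    · intro x hx
      have : x ∈ L := hx
      rw [h] at this
      exact this
    · exfalso
      have hsL : (s, (0 : M')) ∈ S := show s ∈ L by rw [h]; trivial
      obtain ⟨a, ha⟩ := Submodule.mem_span_singleton.1 (mem_span_of_eigen hgr hss hTT hTss hsL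
        (by rw [LinearMap.prodMap_apply, hTs, map_zero, Prod.smul_mk, smul_zero]))
      rw [Prod.smul_mk, Prod.mk.injEq, smul_eq_zero] at ha
      rw [ha.2.resolve_right hs0', zero_smul] at ha
      exact hs0 ha.1.symm
  have hright : ∀ x, ((0 : M), x) ∈ S → x = 0 := by
    let incl : M' →ₗ⁅ℂ, G⁆ M × M' := { LinearMap.inr ℂ M M' with
      map_lie' := fun {z x} => by
        rw [hlie]
        exact Prod.ext (lie_zero z).symm rfl }
    let L : LieSubmodule ℂ G M' := S.comap incl
    rcases eq_bot_or_eq_top L with h | h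
    · intro x hx
      have : x ∈ L := hx
      rw [h] at this
      exact this
    · exfalso
      have hsL : ((0 : M), s') ∈ S := show s' ∈ L by rw [h]; trivial
      obtain ⟨a, ha⟩ := Submodule.mem_span_singleton.1 (mem_span_of_eigen hgr hss hTT hTss hsL
        (by rw [LinearMap.prodMap_apply, hTs', map_zero, Prod.smul_mk, smul_zero]))
      rw [Prod.smul_mk, Prod.mk.injEq, smul_eq_zero] at ha
      rw [ha.1.resolve_right hs0, zero_smul] at ha
      exact hs0' ha.2.symm
  let π : S →ₗ⁅ℂ, G⁆ M := { LinearMap.fst ℂ M M' ∘ₗ (S : Submodule ℂ (M × M')).subtype with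
    map_lie' := fun {z w} => rfl }
  let π' : S →ₗ⁅ℂ, G⁆ M' := { LinearMap.snd ℂ M M' ∘ₗ (S : Submodule ℂ (M × M')).subtype with
    map_lie' := fun {z w} => rfl }
  have hπ : Function.Bijective π := by
    refine ⟨(LieModuleHom.ker_eq_bot π).1 ((LieSubmodule.eq_bot_iff _).2 ?_), fun x => ?_⟩
    · rintro ⟨⟨x, y⟩, hxy⟩ h0
      obtain rfl : x = 0 := h0
      obtain rfl := hright y hxy
      rfl
    · have hle : LieSubmodule.lieSpan ℂ G {s} ≤ π.range := by
        rw [LieSubmodule.lieSpan_le, Set.singleton_subset_iff]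
        exact ⟨⟨_, hsS⟩, rfl⟩
      exact hle (by rw [lieSpan_singleton_eq_top (G := G) hs0]; trivial)
  have hπ' : Function.Bijective π' := by
    refine ⟨(LieModuleHom.ker_eq_bot π').1 ((LieSubmodule.eq_bot_iff _).2 ?_), fun x => ?_⟩
    · rintro ⟨⟨x, y⟩, hxy⟩ h0
      obtain rfl : y = 0 := h0
      obtain rfl := hleft x hxy
      rfl
    · have hle : LieSubmodule.lieSpan ℂ G {s'} ≤ π'.range := by
        rw [LieSubmodule.lieSpan_le, Set.singleton_subset_iff]
        exact ⟨⟨_, hsS⟩, rfl⟩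
      exact hle (by rw [lieSpan_singleton_eq_top (G := G) hs0']; trivial)
  obtain ⟨ε⟩ := lieEquiv_of_bijective π hπ
  obtain ⟨ε'⟩ := lieEquiv_of_bijective π' hπ'
  exact ⟨ε.symm.trans ε'⟩

end Product

end TopDegree

/-! ### The principal gradations of `g` and `ĝ` -/

section Principal

open LieAlgebra

variable {g : Type*} [LieRing g] [LieAlgebra ℂ g]

/-- The piece of degree `p` for the action of `ad ρ` on `g`. -/
def adGrading (ρ : g) (p : ℤ) : Submodule ℂ g :=
  (LieModule.toEnd ℂ g g ρ).eigenspace (p : ℂ)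

lemma mem_adGrading {ρ : g} {p : ℤ} {x : g} : x ∈ adGrading ρ p ↔ ⁅ρ, x⁆ = (p : ℂ) • x :=
  Module.End.mem_eigenspace_iff

lemma adGrading_lie_mem {ρ : g} {p q : ℤ} {x y : g} (hx : x ∈ adGrading ρ p)
    (hy : y ∈ adGrading ρ q) : ⁅x, y⁆ ∈ adGrading ρ (p + q) := by
  rw [mem_adGrading] at *
  rw [leibniz_lie, hx, hy, smul_lie, lie_smul, ← add_smul]
  push_cast
  rfl

lemma iSupIndep_adGrading (ρ : g) : iSupIndep (adGrading ρ) :=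
  (Module.End.eigenspaces_iSupIndep _).comp (f := fun p : ℤ => (p : ℂ)) Int.cast_injective

/-- `ρ` defines a principal gradation of `g` for the Cartan subalgebra `H` and the positive part
`n`: the eigenvalues of `ad ρ` are integers, `H` is the zero eigenspace and `n` is the sum of the
eigenspaces with positive eigenvalues. -/
structure IsPrincipal (H n : LieSubalgebra ℂ g) (ρ : g) : Prop where
  mem : ρ ∈ H
  iSup_eq_top : ⨆ p, adGrading ρ p = ⊤
  le_cartan : ∀ x ∈ adGrading ρ 0, x ∈ H
  cartan_le : ∀ x ∈ H, x ∈ adGrading ρ 0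
  le_pos : ∀ {p : ℤ}, 0 < p → ∀ x ∈ adGrading ρ p, x ∈ n
  pos_le : n.toSubmodule ≤ ⨆ (p : ℤ) (_ : 0 < p), adGrading ρ p

lemma IsPrincipal.isLieGrading {H n : LieSubalgebra ℂ g} {ρ : g} (h : IsPrincipal H n ρ) :
    IsLieGrading (adGrading ρ) :=
  ⟨adGrading_lie_mem, h.iSup_eq_top⟩

section Roots

variable [FiniteDimensional ℂ g] [IsKilling ℂ g] (H : LieSubalgebra ℂ g) [H.IsCartanSubalgebra]
  (b : (IsKilling.rootSystem H).Base)

/-- There is an element of the Cartan subalgebra on which each root takes its height as value. -/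
lemma exists_height_element :
    ∃ ρ : H, ∀ α : H.root, α.1 ρ = ((b.height α : ℤ) : ℂ) := by
  let Φ : Module.Dual ℂ (Module.Dual ℂ H) := b.toWeightBasis.constr ℂ fun _ => 1
  refine ⟨(Module.evalEquiv ℂ H).symm Φ, fun α => ?_⟩
  have hΦ : α.1 ((Module.evalEquiv ℂ H).symm Φ) = Φ ((IsKilling.rootSystem H).root α) := by
    rw [IsKilling.rootSystem_root_apply]
    exact Module.apply_evalEquiv_symm_apply ℂ H (LieModule.Weight.toLinear ℂ H g α.1) Φ
  obtain ⟨f, -, -, hf⟩ := b.exists_root_eq_sum_int α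
  have hsimple : ∀ j ∈ b.support, Φ ((IsKilling.rootSystem H).root j) = 1 := by
    intro j hj
    rw [← b.toWeightBasis_apply ⟨j, hj⟩, Module.Basis.constr_basis]
  rw [hΦ, hf, RootPairing.Base.height_eq_sum hf, map_sum]
  push_cast
  refine Finset.sum_congr rfl fun j hj => ?_
  rw [map_zsmul, hsimple j hj, zsmul_one]

/-- The element on which the roots take their heights as values defines a principal gradation. -/
lemma exists_isPrincipal : ∃ ρ : g, IsPrincipal H (nPlus H b) ρ := by
  obtain ⟨ρ, hρ⟩ := exists_height_element H b
  have hspace : ∀ (χ : LieModule.Weight ℂ H g) (p : ℤ), χ ρ = p →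
      (rootSpace H χ).toSubmodule ≤ adGrading (ρ : g) p := by
    intro χ p hp x hx
    rw [mem_adGrading]
    have := IsKilling.lie_eq_smul_of_mem_rootSpace hx ρ
    rw [hp] at this
    exact this
  have hroot : ∀ χ : LieModule.Weight ℂ H g, χ.IsNonZero →
      ∃ α : H.root, α.1 = χ ∧ χ ρ = ((b.height α : ℤ) : ℂ) := by
    intro χ hχ
    exact ⟨⟨χ, by simpa using hχ⟩, rfl, hρ ⟨χ, by simpa using hχ⟩⟩
  let R : ℤ → Submodule ℂ g := fun p =>
    ⨆ (χ : LieModule.Weight ℂ H g) (_ : χ ρ = p), (rootSpace H χ).toSubmodule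
  have hR : ∀ p, R p ≤ adGrading (ρ : g) p := fun p => iSup₂_le fun χ hχ => hspace χ p hχ
  have hRtop : ⨆ p, R p = ⊤ := by
    have h := congrArg LieSubmodule.toSubmodule (LieModule.iSup_genWeightSpace_eq_top' ℂ H g)
    rw [LieSubmodule.iSup_toSubmodule, LieSubmodule.top_toSubmodule] at h
    rw [eq_top_iff, ← h]
    refine iSup_le fun χ => ?_
    obtain ⟨p, hp⟩ : ∃ p : ℤ, χ ρ = p := by
      by_cases hχ : χ.IsZero
      · exact ⟨0, by rw [Int.cast_zero]; exact congrFun hχ ρ⟩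
      · obtain ⟨α, -, hα⟩ := hroot χ hχ
        exact ⟨_, hα⟩
    exact le_iSup_of_le p (le_iSup₂_of_le χ hp le_rfl)
  have hRmem : ∀ {p : ℤ} {x : g}, x ∈ adGrading (ρ : g) p → x ∈ R p := fun hx =>
    mem_of_mem_iSup_of_iSupIndep (iSupIndep_adGrading (ρ : g)) hR (by rw [hRtop]; trivial) hx
  have hzero : (rootSpace H (0 : H → ℂ)).toSubmodule = H.toSubmodule := by
    rw [rootSpace_zero_eq]
    rfl
  refine ⟨ρ, ρ.2, ?_, fun x hx => ?_, fun x hx => ?_, fun {p} hp x hx => ?_, ?_⟩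
  · rw [eq_top_iff, ← hRtop]
    exact iSup_mono hR
  · have hle : R 0 ≤ H.toSubmodule := by
      refine iSup₂_le fun χ hχ => ?_
      by_cases h0 : χ.IsZero
      · rw [← hzero, ← h0]
      · obtain ⟨α, -, hα⟩ := hroot χ h0
        rw [hα] at hχ
        exact absurd (by exact_mod_cast hχ) (b.height_ne_zero α)
    exact hle (hRmem hx)
  · rw [mem_adGrading, Int.cast_zero, zero_smul]
    have h : x ∈ rootSpace H (0 : H → ℂ) := by
      rw [rootSpace_zero_eq]
      exact hx
    have := IsKilling.lie_eq_smul_of_mem_rootSpace h ρ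
    rwa [Pi.zero_apply, zero_smul] at this
  · have hle : R p ≤ (nPlus H b).toSubmodule := by
      refine iSup₂_le fun χ hχ => ?_
      by_cases h0 : χ.IsZero
      · have h1 : χ ρ = 0 := congrFun h0 ρ
        rw [h1] at hχ
        have : p = 0 := by exact_mod_cast hχ.symm
        omega
      · obtain ⟨α, rfl, hα⟩ := hroot χ h0
        rw [hα] at hχ
        have : b.height α = p := by exact_mod_cast hχ
        refine fun y hy => Submodule.subset_span ⟨α, ?_, hy⟩
        change 0 < b.height α
        omega
    exact hle (hRmem hx)
  · refine Submodule.span_le.2 ?_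
    rintro x ⟨α, hα, hx⟩
    exact Submodule.mem_iSup_of_mem (b.height α) (Submodule.mem_iSup_of_mem hα
      (hspace α.1 _ (hρ α) hx))

end Roots

/-- The derivation `ad ρ + N t d/dt` of `ĝ`: it multiplies `x ⊗ t^k` by `p + N k` if `x` has
degree `p` in `g`. For `N` larger than all degrees that occur in `g`, its positive, zero and negative
parts are those of the triangular decomposition of `ĝ`. -/
def hatDegree (ρ : g) (N : ℤ) : Module.End ℂ (Hat g) :=
  LieModule.toEnd ℂ (Hat g) (Hat g) (loopElem ρ 0) + (N : ℂ) • degLin g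

/-- The piece of degree `p` of the gradation of `ĝ` defined by `ad ρ + N t d/dt`. -/
def hatGrading (ρ : g) (N p : ℤ) : Submodule ℂ (Hat g) := (hatDegree ρ N).eigenspace (p : ℂ)

lemma mem_hatGrading {ρ : g} {N p : ℤ} {z : Hat g} :
    z ∈ hatGrading ρ N p ↔ ⁅loopElem ρ 0, z⁆ + (N : ℂ) • deg g z = (p : ℂ) • z :=
  Module.End.mem_eigenspace_iff

lemma loopElem_mem_hatGrading {ρ x : g} {q : ℤ} (hx : x ∈ adGrading ρ q) (N k : ℤ) :
    loopElem x k ∈ hatGrading ρ N (q + N * k) := by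
  rw [mem_hatGrading, lie_loopElem, mem_adGrading.1 hx]
  change _ + (N : ℂ) • degLin g (loopElem x k) = _
  rw [degLin_loopElem, ← loopLin_apply, ← loopLin_apply, map_smul, zero_add, Int.cast_zero, zero_mul,
    ite_self, zero_smul, add_zero, smul_smul, ← add_smul]
  push_cast
  rfl

lemma central_mem_hatGrading (ρ : g) (N : ℤ) : central g ∈ hatGrading ρ N 0 := by
  rw [mem_hatGrading, lie_central]
  change _ + (N : ℂ) • degLin g (central g) = _
  rw [degLin_central, smul_zero, Int.cast_zero, zero_smul, add_zero]

lemma hatGrading_lie_mem {ρ : g} {N p q : ℤ} {z w : Hat g} (hz : z ∈ hatGrading ρ N p)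
    (hw : w ∈ hatGrading ρ N q) : ⁅z, w⁆ ∈ hatGrading ρ N (p + q) := by
  rw [mem_hatGrading] at *
  have h1 : ⁅loopElem ρ 0, ⁅z, w⁆⁆ + (N : ℂ) • deg g ⁅z, w⁆ =
      ⁅⁅loopElem ρ 0, z⁆ + (N : ℂ) • deg g z, w⁆ + ⁅z, ⁅loopElem ρ 0, w⁆ + (N : ℂ) • deg g w⁆ := by
    rw [leibniz_lie, LieDerivation.apply_lie_eq_add, add_lie, lie_add, smul_lie, lie_smul, smul_add]
    abel
  rw [h1, hz, hw, smul_lie, lie_smul, ← add_smul]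
  push_cast
  rfl

/-- The homogeneous elements of `ĝ` of a given degree, presented by generators. -/
def hatPiece (ρ : g) (N p : ℤ) : Submodule ℂ (Hat g) :=
  Submodule.span ℂ ({z | ∃ (q k : ℤ) (x : g), x ∈ adGrading ρ q ∧ q + N * k = p ∧ z = loopElem x k} ∪
    {z | p = 0 ∧ z = central g})

lemma hatPiece_le (ρ : g) (N p : ℤ) : hatPiece ρ N p ≤ hatGrading ρ N p := by
  refine Submodule.span_le.2 ?_
  rintro _ (⟨q, k, x, hx, rfl, rfl⟩ | ⟨rfl, rfl⟩)
  · exact loopElem_mem_hatGrading hx N k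
  · exact central_mem_hatGrading ρ N

lemma iSup_hatPiece {ρ : g} (h : ⨆ p, adGrading ρ p = ⊤) (N : ℤ) : ⨆ p, hatPiece ρ N p = ⊤ := by
  rw [eq_top_iff]
  rintro z -
  induction z using hat_induction with
  | h0 => exact zero_mem _
  | hl x k =>
    have hx : x ∈ ⨆ p, adGrading ρ p := by rw [h]; trivial
    have hle : ⨆ p, adGrading ρ p ≤ (⨆ p, hatPiece ρ N p).comap (loopLin k) :=
      iSup_le fun q y hy => Submodule.mem_iSup_of_mem (q + N * k)
        (Submodule.subset_span (Or.inl ⟨q, k, y, hy, rfl, rfl⟩))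
    exact hle hx
  | hK c =>
    refine (⨆ p, hatPiece ρ N p).smul_mem c ?_
    exact Submodule.mem_iSup_of_mem 0 (Submodule.subset_span (Or.inr ⟨rfl, rfl⟩))
  | ha z w hz hw => exact add_mem hz hw

variable {H n : LieSubalgebra ℂ g} {ρ : g}

lemma IsPrincipal.isLieGrading_hat (h : IsPrincipal H n ρ) (N : ℤ) :
    IsLieGrading (hatGrading ρ N) := by
  refine ⟨hatGrading_lie_mem, ?_⟩
  rw [eq_top_iff, ← iSup_hatPiece h.iSup_eq_top N]
  exact iSup_mono (hatPiece_le ρ N)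

lemma IsPrincipal.hatGrading_le (h : IsPrincipal H n ρ) (N p : ℤ) :
    hatGrading ρ N p ≤ hatPiece ρ N p := fun _ hz =>
  mem_of_mem_iSup_of_iSupIndep
    ((Module.End.eigenspaces_iSupIndep (hatDegree ρ N)).comp (f := fun p : ℤ => (p : ℂ))
      Int.cast_injective)
    (hatPiece_le ρ N) (by rw [iSup_hatPiece h.iSup_eq_top N]; trivial) hz

/-- `N` exceeds the absolute values of the degrees that occur in `g`. -/
def IsLarge (ρ : g) (N : ℤ) : Prop := 0 < N ∧ ∀ q, adGrading ρ q ≠ ⊥ → |q| < N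

lemma exists_isLarge [FiniteDimensional ℂ g] (ρ : g) : ∃ N, IsLarge ρ N := by
  have hfin := WellFoundedGT.finite_ne_bot_of_iSupIndep (iSupIndep_adGrading ρ)
  obtain ⟨B, hB⟩ := (hfin.image fun q : ℤ => |q|).bddAbove
  refine ⟨max B 0 + 1, by positivity, fun q hq => ?_⟩
  have : |q| ≤ B := hB ⟨q, hq, rfl⟩
  exact Int.lt_add_one_iff.2 (this.trans (le_max_left _ _))

/-- If `q + N k > 0` with `|q| < N`, then `k > 0`, or `k = 0` and `q > 0`. -/
lemma IsPrincipal.hatGrading_pos_le (h : IsPrincipal H n ρ) {N : ℤ} (hN : IsLarge ρ N) {p : ℤ}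
    (hp : 0 < p) {z : Hat g} (hz : z ∈ hatGrading ρ N p) : z ∈ hatPos n := by
  have hle : hatPiece ρ N p ≤ (hatPos n).toSubmodule := by
    refine Submodule.span_le.2 ?_
    rintro _ (⟨q, k, x, hx, hqk, rfl⟩ | ⟨rfl, rfl⟩)
    · by_cases hx0 : x = 0
      · rw [hx0, ← loopLin_apply, map_zero]
        exact zero_mem _
      have hq := hN.2 q fun hbot => hx0 (by rwa [hbot, Submodule.mem_bot] at hx)
      have hN0 := hN.1
      rw [abs_lt] at hq
      refine Submodule.subset_span ?_
      rcases lt_trichotomy k 0 with hk | rfl | hk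
      · nlinarith
      · exact Or.inl ⟨x, h.le_pos (by omega) x hx, rfl⟩
      · exact Or.inr ⟨x, k, hk, rfl⟩
    · omega
  exact hle (h.hatGrading_le N p hz)

/-- If `q + N k = 0` with `|q| < N`, then `k = 0` and `q = 0`. -/
lemma IsPrincipal.hatGrading_zero_le (h : IsPrincipal H n ρ) {N : ℤ} (hN : IsLarge ρ N)
    {z : Hat g} (hz : z ∈ hatGrading ρ N 0) : z ∈ hatCartan H := by
  have hle : hatPiece ρ N 0 ≤ (hatCartan H).toSubmodule := by
    refine Submodule.span_le.2 ?_
    rintro _ (⟨q, k, x, hx, hqk, rfl⟩ | ⟨-, rfl⟩)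
    · by_cases hx0 : x = 0
      · rw [hx0, ← loopLin_apply, map_zero]
        exact zero_mem _
      have hq := hN.2 q fun hbot => hx0 (by rwa [hbot, Submodule.mem_bot] at hx)
      have hN0 := hN.1
      rw [abs_lt] at hq
      refine Submodule.subset_span (Or.inl ⟨x, ?_, ?_⟩)
      · obtain rfl : k = 0 := by
          rcases lt_trichotomy k 0 with hk | hk | hk
          · nlinarith
          · exact hk
          · nlinarith
        obtain rfl : q = 0 := by omega
        exact h.le_cartan x hx
      · congr 1
        rcases lt_trichotomy k 0 with hk | hk | hk
        · nlinarith
        · exact hk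
        · nlinarith
    · exact Submodule.subset_span (Or.inr rfl)
  exact hle (h.hatGrading_le N 0 hz)

lemma IsPrincipal.hatCartan_le (h : IsPrincipal H n ρ) (N : ℤ) {z : Hat g}
    (hz : z ∈ hatCartan H) : z ∈ hatGrading ρ N 0 := by
  have hle : (hatCartan H).toSubmodule ≤ hatGrading ρ N 0 := by
    refine Submodule.span_le.2 ?_
    rintro _ (⟨x, hx, rfl⟩ | rfl)
    · simpa using loopElem_mem_hatGrading (h.cartan_le x hx) N 0
    · exact central_mem_hatGrading ρ N
  exact hle hz

lemma IsPrincipal.hatPos_le (h : IsPrincipal H n ρ) {N : ℤ} (hN : IsLarge ρ N) :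
    (hatPos n).toSubmodule ≤ ⨆ (p : ℤ) (_ : 0 < p), hatGrading ρ N p := by
  refine Submodule.span_le.2 ?_
  rintro _ (⟨x, hx, rfl⟩ | ⟨x, k, hk, rfl⟩)
  · have hle : (⨆ (p : ℤ) (_ : 0 < p), adGrading ρ p) ≤
        (⨆ (p : ℤ) (_ : 0 < p), hatGrading ρ N p).comap (loopLin 0) := by
      refine iSup₂_le fun q hq y hy => Submodule.mem_iSup_of_mem q (Submodule.mem_iSup_of_mem hq ?_)
      simpa using loopElem_mem_hatGrading hy N 0
    exact hle (h.pos_le hx)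
  · have hle : (⨆ p : ℤ, adGrading ρ p) ≤
        (⨆ (p : ℤ) (_ : 0 < p), hatGrading ρ N p).comap (loopLin k) := by
      refine iSup_le fun q y hy => ?_
      by_cases hy0 : y = 0
      · rw [hy0]; exact zero_mem _
      have hq := hN.2 q fun hbot => hy0 (by rwa [hbot, Submodule.mem_bot] at hy)
      have hN0 := hN.1
      rw [abs_lt] at hq
      exact Submodule.mem_iSup_of_mem (q + N * k) (Submodule.mem_iSup_of_mem (by nlinarith)
        (loopElem_mem_hatGrading hy N k))
    exact hle (by rw [h.iSup_eq_top]; trivial)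

end Principal

/-! ### Smoothness of highest weight and Whittaker modules -/

section Smooth

variable {g : Type*} [LieRing g] [LieAlgebra ℂ g] {V : Type*} [AddCommGroup V] [Module ℂ V]
  [LieRingModule (Hat g) V] [LieModule ℂ (Hat g) V]

/-- The vectors killed by all `x ⊗ t^k` with `k` large are stable under `ĝ`. -/
lemma exists_lie_mem_smoothLayer {N : ℤ} {v : V} (hv : v ∈ smoothLayer (g := g) V N) (z : Hat g) :
    ∃ N', ⁅z, v⁆ ∈ smoothLayer (g := g) V N' := by
  induction z using hat_induction with
  | h0 => exact ⟨0, by rw [zero_lie]; exact zero_mem _⟩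
  | hl y l =>
    refine ⟨max N (max (N - l) (1 - l)), fun x k hk => ?_⟩
    simp only [max_le_iff] at hk
    rw [leibniz_lie, hv x k hk.1, lie_zero, add_zero, lie_loopElem, if_neg (by omega), zero_smul,
      add_zero]
    exact hv _ _ (by omega)
  | hK c =>
    refine ⟨N, fun x k hk => ?_⟩
    rw [leibniz_lie, lie_smul, lie_central, smul_zero, zero_lie, hv x k hk, lie_zero, add_zero]
  | ha z w hz hw =>
    obtain ⟨N₁, h₁⟩ := hz
    obtain ⟨N₂, h₂⟩ := hw
    refine ⟨max N₁ N₂, ?_⟩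
    rw [add_lie]
    exact add_mem (smoothLayer_mono (le_max_left _ _) h₁) (smoothLayer_mono (le_max_right _ _) h₂)

lemma isSmooth_of_lieSpan_eq_top {N : ℤ} {v : V} (hv : v ∈ smoothLayer (g := g) V N)
    (htop : LieSubmodule.lieSpan ℂ (Hat g) {v} = ⊤) : IsSmooth g V := by
  let S : LieSubmodule ℂ (Hat g) V :=
    { carrier := {v | ∃ N, v ∈ smoothLayer (g := g) V N}
      add_mem' := fun ⟨N₁, h₁⟩ ⟨N₂, h₂⟩ => ⟨max N₁ N₂,
        add_mem (smoothLayer_mono (le_max_left _ _) h₁) (smoothLayer_mono (le_max_right _ _) h₂)⟩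
      zero_mem' := ⟨0, zero_mem _⟩
      smul_mem' := fun c _ ⟨N, h⟩ => ⟨N, Submodule.smul_mem _ c h⟩
      lie_mem := fun {z _} ⟨_, h⟩ => exists_lie_mem_smoothLayer h z }
  have hle : LieSubmodule.lieSpan ℂ (Hat g) {v} ≤ S := by
    rw [LieSubmodule.lieSpan_le, Set.singleton_subset_iff]
    exact ⟨N, hv⟩
  exact fun w => hle (by rw [htop]; trivial)

variable {n : LieSubalgebra ℂ g}

lemma loopElem_mem_hatPos (x : g) {k : ℤ} (hk : 0 < k) : loopElem x k ∈ hatPos n :=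
  Submodule.subset_span (Or.inr ⟨x, k, hk, rfl⟩)

lemma IsIrredHighestWeight.isSmooth {H : LieSubalgebra ℂ (Hat g)} {γ : Module.Dual ℂ H}
    (h : IsIrredHighestWeight H (hatPos n) γ V) : IsSmooth g V := by
  obtain ⟨v, hv, htop⟩ := h.generated
  exact isSmooth_of_lieSpan_eq_top (N := 1)
    (fun x k hk => hv.annihilated _ (loopElem_mem_hatPos x (by omega))) htop

lemma span_lie_eq_top_of_isSimple [LieAlgebra.IsSimple ℂ g] :
    Submodule.span ℂ {x : g | ∃ y z : g, ⁅y, z⁆ = x} = ⊤ := by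
  have h : Submodule.span ℂ {x : g | ∃ y z : g, ⁅y, z⁆ = x} =
      (⁅(⊤ : LieIdeal ℂ g), (⊤ : LieIdeal ℂ g)⁆ : LieIdeal ℂ g).toSubmodule := by
    rw [LieSubmodule.lieIdeal_oper_eq_linear_span']
    simp
  rcases LieAlgebra.IsSimple.eq_bot_or_eq_top (R := ℂ)
    (⁅(⊤ : LieIdeal ℂ g), (⊤ : LieIdeal ℂ g)⁆ : LieIdeal ℂ g) with h0 | h1
  · refine absurd ⟨fun x y => ?_⟩ (LieAlgebra.IsSimple.non_abelian ℂ (L := g))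
    have hxy : ⁅x, y⁆ ∈ Submodule.span ℂ {x : g | ∃ y z : g, ⁅y, z⁆ = x} :=
      Submodule.subset_span ⟨x, y, rfl⟩
    rw [h, h0] at hxy
    exact hxy
  · rw [h, h1]
    rfl

/-- A Whittaker vector is killed by `x ⊗ t^k` for `k ≥ 2`, since `g` is perfect and a character
vanishes on `[y ⊗ t, z ⊗ t^{k-1}]`. -/
lemma IsIrredWhittaker.isSmooth [LieAlgebra.IsSimple ℂ g]
    {η : LieAlgebra.LieCharacter ℂ (hatPos n)} (h : IsIrredWhittaker (hatPos n) η V) :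
    IsSmooth g V := by
  obtain ⟨v, -, hv, htop⟩ := h.generated
  refine isSmooth_of_lieSpan_eq_top (N := 2) (fun x k hk => ?_) htop
  let A : g →ₗ[ℂ] V := (LieModule.toEnd ℂ (Hat g) V).toLinearMap.flip v ∘ₗ loopLin k
  have hA : ∀ x, A x = ⁅loopElem x k, v⁆ := fun _ => rfl
  have hker : Submodule.span ℂ {x : g | ∃ y z : g, ⁅y, z⁆ = x} ≤ LinearMap.ker A := by
    refine Submodule.span_le.2 ?_
    rintro _ ⟨y, z, rfl⟩
    have h1 := hv ⟨loopElem y 1, loopElem_mem_hatPos y one_pos⟩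
    have h2 := hv ⟨loopElem z (k - 1), loopElem_mem_hatPos z (by omega)⟩
    have h3 : loopElem ⁅y, z⁆ k = ⁅loopElem y 1, loopElem z (k - 1)⁆ := by
      rw [lie_loopElem, if_neg (by omega), zero_smul, add_zero, add_sub_cancel]
    rw [SetLike.mem_coe, LinearMap.mem_ker, hA, h3, lie_lie]
    dsimp only at h1 h2
    rw [h2, lie_smul, h1, lie_smul, h2, smul_comm, sub_self]
  have hx : x ∈ Submodule.span ℂ {x : g | ∃ y z : g, ⁅y, z⁆ = x} := by
    rw [span_lie_eq_top_of_isSimple]; trivial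
  exact hker hx

end Smooth

/-! ### Highest weight vectors as top vectors -/

section HighestWeight

open LieAlgebra

/-- A linear form on a subalgebra, extended by zero to a function on the whole Lie algebra. -/
def extendByZero {G : Type*} [LieRing G] [LieAlgebra ℂ G] {HH : LieSubalgebra ℂ G}
    (γ : Module.Dual ℂ HH) (z : G) : ℂ :=
  open Classical in if h : z ∈ HH then γ ⟨z, h⟩ else 0

lemma extendByZero_apply {G : Type*} [LieRing G] [LieAlgebra ℂ G] {HH : LieSubalgebra ℂ G}
    (γ : Module.Dual ℂ HH) {z : G} (h : z ∈ HH) : extendByZero γ z = γ ⟨z, h⟩ :=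
  dif_pos h

lemma IsHighestWeightVector.isTopVector {G : Type*} [LieRing G] [LieAlgebra ℂ G]
    {HH NN : LieSubalgebra ℂ G} {γ : Module.Dual ℂ HH} {M : Type*} [AddCommGroup M] [Module ℂ M]
    [LieRingModule G M] {v : M} (hv : IsHighestWeightVector HH NN γ v) {gr : ℤ → Submodule ℂ G}
    (hpos : ∀ {p : ℤ} {z : G}, 0 < p → z ∈ gr p → z ∈ NN) (hzero : ∀ {z : G}, z ∈ gr 0 → z ∈ HH) :
    IsTopVector gr (extendByZero γ) v :=
  ⟨fun hp hz => hv.annihilated _ (hpos hp hz), fun hz => by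
    rw [extendByZero_apply γ (hzero hz)]
    exact hv.weight ⟨_, hzero hz⟩⟩

variable {g : Type*} [LieRing g] [LieAlgebra ℂ g] {H n : LieSubalgebra ℂ g} {ρ : g}

/-- Schur's lemma for irreducible highest weight `g`-modules. -/
lemma IsIrredHighestWeight.end_eq_smul (hρ : IsPrincipal H n ρ) {lam : Module.Dual ℂ H}
    {M : Type*} [AddCommGroup M] [Module ℂ M] [LieRingModule g M] [LieModule ℂ g M]
    (h : IsIrredHighestWeight H n lam M) (φ : M →ₗ⁅ℂ, g⁆ M) : ∃ c : ℂ, ∀ v, φ v = c • v := by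
  obtain ⟨v, hv, -⟩ := h.generated
  have := h.irreducible
  have hT : IsDegreeOperator (adGrading ρ) (LieModule.toEnd ℂ g M ρ) := fun {p z} hz w => by
    rw [LieModule.toEnd_apply_apply, LieModule.toEnd_apply_apply, leibniz_lie, mem_adGrading.1 hz,
      smul_lie, add_comm]
  exact Affine.end_eq_smul hρ.isLieGrading
    (hv.isTopVector (fun hp hz => hρ.le_pos hp _ hz) (fun hz => hρ.le_cartan _ hz)) hv.ne_zero hT
    (hv.weight ⟨ρ, hρ.mem⟩) φ (fun w => φ.map_lie ρ w)

variable {V : Type*} [AddCommGroup V] [Module ℂ V] [LieRingModule (Hat g) V]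
  {W : Type*} [AddCommGroup W] [Module ℂ W] [LieRingModule (Hat g) W]
  {γ γ' : Module.Dual ℂ (hatCartan H)} {N : ℤ}

lemma IsHighestWeightVector.isTopVector_hat (hρ : IsPrincipal H n ρ) (hN : IsLarge ρ N) {v : V}
    (hv : IsHighestWeightVector (hatCartan H) (hatPos n) γ v) :
    IsTopVector (hatGrading ρ N) (extendByZero γ) v :=
  hv.isTopVector (fun hp hz => hρ.hatGrading_pos_le hN hp hz) fun hz => hρ.hatGrading_zero_le hN hz

variable [LieModule ℂ (Hat g) V]

/-- Irreducible highest weight modules contain no eigenvectors of `ñ₊` with a nonzero eigenvalue, as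
elements of positive degree act locally nilpotently. -/
lemma isEmpty_equiv_whittaker (hρ : IsPrincipal H n ρ) (hN : IsLarge ρ N)
    (hV : IsIrredHighestWeight (hatCartan H) (hatPos n) γ V)
    {η : LieAlgebra.LieCharacter ℂ (hatPos n)} (hη : η ≠ 0)
    (hW : IsIrredWhittaker (hatPos n) η W) : IsEmpty (V ≃ₗ⁅ℂ, Hat g⁆ W) := by
  refine ⟨fun e => hη (LieHom.ext fun x => ?_)⟩
  obtain ⟨v, hv, htop⟩ := hV.generated
  obtain ⟨w, hw0, hw, -⟩ := hW.generated
  let ε : W →ₗ⁅ℂ, Hat g⁆ V := e.symm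
  have hu0 : ε w ≠ 0 := fun h => hw0 (e.symm.injective (by rw [map_zero]; exact h))
  have hu : ∀ x : hatPos n, ⁅(x : Hat g), ε w⁆ = η x • ε w := fun x => by
    rw [← LieModuleHom.map_lie, hw, map_smul]
  have hzero : ∀ z ∈ ⨆ (p : ℤ) (_ : 0 < p), hatGrading ρ N p, ⁅z, ε w⁆ = 0 := by
    have hle : (⨆ (p : ℤ) (_ : 0 < p), hatGrading ρ N p) ≤
        LinearMap.ker ((LieModule.toEnd ℂ (Hat g) V).toLinearMap.flip (ε w)) := by
      refine iSup₂_le fun p hp z hz => ?_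
      have hz' := hu ⟨z, hρ.hatGrading_pos_le hN hp hz⟩
      have hc := eigenvalue_eq_zero_of_pos (hρ.isLieGrading_hat N) (hv.isTopVector_hat hρ hN) hp hz
        (by rw [htop]; trivial) hu0 hz'
      rw [hc, zero_smul] at hz'
      exact hz'
    exact fun z hz => hle hz
  have hx := hu x
  rw [hzero _ (hρ.hatPos_le hN x.2), eq_comm, smul_eq_zero] at hx
  exact hx.resolve_right hu0

/-- The degree operator of an irreducible highest weight module with an action of `d`. -/
lemma isDegreeOperator_of_graded {D : V →ₗ[ℂ] V}
    (hD : ∀ (z : Hat g) (w : V), D ⁅z, w⁆ = ⁅z, D w⁆ + ⁅deg g z, w⁆) :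
    IsDegreeOperator (hatGrading ρ N)
      (LieModule.toEnd ℂ (Hat g) V (loopElem ρ 0) + (N : ℂ) • D) := fun {p z} hz w => by
  rw [LinearMap.add_apply, LinearMap.add_apply, LieModule.toEnd_apply_apply,
    LieModule.toEnd_apply_apply, LinearMap.smul_apply, LinearMap.smul_apply, hD, ← smul_lie,
    ← mem_hatGrading.1 hz, add_lie, leibniz_lie, lie_add, lie_smul, smul_add, smul_lie]
  abel

lemma loopElem_mem_hatCartan (hρ : IsPrincipal H n ρ) : loopElem ρ 0 ∈ hatCartan H :=
  Submodule.subset_span (Or.inl ⟨ρ, hρ.mem, rfl⟩)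

lemma IsHighestWeightVector.gradedOperator_apply (hρ : IsPrincipal H n ρ) {v : V}
    (hv : IsHighestWeightVector (hatCartan H) (hatPos n) γ v) {D : V →ₗ[ℂ] V} (hDv : D v = 0) :
    (LieModule.toEnd ℂ (Hat g) V (loopElem ρ 0) + (N : ℂ) • D) v =
      γ ⟨_, loopElem_mem_hatCartan hρ⟩ • v := by
  rw [LinearMap.add_apply, LinearMap.smul_apply, hDv, smul_zero, add_zero]
  exact hv.weight ⟨_, loopElem_mem_hatCartan hρ⟩

/-- Graded irreducible highest weight modules are classified by their highest weights. -/
lemma IsGradedHighestWeight.nonempty_equiv_iff [LieModule ℂ (Hat g) W] (hρ : IsPrincipal H n ρ) (hN : IsLarge ρ N)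
    (hV : IsGradedHighestWeight H n γ V) (hW : IsGradedHighestWeight H n γ' W) :
    Nonempty (V ≃ₗ⁅ℂ, Hat g⁆ W) ↔ γ = γ' := by
  have := hV.isIrredHighestWeight.irreducible
  have := hW.isIrredHighestWeight.irreducible
  obtain ⟨D, v, hv, hDv, hD⟩ := hV.graded
  obtain ⟨D', w, hw, hDw, hD'⟩ := hW.graded
  have hgr := hρ.isLieGrading_hat N
  constructor
  · rintro ⟨e⟩
    let ε : W →ₗ⁅ℂ, Hat g⁆ V := e.symm
    have hεw : IsHighestWeightVector (hatCartan H) (hatPos n) γ' (ε w) :=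
      ⟨fun h => hw.ne_zero (e.symm.injective (by rw [map_zero]; exact h)),
        fun x => by rw [← LieModuleHom.map_lie, hw.weight, map_smul],
        fun x hx => by rw [← LieModuleHom.map_lie, hw.annihilated x hx, map_zero]⟩
    ext ⟨z, hz⟩
    have h := topVector_unique hgr (hv.isTopVector_hat hρ hN) hv.ne_zero
      (isDegreeOperator_of_graded hD) (hv.gradedOperator_apply hρ hDv) (hεw.isTopVector_hat hρ hN) hεw.ne_zero
      (hρ.hatCartan_le N hz)
    rwa [extendByZero_apply γ hz, extendByZero_apply γ' hz] at h
  · rintro rfl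
    exact lieEquiv_of_topVectors hgr (hv.isTopVector_hat hρ hN) hv.ne_zero
      (isDegreeOperator_of_graded hD) (hv.gradedOperator_apply hρ hDv) (hw.isTopVector_hat hρ hN) hw.ne_zero
      (isDegreeOperator_of_graded hD') (hw.gradedOperator_apply hρ hDw)

end HighestWeight

/-! ### The comparison of induced modules -/

section Comparison

lemma tensor_equiv {G M M' N N' : Type*} [LieRing G] [LieAlgebra ℂ G]
    [AddCommGroup M] [Module ℂ M] [LieRingModule G M] [LieModule ℂ G M]
    [AddCommGroup M'] [Module ℂ M'] [LieRingModule G M'] [LieModule ℂ G M']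
    [AddCommGroup N] [Module ℂ N] [LieRingModule G N] [LieModule ℂ G N]
    [AddCommGroup N'] [Module ℂ N'] [LieRingModule G N'] [LieModule ℂ G N']
    (e : M ≃ₗ⁅ℂ, G⁆ M') (e' : N ≃ₗ⁅ℂ, G⁆ N') :
    Nonempty (M ⊗[ℂ] N ≃ₗ⁅ℂ, G⁆ M' ⊗[ℂ] N') :=
  lieEquiv_of_bijective
    (TensorProduct.LieModule.map (e : M →ₗ⁅ℂ, G⁆ M') (e' : N →ₗ⁅ℂ, G⁆ N'))
    (TensorProduct.congr e.toLinearEquiv e'.toLinearEquiv).bijective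

variable {g : Type*} [LieRing g] [LieAlgebra ℂ g] {m m' : ℕ}
  {E : Fin m → Type*} [∀ i, AddCommGroup (E i)] [∀ i, Module ℂ (E i)]
  [∀ i, LieRingModule g (E i)] [∀ i, LieModule ℂ g (E i)]
  {E' : Fin m' → Type*} [∀ i, AddCommGroup (E' i)] [∀ i, Module ℂ (E' i)]
  [∀ i, LieRingModule g (E' i)] [∀ i, LieModule ℂ g (E' i)]
  {V : Type*} [AddCommGroup V] [Module ℂ V] [LieRingModule (Hat g) V] [LieModule ℂ (Hat g) V]
  {V' : Type*} [AddCommGroup V'] [Module ℂ V'] [LieRingModule (Hat g) V']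
  [LieModule ℂ (Hat g) V']

/-- The isomorphism class of `(E(λ, a) ⊗ V)[d]` determines, and is determined by, those of the two
factors, for all smooth irreducible `V`. -/
lemma nonempty_withD_equiv_iff {a : Fin m → ℂˣ} {a' : Fin m' → ℂˣ} (ha : Function.Injective a)
    (ha' : Function.Injective a')
    (hE : ∀ i, LieModule.IsIrreducible ℂ g (E i)) (hE' : ∀ i, LieModule.IsIrreducible ℂ g (E' i))
    (hEnd : ∀ i, ∀ φ : E i →ₗ⁅ℂ, g⁆ E i, ∃ c : ℂ, ∀ v, φ v = c • v)
    (hEnd' : ∀ i, ∀ φ : E' i →ₗ⁅ℂ, g⁆ E' i, ∃ c : ℂ, ∀ v, φ v = c • v)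
    (hV : LieModule.IsIrreducible ℂ (Hat g) V) (hV' : LieModule.IsIrreducible ℂ (Hat g) V')
    (hsV : IsSmooth g V) (hsV' : IsSmooth g V') :
    Nonempty (WithD g (EvalModule E a ⊗[ℂ] V) ≃ₗ⁅ℂ, Tilde g⁆
        WithD g (EvalModule E' a' ⊗[ℂ] V')) ↔
      Nonempty (EvalModule E a ≃ₗ⁅ℂ, Hat g⁆ EvalModule E' a') ∧
        Nonempty (V ≃ₗ⁅ℂ, Hat g⁆ V') := by
  constructor
  · rintro ⟨e⟩
    have : ∀ i, Nontrivial (E i) := fun i => nontrivial_of_isIrreducible (G := g)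
    have : ∀ i, Nontrivial (E' i) := fun i => nontrivial_of_isIrreducible (G := g)
    have := nontrivial_evalModule (V := E) a
    have := nontrivial_evalModule (V := E') a'
    have := (isLoopDense_evalModule a ha hEnd).irreducible_tensor hsV
    have := (isLoopDense_evalModule a' ha' hEnd').irreducible_tensor hsV'
    have : Nontrivial (EvalModule E' a' ⊗[ℂ] V') := nontrivial_of_isIrreducible (G := Hat g)
    obtain ⟨φ, hφ⟩ := exists_hom_of_withD_equiv e
    exact equiv_of_tensor_hom a a' ha ha' hEnd hEnd' hsV hsV' φ hφ
  · rintro ⟨⟨e⟩, ⟨e'⟩⟩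
    obtain ⟨ε⟩ := tensor_equiv e e'
    exact induced_equiv (hatIncl g) ε

end Comparison

end Affine

end

theorem theorem6p3 {g : Type uG} [LieRing g] [LieAlgebra ℂ g]
    [FiniteDimensional ℂ g] [LieAlgebra.IsSimple ℂ g]
    (H : LieSubalgebra ℂ g) [H.IsCartanSubalgebra]
    (b : (LieAlgebra.IsKilling.rootSystem H).Base)
    -- the data of `E(λ, a)`, with `λ ≠ 0`
    {m : ℕ} (lam : Fin m → Module.Dual ℂ H) (hlam : lam ≠ 0)
    (a : Fin m → ℂˣ) (ha : Function.Injective a)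
    (E : Fin m → Type uE) [∀ i, AddCommGroup (E i)] [∀ i, Module ℂ (E i)]
    [∀ i, LieRingModule g (E i)] [∀ i, LieModule ℂ g (E i)]
    (hE : ∀ i, IsIrredHighestWeight H (nPlus H b) (lam i) (E i))
    -- the data of `E(λ', a')`
    {m' : ℕ} (lam' : Fin m' → Module.Dual ℂ H)
    (a' : Fin m' → ℂˣ) (ha' : Function.Injective a')
    (E' : Fin m' → Type uE') [∀ i, AddCommGroup (E' i)] [∀ i, Module ℂ (E' i)]
    [∀ i, LieRingModule g (E' i)] [∀ i, LieModule ℂ g (E' i)]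
    (hE' : ∀ i, IsIrredHighestWeight H (nPlus H b) (lam' i) (E' i)) :
    -- (1) no isomorphism between the two families, for any irreducible highest weight module `V`
    (∀ (γ : Module.Dual ℂ (hatCartan H))
      (η : LieAlgebra.LieCharacter ℂ (hatPos (nPlus H b)))
      (V : Type uV) [AddCommGroup V] [Module ℂ V] [LieRingModule (Hat g) V]
      [LieModule ℂ (Hat g) V]
      (W : Type uV') [AddCommGroup W] [Module ℂ W] [LieRingModule (Hat g) W]
      [LieModule ℂ (Hat g) W],
      IsIrredHighestWeight (hatCartan H) (hatPos (nPlus H b)) γ V →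
      η ≠ 0 → IsIrredWhittaker (hatPos (nPlus H b)) η W →
      IsEmpty (WithD g (EvalModule E a ⊗[ℂ] V) ≃ₗ⁅ℂ, Tilde g⁆
        WithD g (EvalModule E' a' ⊗[ℂ] W))) ∧
    -- (2) the highest weight family: isomorphism of arbitrary irreducible highest weight modules,
    -- and the criterion in terms of the highest weights for the modules `V(γ)`
    (∀ (γ γ' : Module.Dual ℂ (hatCartan H))
      (V : Type uV) [AddCommGroup V] [Module ℂ V] [LieRingModule (Hat g) V]
      [LieModule ℂ (Hat g) V]
      (V' : Type uV') [AddCommGroup V'] [Module ℂ V'] [LieRingModule (Hat g) V']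
      [LieModule ℂ (Hat g) V'],
      (IsIrredHighestWeight (hatCartan H) (hatPos (nPlus H b)) γ V →
        IsIrredHighestWeight (hatCartan H) (hatPos (nPlus H b)) γ' V' →
        (Nonempty (WithD g (EvalModule E a ⊗[ℂ] V) ≃ₗ⁅ℂ, Tilde g⁆
            WithD g (EvalModule E' a' ⊗[ℂ] V')) ↔
          Nonempty (EvalModule E a ≃ₗ⁅ℂ, Hat g⁆ EvalModule E' a') ∧
            Nonempty (V ≃ₗ⁅ℂ, Hat g⁆ V'))) ∧
      (IsGradedHighestWeight H (nPlus H b) γ V →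
        IsGradedHighestWeight H (nPlus H b) γ' V' →
        (Nonempty (WithD g (EvalModule E a ⊗[ℂ] V) ≃ₗ⁅ℂ, Tilde g⁆
            WithD g (EvalModule E' a' ⊗[ℂ] V')) ↔
          Nonempty (EvalModule E a ≃ₗ⁅ℂ, Hat g⁆ EvalModule E' a') ∧
            γ = γ'))) ∧
    -- (3) the Whittaker family
    (∀ (η η' : LieAlgebra.LieCharacter ℂ (hatPos (nPlus H b)))
      (W : Type uV) [AddCommGroup W] [Module ℂ W] [LieRingModule (Hat g) W]
      [LieModule ℂ (Hat g) W]
      (W' : Type uV') [AddCommGroup W'] [Module ℂ W'] [LieRingModule (Hat g) W']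
      [LieModule ℂ (Hat g) W'],
      η ≠ 0 → η' ≠ 0 →
      IsIrredWhittaker (hatPos (nPlus H b)) η W →
      IsIrredWhittaker (hatPos (nPlus H b)) η' W' →
      (Nonempty (WithD g (EvalModule E a ⊗[ℂ] W) ≃ₗ⁅ℂ, Tilde g⁆
          WithD g (EvalModule E' a' ⊗[ℂ] W')) ↔
        Nonempty (EvalModule E a ≃ₗ⁅ℂ, Hat g⁆ EvalModule E' a') ∧
          Nonempty (W ≃ₗ⁅ℂ, Hat g⁆ W'))) := by
  obtain ⟨ρ, hρ⟩ := exists_isPrincipal H b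
  obtain ⟨N, hN⟩ := exists_isLarge ρ
  have hiff {V : Type uV} [AddCommGroup V] [Module ℂ V] [LieRingModule (Hat g) V]
      [LieModule ℂ (Hat g) V] {V' : Type uV'} [AddCommGroup V'] [Module ℂ V']
      [LieRingModule (Hat g) V'] [LieModule ℂ (Hat g) V']
      (hV : LieModule.IsIrreducible ℂ (Hat g) V) (hV' : LieModule.IsIrreducible ℂ (Hat g) V')
      (hsV : IsSmooth g V) (hsV' : IsSmooth g V') :=
    nonempty_withD_equiv_iff ha ha' (fun i => (hE i).irreducible) (fun i => (hE' i).irreducible)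
      (fun i => (hE i).end_eq_smul hρ) (fun i => (hE' i).end_eq_smul hρ) hV hV' hsV hsV'
  refine ⟨fun γ η V _ _ _ _ W _ _ _ _ hV hη hW => ⟨fun e => ?_⟩,
    fun γ γ' V _ _ _ _ V' _ _ _ _ => ⟨fun hV hV' => ?_, fun hV hV' => ?_⟩,
    fun η η' W _ _ _ _ W' _ _ _ _ _ _ hW hW' => ?_⟩
  · obtain ⟨-, ⟨e'⟩⟩ := (hiff hV.irreducible hW.irreducible hV.isSmooth hW.isSmooth).1 ⟨e⟩
    exact (isEmpty_equiv_whittaker hρ hN hV hη hW).false e'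
  · exact hiff hV.irreducible hV'.irreducible hV.isSmooth hV'.isSmooth
  · have h := hV.isIrredHighestWeight
    have h' := hV'.isIrredHighestWeight
    rw [← hV.nonempty_equiv_iff hρ hN hV']
    exact hiff h.irreducible h'.irreducible h.isSmooth h'.isSmooth
  · exact hiff hW.irreducible hW'.irreducible hW.isSmooth hW'.isSmooth
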